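/- **The cd-index of rank 2 matroid base polytopes.** For a convex polytope $Q$ of dimension $m$ let $P$ be its face poset (including $\emptyset$ and $Q$), graded of rank $m+1$. For $S\subseteq[m]$ let $f_P(S)$ be the number of chains in $P\setminus\{\emptyset,Q\}$ whose set of ranks is exactly $S$, let $h_P(S)=\sum_{T\subseteq S}(-1)^{|S\setminus T|}f_P(T)$, and let $$\Psi(Q)=\sum_{S\subseteq[m]}h_P(S)\,u_S\in\mathbb Z\langle \mathbf a,\mathbf b\rangle ,$$ where $u_S=u_1\cdots u_m$ with $u_i=\mathbf b$ if $i\in S$ and $u_i=\mathbf a$ if $i\notin S$. When $\Psi(Q)$ is a noncommutative polynomial with integer coefficients in $\mathbf c=\mathbf a+\mathbf b$ and $\mathbf d=\mathbf a\mathbf b+\mathbf b\mathbf a$, it is called the $\mathbf c\mathbf d$-index of $Q$. For a composition $\alpha=(\alpha_1,\dots,\alpha_k)$ of $n$ (positive parts, length $\ell(\alpha)=k\ge 2$) let $M_\alpha$ be the loopless rank 2 matroid on $n$ elements whose parallelism classes have sizes $\alpha_1,\dots,\alpha_k$, and let $Q(M_\alpha)\subset\mathbb R^n$ be its matroid base polytope,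 the convex hull of the incidence vectors of its bases. Let $\Delta_m$ be the $(m-1)$-dimensional simplex. Put $$\lambda(\alpha,i)=\Bigl(\sum_{j<i}\alpha_j,\ \alpha_i,\ \sum_{j>i}\alpha_j\Bigr)\quad(2\le i\le \ell(\alpha)-1),\qquad \mu(\alpha,i)=\Bigl(\sum_{j\le i}\alpha_j,\ \sum_{j>i}\alpha_j\Bigr)\quad(1\le i\le \ell(\alpha)-1).$$ For weak compositions $\beta$ (parts may be $0$) of length $\ell(\alpha)$ write $\beta<\alpha$ if $\beta_j\le\alpha_j$ for all $j$ and $\beta\ne\alpha$; let $\bar\beta$ be the composition obtained from $\beta$ by deleting its zero parts, and $|\bar\beta|$ the sum of its parts. Let $\alpha$ be a composition of $n$ with at least three parts. Then $\Psi(Q(M_\alpha))$, $\Psi(Q(M_{\lambda(\alpha,i)}))$ for $2\le i\le\ell(\alpha)-1$, $\Psi(\Delta_p\times\Delta_q)$ and $\Psi(\Delta_m)$ for $p,q,m\ge1$ are polynomials in $\mathbf c$ and $\mathbf d$ (that is, the $\mathbf c\mathbf d$-indices exist), and $$\begin{aligned}\Psi(Q(M_\alpha))={}&\sum_{i=2}^{\ell(\alpha)-1}\Psi\bigl(Q(M_{\lambda(\alpha,i)})\bigr)-\Bigl(\sum_{i=2}^{\ell(\alpha)-2}\Psi\bigl(\Delta_{\mu(\alpha,i)_1}\times\Delta_{\mu(\alpha,i)_2}\bigr)\Bigr)\cdot\mathbf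 c\\&-\sum_{\substack{\beta<\alpha\\ \ell(\bar\beta)\ge4}}\ \prod_{j=1}^{\ell(\alpha)}\binom{\alpha_j}{\beta_j}\Bigl(\sum_{i=2}^{\ell(\bar\beta)-2}\Psi\bigl(\Delta_{\mu(\bar\beta,i)_1}\times\Delta_{\mu(\bar\beta,i)_2}\bigr)\Bigr)\cdot\mathbf d\cdot\Psi(\Delta_{n-|\bar\beta|}).\end{aligned}$$ -/

import Mathlib

open scoped BigOperators

noncomputable section

namespace RankTwoCD

/-! ### The `ab`-index of a finite graded poset, and polynomials in `c` and `d` -/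

/-- The two noncommuting variables `a` and `b`. -/
inductive ABVar
  | a
  | b

/-- The ring `ℤ⟨a, b⟩` of noncommutative polynomials. -/
abbrev ABPoly : Type := FreeAlgebra ℤ ABVar

/-- The variable `a`. -/
def aVar : ABPoly := FreeAlgebra.ι ℤ ABVar.a

/-- The variable `b`. -/
def bVar : ABPoly := FreeAlgebra.ι ℤ ABVar.b

/-- `c = a + b`. -/
def cVar : ABPoly := aVar + bVar

/-- `d = ab + ba`. -/
def dVar : ABPoly := aVar * bVar + bVar * aVar

/-- The noncommutative polynomials in `c` and `d`, as a subring of `ℤ⟨a, b⟩`. -/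
def cdPolynomials : Subalgebra ℤ ABPoly := Algebra.adjoin ℤ {cVar, dVar}

section Flag

variable (P : Type*) [PartialOrder P] [BoundedOrder P]

/-- The rank `ρ(x)` of an element of a finite graded poset with `0̂` and `1̂`:
the maximal length of a chain that ends in `x`. -/
def rk {P : Type*} [PartialOrder P] (x : P) : ℕ := (Order.height x).toNat

/-- The number `m` such that the graded poset `P` has rank `m + 1`. -/
def innerRank : ℕ := rk (⊤ : P) - 1

/-- The flag `f`-vector: the number of chains of elements strictly between `0̂` and `1̂` whose
set of ranks is exactly `S`. -/
def flagF (S : Finset ℕ) : ℕ :=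
  Set.ncard {C : Set P | IsChain (· ≤ ·) C ∧ ⊥ ∉ C ∧ ⊤ ∉ C ∧ rk '' C = (S : Set ℕ)}

/-- The flag `h`-vector. -/
def flagH (S : Finset ℕ) : ℤ :=
  ∑ T ∈ S.powerset, (-1 : ℤ) ^ (S \ T).card * (flagF P T : ℤ)

/-- The monomial `u_S = u_1 ⋯ u_m`, with `u_i = b` for `i ∈ S` and `u_i = a` for `i ∉ S`. -/
def abMonomial (m : ℕ) (S : Finset ℕ) : ABPoly :=
  ((List.range m).map fun i => if i + 1 ∈ S then bVar else aVar).prod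

/-- The `ab`-index `Ψ(P) = ∑_{S ⊆ [m]} h_P(S) u_S` of a finite graded poset of rank `m + 1`.
When it is a polynomial in `c` and `d`, it is the `cd`-index of `P`. -/
def abIndex : ABPoly :=
  ∑ S ∈ (Finset.Icc 1 (innerRank P)).powerset, flagH P S • abMonomial (innerRank P) S

end Flag

/-! ### Polytopes -/

section Polytope

variable {E : Type*} [AddCommGroup E] [Module ℝ E] [TopologicalSpace E]

/-- The face poset of a polytope `Q`, ordered by inclusion: the empty face and all subsets of `Q`
on which some linear form attains its maximum over `Q` (in particular `Q` itself). -/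
def FacePoset (Q : Set E) : Type _ := {F : Set E // IsExposed ℝ Q F}

instance (Q : Set E) : PartialOrder (FacePoset Q) :=
  inferInstanceAs (PartialOrder {F : Set E // IsExposed ℝ Q F})

instance (Q : Set E) : BoundedOrder (FacePoset Q) where
  top := ⟨Q, IsExposed.refl Q⟩
  le_top F := F.2.subset
  bot := ⟨∅, isExposed_empty⟩
  bot_le F := Set.empty_subset F.1

/-- `Ψ(Q)` for a polytope `Q`: the `cd`-index of its face poset, as an element
of `ℤ⟨c, d⟩ ⊆ ℤ⟨a, b⟩`. -/
def psi (Q : Set E) : ABPoly := abIndex (FacePoset Q)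

end Polytope

/-- `Δ_m`, the `(m - 1)`-dimensional simplex with `m` vertices. -/
def simplex (m : ℕ) : Set (Fin m → ℝ) := stdSimplex ℝ (Fin m)

/-! ### Matroid base polytopes and rank two matroids -/

open Classical in
/-- The incidence vector `e_B` of a subset `B` of the ground set. -/
def incidence {ι : Type*} (B : Set ι) : ι → ℝ := fun i => if i ∈ B then 1 else 0

/-- The matroid base polytope `Q(M)`: the convex hull of the incidence vectors of the bases. -/
def basePolytope {ι : Type*} (M : Matroid ι) : Set (ι → ℝ) :=
  convexHull ℝ {x | ∃ B : Set ι, M.IsBase B ∧ x = incidence B}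

/-- The loopless matroid of rank (at most) two on a finite set `ι` whose parallelism classes are
the nonempty fibres of `f`: a set is independent if it has at most two elements
and no two of its elements lie in the same fibre. -/
def rankTwoMatroid {ι κ : Type*} [Finite ι] (f : ι → κ) : Matroid ι :=
  (IndepMatroid.ofFinite (E := Set.univ) Set.finite_univ
    (fun I => Set.InjOn f I ∧ I.ncard ≤ 2)
    ⟨Set.injOn_empty f, by simp⟩
    (fun I J hJ hIJ => ⟨hJ.1.mono hIJ, (Set.ncard_le_ncard hIJ J.toFinite).trans hJ.2⟩)
    (by
      intro I J hI hJ hlt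
      have h : (f '' I).ncard < (f '' J).ncard := by
        rwa [hI.1.ncard_image, hJ.1.ncard_image]
      obtain ⟨_, ⟨e, he, rfl⟩, hn⟩ :=
        Set.exists_mem_notMem_of_ncard_lt_ncard h (I.toFinite.image f)
      have heI : e ∉ I := fun h' => hn (Set.mem_image_of_mem f h')
      refine ⟨e, he, heI, (Set.injOn_insert heI).2 ⟨hI.1, hn⟩, ?_⟩
      rw [Set.ncard_insert_of_notMem heI I.toFinite]
      have := hJ.2
      omega)
    (fun _ _ => Set.subset_univ _)).matroid

/-- A ground set with `α_1 + ⋯ + α_k` elements, partitioned into classes `P_1, …, P_k`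
with `|P_j| = α_j`. -/
abbrev Ground (α : List ℕ) : Type := Σ j : Fin α.length, Fin (α.get j)

/-- The matroid `M_α` of rank two with parallelism classes of sizes `α_1, …, α_k`. -/
def matroidOf (α : List ℕ) : Matroid (Ground α) :=
  rankTwoMatroid (fun x : Ground α => x.1)

/-! ### Compositions (lists of parts; the parts are numbered from `1`) -/

/-- `λ(α, i) = (α_1 + ⋯ + α_{i-1}, α_i, α_{i+1} + ⋯ + α_k)`, for `2 ≤ i ≤ k - 1`. -/
def lam (α : List ℕ) (i : ℕ) : List ℕ :=
  [(α.take (i - 1)).sum, α.getD (i - 1) 0, (α.drop i).sum]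

/-- `μ(α, i)_1 = α_1 + ⋯ + α_i`. -/
def mu₁ (α : List ℕ) (i : ℕ) : ℕ := (α.take i).sum

/-- `μ(α, i)_2 = α_{i+1} + ⋯ + α_k`. -/
def mu₂ (α : List ℕ) (i : ℕ) : ℕ := (α.drop i).sum

/-- The composition `β̄` obtained from the weak composition `β` by deleting its zero parts. -/
def deleteZeros {k : ℕ} (β : Fin k → ℕ) : List ℕ := (List.ofFn β).filter (· ≠ 0)

end RankTwoCD

end

open scoped BigOperators

noncomputable section

namespace RankTwoCD

open Finset

set_option linter.unusedSectionVars false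

/-! ### Saturation of the ring of `cd`-polynomials -/

/-! Geometrically, the coordinates of a point of `Q(M_α)` sum to 2, and the hyperplanes on which the
coordinates of the first `i` classes sum to 1 (for `2 ≤ i ≤ ℓ(α) - 2`) cut `Q(M_α)` into the pieces
`Q(M_{λ(α,i)})`, glued in a row along walls that are products of two simplices. The formula compares
chains of faces before and after the cutting. The proof carries out this count on face posets and
never needs the subdivision itself.

With `e = a - b`, the `ab`-index becomes an unsigned sum over chains, with a `b` at each rank used
and an `e` elsewhere. Splitting off the largest element of a chain gives a recursion over lower
intervals that determines `Ψ` (`abIndex_eq_of_recursion`), and it may be solved in any model of the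
face poset (`psi_convexHull_eq`). For a rank two matroid with at least three classes the nonempty
faces are the products `Δ_A × Δ_B`, with `A` or `B` inside a class that misses the other set, and
the "big" faces, one for each set `S` that meets at least three classes. A chain below a big face
`U` is cut at its smallest big member `S` (with `U` itself allowed): product faces lie below `S`, a
Boolean interval above. Hence `Ψ` is the sum of `splitWeight f S * upperWeight U S`, which is
`bigCD`.

The heart is `card_pieces`: for a pair `(A, B)` inside a big `S`, the number of pieces in which it
is a face of product type equals the number of walls that contain it, plus 1 if it is such a face of
the whole polytope, plus 1 if it is an inner pair, that is, itself a wall for the classes that meet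
`A ∪ B`. Summed over pairs, this gives `splitWeight_splitting`, where a wall of `S` carries the
letter `a` and a wall of a subset `T` carries `b e^(|S| - |T|)`. After multiplication by the upper
weights and summation over `S`, a wall of `T ≠ U` collects `ab + ba = d` followed by the index of a
simplex, and a wall of `U` collects `a + b = c` (`bigCD_splitting`). Grouping the sets `T` by the
numbers of their elements in the classes produces the binomial coefficients.

Existence of the `cd`-index: Euler's relations turn the recursion into its mirror image under `a ↔
b`. The sum of the two puts `2Ψ` into `ℤ⟨c, d⟩`, and halving stays inside this ring
(`mem_cd_of_eulerian`, `mem_cd_of_add_self`). -/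

/-- The variable `e = a - b`; the `ab`-index is a sum over chains of words in `b` and `e`. -/
def eVar : ABPoly := aVar - bVar

theorem aVar_eq : aVar = eVar + bVar := by simp [eVar]

theorem eVar_ne_zero : eVar ≠ 0 := by
  intro h
  have := congrArg (FreeAlgebra.lift ℤ (fun x : ABVar => match x with | .a => (1 : ℤ) | .b => 0)) h
  simp [eVar, aVar, bVar] at this

theorem cVar_mem : cVar ∈ cdPolynomials := Algebra.subset_adjoin (by simp)

theorem dVar_mem : dVar ∈ cdPolynomials := Algebra.subset_adjoin (by simp)

/-- The algebra map `x ↦ [[ε(x), ∂x], [0, x]]`, where `∂` is the twisted derivation with the given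
values on the variables. -/
def leftQuotientMatrix (t : ABVar → ABPoly) : ABPoly →ₐ[ℤ] Matrix (Fin 2) (Fin 2) ABPoly :=
  FreeAlgebra.lift ℤ fun x => !![0, t x; 0, FreeAlgebra.ι ℤ x]

/-- The twisted derivation with the given values on the variables. -/
def leftQuotient (t : ABVar → ABPoly) : ABPoly →+ ABPoly where
  toFun w := leftQuotientMatrix t w 0 1
  map_zero' := by simp
  map_add' := by simp

theorem leftQuotientMatrix_one_one (t : ABVar → ABPoly) (w : ABPoly) :
    leftQuotientMatrix t w 1 0 = 0 ∧ leftQuotientMatrix t w 1 1 = w := by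
  induction w using FreeAlgebra.induction with
  | grade0 r =>
    rw [AlgHom.commutes, Matrix.algebraMap_matrix_apply, Matrix.algebraMap_matrix_apply]
    exact ⟨if_neg (by decide), if_pos rfl⟩
  | grade1 x => simp [leftQuotientMatrix]
  | mul x y hx hy => simp [Matrix.mul_apply, hx, hy]
  | add x y hx hy => simp [hx, hy]

theorem leftQuotient_algebraMap (t : ABVar → ABPoly) (k : ℤ) :
    leftQuotient t (algebraMap ℤ ABPoly k) = 0 := by
  change leftQuotientMatrix t _ 0 1 = 0
  rw [AlgHom.commutes, Matrix.algebraMap_matrix_apply]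
  exact if_neg (by decide)

/-- The upper right entry of a product is `ε(v) ∂w + (∂v) w`, and `ε` kills letters. If `t` is the
indicator of one letter, this strips that letter from the front of a word and kills the words that
begin with the other one. -/
theorem leftQuotient_var_mul (t : ABVar → ABPoly) (x : ABVar) (w : ABPoly) :
    leftQuotient t (FreeAlgebra.ι ℤ x * w) = t x * w := by
  have h : leftQuotientMatrix t (FreeAlgebra.ι ℤ x) = !![0, t x; 0, FreeAlgebra.ι ℤ x] := by
    simp [leftQuotientMatrix]
  simp [leftQuotient, Matrix.mul_apply, h, leftQuotientMatrix_one_one]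

/-- Polynomials in `c` and `d` built from words with at most `n` letters. -/
def IsCD : ℕ → ABPoly → Prop
  | 0, w => ∃ k : ℤ, w = algebraMap ℤ ABPoly k
  | n + 1, w => ∃ (k : ℤ) (x y : ABPoly), IsCD n x ∧ IsCD n y ∧
      w = algebraMap ℤ ABPoly k + cVar * x + dVar * y

theorem isCD_algebraMap (n : ℕ) (k : ℤ) : IsCD n (algebraMap ℤ ABPoly k) := by
  induction n generalizing k with
  | zero => exact ⟨k, rfl⟩
  | succ n ih => exact ⟨k, 0, 0, by simpa using ih 0, by simpa using ih 0, by simp⟩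

theorem IsCD.succ {n : ℕ} {w : ABPoly} (h : IsCD n w) : IsCD (n + 1) w := by
  induction n generalizing w with
  | zero => obtain ⟨k, rfl⟩ := h; exact isCD_algebraMap _ _
  | succ n ih => obtain ⟨k, x, y, hx, hy, rfl⟩ := h; exact ⟨k, x, y, ih hx, ih hy, rfl⟩

theorem IsCD.mono {n m : ℕ} (hnm : n ≤ m) {w : ABPoly} (h : IsCD n w) : IsCD m w := by
  induction m, hnm using Nat.le_induction with
  | base => exact h
  | succ m _ ih => exact ih.succ

theorem IsCD.add {n : ℕ} {v w : ABPoly} (hv : IsCD n v) (hw : IsCD n w) : IsCD n (v + w) := by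
  induction n generalizing v w with
  | zero =>
    obtain ⟨k, rfl⟩ := hv
    obtain ⟨l, rfl⟩ := hw
    exact ⟨k + l, by simp⟩
  | succ n ih =>
    obtain ⟨k, x, y, hx, hy, rfl⟩ := hv
    obtain ⟨k', x', y', hx', hy', rfl⟩ := hw
    exact ⟨k + k', x + x', y + y', ih hx hx', ih hy hy', by rw [map_add]; noncomm_ring⟩

theorem IsCD.algebraMap_mul {n : ℕ} {w : ABPoly} (k : ℤ) (hw : IsCD n w) :
    IsCD n (algebraMap ℤ ABPoly k * w) := by
  induction n generalizing w with
  | zero => obtain ⟨l, rfl⟩ := hw; exact ⟨k * l, by simp⟩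
  | succ n ih =>
    obtain ⟨l, x, y, hx, hy, rfl⟩ := hw
    refine ⟨k * l, _, _, ih hx, ih hy, ?_⟩
    rw [mul_add, mul_add, map_mul, ← mul_assoc, ← mul_assoc, ← mul_assoc, ← mul_assoc,
      Algebra.commutes k cVar, Algebra.commutes k dVar]

theorem IsCD.mul {n : ℕ} {v : ABPoly} (hv : IsCD n v) :
    ∀ {m : ℕ} {w : ABPoly}, IsCD m w → IsCD (n + m) (v * w) := by
  induction n generalizing v with
  | zero => obtain ⟨k, rfl⟩ := hv; intro m w hw; simpa using hw.algebraMap_mul k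
  | succ n ih =>
    obtain ⟨k, x, y, hx, hy, rfl⟩ := hv
    intro m w hw
    have h1 : IsCD (n + 1 + m) (algebraMap ℤ ABPoly k * w) :=
      (hw.algebraMap_mul k).mono (by omega)
    have h2 : IsCD (n + m + 1) (cVar * (x * w) + dVar * (y * w)) :=
      ⟨0, _, _, ih hx hw, ih hy hw, by simp⟩
    have := h1.add (h2.mono (by omega))
    convert this using 1
    noncomm_ring

theorem mem_cdPolynomials_iff {w : ABPoly} : w ∈ cdPolynomials ↔ ∃ n, IsCD n w := by
  constructor
  · intro h
    induction h using Algebra.adjoin_induction with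
    | mem x hx =>
      have h1 : IsCD 0 (1 : ABPoly) := ⟨1, by simp⟩
      have h0 : IsCD 0 (0 : ABPoly) := ⟨0, by simp⟩
      rcases hx with rfl | rfl
      · exact ⟨1, 0, 1, 0, h1, h0, by simp⟩
      · exact ⟨1, 0, 0, 1, h0, h1, by simp⟩
    | algebraMap r => exact ⟨0, r, rfl⟩
    | add x y _ _ hx hy =>
      obtain ⟨n, hn⟩ := hx
      obtain ⟨m, hm⟩ := hy
      exact ⟨max n m, (hn.mono (le_max_left _ _)).add (hm.mono (le_max_right _ _))⟩
    | mul x y _ _ hx hy =>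
      obtain ⟨n, hn⟩ := hx
      obtain ⟨m, hm⟩ := hy
      exact ⟨_, hn.mul hm⟩
  · rintro ⟨n, hn⟩
    induction n generalizing w with
    | zero => obtain ⟨k, rfl⟩ := hn; exact Subalgebra.algebraMap_mem _ _
    | succ n ih =>
      obtain ⟨k, x, y, hx, hy, rfl⟩ := hn
      exact add_mem (add_mem (Subalgebra.algebraMap_mem _ _) (mul_mem cVar_mem (ih hx)))
        (mul_mem dVar_mem (ih hy))

theorem two_mul_cancel {v w : ABPoly} (h : v + v = w + w) : v = w := by
  have h2 : (algebraMap ℤ ABPoly 2) * (v - w) = 0 := by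
    rw [map_ofNat, two_mul]
    rw [show v - w + (v - w) = v + v - (w + w) by abel, h, sub_self]
  rcases mul_eq_zero.1 h2 with h3 | h3
  · rw [FreeAlgebra.algebraMap_eq_zero_iff] at h3
    omega
  · exact sub_eq_zero.1 h3

/-- Write `2w = k + c x + d y`. Stripping a leading `a` leaves `x + b y`, and stripping a leading
`b` leaves `x + a y`. Stripping `b` from the difference isolates `y`, so `y` and then `x` are twice
explicit polynomials, to which induction applies; `k` is twice the constant term of `w`. -/
theorem IsCD.of_two_mul {n : ℕ} {w : ABPoly} (h : IsCD n (w + w)) : IsCD n w := by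
  induction n generalizing w with
  | zero =>
    obtain ⟨k, hk⟩ := h
    have h1 := congrArg (FreeAlgebra.algebraMapInv (R := ℤ)) hk
    rw [map_add, FreeAlgebra.algebraMap_leftInverse] at h1
    exact ⟨FreeAlgebra.algebraMapInv w, two_mul_cancel (by rw [hk, ← h1, map_add])⟩
  | succ n ih =>
    obtain ⟨k, x, y, hx, hy, hw⟩ := h
    have h1 := congrArg (FreeAlgebra.algebraMapInv (R := ℤ)) hw
    simp only [map_add, map_mul, FreeAlgebra.algebraMap_leftInverse k, cVar, dVar] at h1
    have h1' : FreeAlgebra.algebraMapInv w + FreeAlgebra.algebraMapInv w = k := by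
      simpa [aVar, bVar, FreeAlgebra.algebraMapInv] using h1
    set p := leftQuotient (fun z => match z with | .a => 1 | .b => 0) with hp
    set q := leftQuotient (fun z => match z with | .a => 0 | .b => 1) with hq
    have pa : ∀ z, p (aVar * z) = z := fun z => by
      rw [hp, aVar, leftQuotient_var_mul]; simp
    have pb : ∀ z, p (bVar * z) = 0 := fun z => by
      rw [hp, bVar, leftQuotient_var_mul]; simp
    have qa : ∀ z, q (aVar * z) = 0 := fun z => by
      rw [hq, aVar, leftQuotient_var_mul]; simp
    have qb : ∀ z, q (bVar * z) = z := fun z => by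
      rw [hq, bVar, leftQuotient_var_mul]; simp
    have hpw : p w + p w = x + bVar * y := by
      rw [← map_add, hw]
      simp only [cVar, dVar, add_mul, mul_assoc, map_add, pa, pb]
      rw [hp, leftQuotient_algebraMap]; abel
    have hqw : q w + q w = x + aVar * y := by
      rw [← map_add, hw]
      simp only [cVar, dVar, add_mul, mul_assoc, map_add, qa, qb]
      rw [hq, leftQuotient_algebraMap]; abel
    have hy2 : q (p w - q w) + q (p w - q w) = y := by
      rw [← map_add, show p w - q w + (p w - q w) = (p w + p w) - (q w + q w) by abel, hpw, hqw,
        show x + bVar * y - (x + aVar * y) = bVar * y - aVar * y by abel, map_sub, qa, qb, sub_zero]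
    have hx2 : (p w - bVar * q (p w - q w)) + (p w - bVar * q (p w - q w)) = x := by
      rw [show ∀ s t : ABPoly, s - bVar * t + (s - bVar * t) = s + s - bVar * (t + t) by
        intros; noncomm_ring, hpw, hy2]
      abel
    refine ⟨FreeAlgebra.algebraMapInv w, _, _, ih (hx2 ▸ hx), ih (hy2 ▸ hy), two_mul_cancel ?_⟩
    rw [hw]
    conv_lhs => rw [← h1', ← hx2, ← hy2]
    rw [map_add]
    noncomm_ring

theorem mem_cd_of_add_self {w : ABPoly} (h : w + w ∈ cdPolynomials) : w ∈ cdPolynomials := by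
  rw [mem_cdPolynomials_iff] at h ⊢
  exact h.imp fun _ hn => hn.of_two_mul

theorem eVar_sq_mem : eVar ^ 2 ∈ cdPolynomials := by
  have : eVar ^ 2 = cVar * cVar - (dVar + dVar) := by
    simp only [eVar, cVar, dVar]; noncomm_ring
  rw [this]
  exact sub_mem (mul_mem cVar_mem cVar_mem) (add_mem dVar_mem dVar_mem)

theorem eVar_pow_even_mem {j : ℕ} (hj : Even j) : eVar ^ j ∈ cdPolynomials := by
  obtain ⟨k, rfl⟩ := hj
  rw [← two_mul, pow_mul]
  exact pow_mem eVar_sq_mem k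

theorem eVar_pow_add_neg_pow_mem (j : ℕ) : eVar ^ j + (-eVar) ^ j ∈ cdPolynomials := by
  rcases Nat.even_or_odd j with hj | hj
  · rw [hj.neg_pow]
    exact add_mem (eVar_pow_even_mem hj) (eVar_pow_even_mem hj)
  · rw [hj.neg_pow, add_neg_cancel]
    exact zero_mem _

/-- For even `j` this is `c e^j`; for odd `j` it collapses to `(b - a) e^j = -e^(j+1)`, an even
power of `e`. -/
theorem bVar_mul_add_aVar_mul_mem (j : ℕ) :
    bVar * eVar ^ j + aVar * (-eVar) ^ j ∈ cdPolynomials := by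
  rcases Nat.even_or_odd j with hj | hj
  · rw [hj.neg_pow, ← add_mul, add_comm bVar]
    exact mul_mem cVar_mem (eVar_pow_even_mem hj)
  · have : bVar * eVar ^ j + aVar * (-eVar) ^ j = - eVar ^ (j + 1) := by
      rw [hj.neg_pow, pow_succ', aVar_eq]; noncomm_ring
    rw [this]
    exact neg_mem (eVar_pow_even_mem (by rcases hj with ⟨k, rfl⟩; exact ⟨k + 1, by ring⟩))

open Classical in
/-- If the intervals below `y` satisfy Euler's relation, then `ψ y` is a polynomial in `c`, `d`. -/
theorem mem_cd_of_eulerian {Φ : Type*} [Fintype Φ] [PartialOrder Φ] {g : Φ → ℕ} (hg : StrictMono g)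
    (hg1 : ∀ z, 1 ≤ g z) {ψ : Φ → ABPoly} {y : Φ}
    (hψ : ∀ z ≤ y, ψ z = eVar ^ (g z - 1) +
      ∑ w with w < z, ψ w * bVar * eVar ^ (g z - g w - 1))
    (h1 : ∑ z with z ≤ y, (-1 : ℤ) ^ g z = -1)
    (h2 : ∀ x < y, ∑ z with x ≤ z ∧ z ≤ y, (-1 : ℤ) ^ g z = 0)
    (hcd : ∀ z < y, ψ z ∈ cdPolynomials) : ψ y ∈ cdPolynomials := by
  have hle : ∀ z : Φ, (univ.filter fun w => w ≤ z) = insert z (univ.filter fun w => w < z) := by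
    intro z; ext w; simp [le_iff_eq_or_lt]
  have hins : ∀ (z : Φ) (h : Φ → ABPoly), ∑ w with w ≤ z, h w = h z + ∑ w with w < z, h w := by
    intro z h; rw [hle, sum_insert (by simp)]
  have hsub : ∀ {w z : Φ}, w < z → g z - g w = (g z - g w - 1) + 1 := by
    intro w z h; have := hg h; omega
  -- Multiplying the recursion by `a = e + b` supplies the missing summand `w = z`.
  have hA : ∀ z ≤ y, ψ z * aVar = eVar ^ g z + ∑ w with w ≤ z, ψ w * bVar * eVar ^ (g z - g w) := by
    intro z hz
    have he : ψ z * eVar = eVar ^ g z + ∑ w with w < z, ψ w * bVar * eVar ^ (g z - g w) := by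
      rw [hψ z hz, add_mul, ← pow_succ, Nat.sub_add_cancel (hg1 z), sum_mul]
      congr 1
      refine sum_congr rfl fun w hw => ?_
      rw [mul_assoc, ← pow_succ, ← hsub (by simpa using hw)]
    rw [hins, aVar_eq, mul_add, he]
    simp only [Nat.sub_self, pow_zero, mul_one]
    abel
  have hpow : ∀ {i j k : ℕ}, i + j = k → eVar ^ i * (-eVar) ^ j = (-1 : ℤ) ^ j • eVar ^ k := by
    rintro i j k rfl
    rw [neg_pow, ← mul_assoc, (Commute.neg_one_right _).pow_right j |>.eq, mul_assoc, pow_add,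
      zsmul_eq_mul]
    simp
  -- After substituting `hA` and exchanging the sums, the coefficient of each `w` is an alternating
  -- sum over `[w, y]`, so only `w = y` survives. The pure power of `e` comes from `h1`, which is
  -- Euler's relation for the interval from the empty face, an element that `Φ` omits.
  have hsum : ∑ z with z ≤ y, ψ z * aVar * (-eVar) ^ (g y - g z) =
      - (-eVar) ^ g y + ψ y * bVar := by
    have e1 : ∀ z ∈ univ.filter (fun z => z ≤ y), ψ z * aVar * (-eVar) ^ (g y - g z) =
        ((-1 : ℤ) ^ g y * (-1) ^ g z) • eVar ^ g y +
        ∑ w with w ≤ y, if w ≤ z then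
          ((-1 : ℤ) ^ g y * (-1) ^ g z) • (ψ w * bVar * eVar ^ (g y - g w)) else 0 := by
      intro z hz
      have hz' : z ≤ y := by simpa using hz
      have hgz := hg.monotone hz'
      have hsg : (-1 : ℤ) ^ (g y - g z) = (-1) ^ g y * (-1) ^ g z := by
        obtain ⟨k, hk⟩ := Nat.exists_eq_add_of_le hgz
        rw [hk, Nat.add_sub_cancel_left, pow_add]
        have : (-1 : ℤ) ^ g z * (-1) ^ g z = 1 := by rw [← mul_pow]; simp
        rw [mul_comm ((-1 : ℤ) ^ g z), mul_assoc, this, mul_one]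
      rw [hA z hz', add_mul, hpow (k := g y) (by omega), hsg, sum_mul]
      congr 1
      rw [← sum_filter, filter_filter]
      have hfl : (univ.filter fun w => w ≤ y ∧ w ≤ z) = univ.filter fun w => w ≤ z := by
        ext w; simp only [mem_filter, mem_univ, true_and]
        exact ⟨fun h => h.2, fun h => ⟨h.trans hz', h⟩⟩
      rw [hfl]
      refine sum_congr rfl fun w hw => ?_
      have hgw := hg.monotone (show w ≤ z by simpa using hw)
      rw [mul_assoc (ψ w * bVar), hpow (k := g y - g w) (by omega), hsg, mul_smul_comm]
    rw [sum_congr rfl e1, sum_add_distrib, ← sum_smul, ← mul_sum, h1, sum_comm]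
    congr 1
    · rw [neg_pow eVar]; simp [zsmul_eq_mul]
    · have e2 : ∀ w ∈ univ.filter (fun w => w ≤ y), (∑ z with z ≤ y, if w ≤ z then
          ((-1 : ℤ) ^ g y * (-1) ^ g z) • (ψ w * bVar * eVar ^ (g y - g w)) else 0) =
          if w = y then ψ y * bVar else 0 := by
        intro w hw
        have hw' : w ≤ y := by simpa using hw
        rw [← sum_filter, filter_filter, ← sum_smul, ← mul_sum]
        split_ifs with hwy
        · subst hwy
          have : (univ.filter fun z => z ≤ w ∧ w ≤ z) = {w} := by
            ext z; simp [le_antisymm_iff]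
          rw [this, sum_singleton, ← mul_pow]; simp
        · have := h2 w (lt_of_le_of_ne hw' hwy)
          simp only [and_comm] at this ⊢
          rw [this]; simp
      rw [sum_congr rfl e2]
      simp
  -- The mirror image of the recursion under `a ↔ b`, `e ↔ -e`, obtained by cancelling a right
  -- factor `-e`.
  have hB : ψ y = (-eVar) ^ (g y - 1) +
      ∑ w with w < y, ψ w * aVar * (-eVar) ^ (g y - g w - 1) := by
    apply mul_right_cancel₀ (neg_ne_zero.2 eVar_ne_zero)
    rw [hins] at hsum
    rw [add_mul, ← pow_succ, Nat.sub_add_cancel (hg1 y), sum_mul]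
    have : ∑ w with w < y, ψ w * aVar * (-eVar) ^ (g y - g w - 1) * -eVar =
        ∑ w with w < y, ψ w * aVar * (-eVar) ^ (g y - g w) := by
      refine sum_congr rfl fun w hw => ?_
      rw [mul_assoc, ← pow_succ, ← hsub (by simpa using hw)]
    rw [this]
    simp only [Nat.sub_self, pow_zero, mul_one] at hsum
    have h3 := congrArg (fun t => t - ψ y * aVar + (-eVar) ^ g y) hsum
    simp only [add_sub_cancel_left] at h3
    rw [add_comm, h3, eVar]
    noncomm_ring
  apply mem_cd_of_add_self
  have : ψ y + ψ y = (eVar ^ (g y - 1) + (-eVar) ^ (g y - 1)) +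
      ∑ w with w < y, ψ w * (bVar * eVar ^ (g y - g w - 1) + aVar * (-eVar) ^ (g y - g w - 1)) := by
    conv_lhs => rw [hψ y le_rfl]
    have hB' := hB
    rw [hψ y le_rfl] at hB'
    conv_lhs => rhs; rw [hB']
    simp only [mul_add, sum_add_distrib, ← mul_assoc]
    abel
  rw [this]
  refine add_mem (eVar_pow_add_neg_pow_mem _) (sum_mem fun w hw => ?_)
  exact mul_mem (hcd w (by simpa using hw)) (bVar_mul_add_aVar_mul_mem _)

/-! ### The `ab`-index as a sum over chains -/

/-- The word of length `m` with the letters `b` at the positions in `S`, and `e` elsewhere. -/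
def ebWord (m : ℕ) (S : Finset ℕ) : ABPoly :=
  ((List.range m).map fun i => if i + 1 ∈ S then bVar else eVar).prod

theorem ebWord_succ (m : ℕ) (S : Finset ℕ) :
    ebWord (m + 1) S = ebWord m S * if m + 1 ∈ S then bVar else eVar := by
  simp [ebWord, List.range_succ]

theorem abMonomial_succ (m : ℕ) (S : Finset ℕ) :
    abMonomial (m + 1) S = abMonomial m S * if m + 1 ∈ S then bVar else aVar := by
  simp [abMonomial, List.range_succ]

theorem abMonomial_insert (m r : ℕ) (hr : m < r) (S : Finset ℕ) :
    abMonomial m (insert r S) = abMonomial m S := by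
  unfold abMonomial
  congr 1
  refine List.map_congr_left fun i hi => ?_
  have : i + 1 ≠ r := by have := List.mem_range.1 hi; omega
  simp [this]

theorem ebWord_empty (m : ℕ) : ebWord m ∅ = eVar ^ m := by
  simp [ebWord]

theorem ebWord_insert {m r : ℕ} (hr : 1 ≤ r) (hm : r ≤ m) {T : Finset ℕ} (hT : ∀ t ∈ T, t < r) :
    ebWord m (insert r T) = ebWord (r - 1) T * bVar * eVar ^ (m - r) := by
  induction m, hm using Nat.le_induction with
  | base =>
    obtain ⟨s, rfl⟩ := Nat.exists_eq_add_of_le' hr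
    rw [ebWord_succ, if_pos (mem_insert_self _ _), Nat.sub_self, pow_zero, mul_one,
      Nat.add_sub_cancel]
    congr 1
    unfold ebWord
    congr 1
    refine List.map_congr_left fun i hi => ?_
    have : i ≠ s := by have := List.mem_range.1 hi; omega
    simp [mem_insert, this]
  | succ m hm ih =>
    have h : m + 1 ∉ insert r T := by
      rw [mem_insert]
      rintro (h | h)
      · omega
      · have := hT _ h; omega
    rw [ebWord_succ, if_neg h, ih, Nat.succ_sub hm, pow_succ, ← mul_assoc]

/-- Expand `e = a - b` at each position outside `T`; `R` collects the positions where `-b` is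
chosen. -/
theorem ebWord_eq_sum (m : ℕ) (T : Finset ℕ) :
    ebWord m T = ∑ R ∈ (Icc 1 m \ T).powerset, (-1 : ℤ) ^ R.card • abMonomial m (T ∪ R) := by
  induction m with
  | zero => simp [ebWord, abMonomial]
  | succ m ih =>
    have hI : Icc 1 (m + 1) = insert (m + 1) (Icc 1 m) := by
      ext i; simp only [mem_Icc, mem_insert]; omega
    rw [ebWord_succ, ih, hI]
    split_ifs with h
    · rw [insert_sdiff_of_mem _ h, sum_mul]
      refine sum_congr rfl fun R _ => ?_
      rw [abMonomial_succ, if_pos (mem_union_left _ h), smul_mul_assoc]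
    · rw [insert_sdiff_of_notMem _ h, sum_powerset_insert (by simp), sum_mul, ← sum_add_distrib]
      refine sum_congr rfl fun R hR => ?_
      have hR' : m + 1 ∉ R := fun hm => by
        have := mem_powerset.1 hR hm
        simp at this
      rw [abMonomial_succ, if_neg (by simp [h, hR']), union_insert, abMonomial_succ,
        if_pos (mem_insert_self _ _), abMonomial_insert _ _ (Nat.lt_succ_self m),
        card_insert_of_notMem hR', pow_succ, mul_neg_one, neg_smul, ← sub_eq_add_neg, ← smul_sub,
        ← mul_sub, smul_mul_assoc, eVar]

/-- The signs in the definition of the flag `h`-vector are exactly those of the expansion of `e = a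
- b`, so both sides are the same double sum over `T ⊆ S`. -/
theorem abIndex_eq_sum_flagF (P : Type*) [PartialOrder P] [BoundedOrder P] :
    abIndex P = ∑ T ∈ (Icc 1 (innerRank P)).powerset, flagF P T • ebWord (innerRank P) T := by
  unfold abIndex flagH
  simp_rw [ebWord_eq_sum, sum_smul, smul_sum]
  rw [sum_sigma', sum_sigma']
  refine sum_bij' (fun x _ => ⟨x.2, x.1 \ x.2⟩) (fun x _ => ⟨x.1 ∪ x.2, x.1⟩) ?_ ?_ ?_ ?_ ?_
  · rintro ⟨S, T⟩ h
    simp only [mem_sigma, mem_powerset] at h ⊢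
    exact ⟨h.2.trans h.1, sdiff_subset_sdiff h.1 subset_rfl⟩
  · rintro ⟨T, R⟩ h
    simp only [mem_sigma, mem_powerset] at h ⊢
    exact ⟨union_subset h.1 (h.2.trans sdiff_subset), subset_union_left⟩
  · rintro ⟨S, T⟩ h
    simp only [mem_sigma, mem_powerset] at h
    simp [union_sdiff_of_subset h.2]
  · rintro ⟨T, R⟩ h
    simp only [mem_sigma, mem_powerset] at h
    have : (T ∪ R) \ T = R := by
      rw [union_sdiff_left, Finset.sdiff_eq_self_iff_disjoint]
      exact disjoint_of_subset_left h.2 sdiff_disjoint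
    simp [this]
  · rintro ⟨S, T⟩ h
    simp only [mem_sigma, mem_powerset] at h
    simp only [union_sdiff_of_subset h.2]
    rw [mul_comm, mul_smul, natCast_zsmul]

/-- A strictly increasing map to `ℕ` bounds the height from above, and descending in steps of one
produces a chain of that length. -/
theorem rk_eq {P : Type*} [PartialOrder P] [BoundedOrder P] {g : P → ℕ} (hg : StrictMono g) (hg0 : g ⊥ = 0)
    (hdesc : ∀ x, x ≠ ⊥ → ∃ y < x, g x = g y + 1) (x : P) : rk x = g x := by
  have h : Order.height x = g x := by
    refine le_antisymm ?_ ?_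
    · have := Order.height_le_height_apply_of_strictMono g hg x
      simpa using this
    · induction hn : g x generalizing x with
      | zero => simp
      | succ n ih =>
        obtain ⟨y, hy, hxy⟩ := hdesc x (by rintro rfl; omega)
        have := ih y (by omega)
        calc ((n + 1 : ℕ) : ℕ∞) = n + 1 := by push_cast; rfl
          _ ≤ Order.height y + 1 := by gcongr
          _ ≤ Order.height x := Order.height_add_one_le hy
  simp [rk, h]

/-! ### Recursion over the largest element of a chain. -/

section Chains

variable {P : Type*} [PartialOrder P] [BoundedOrder P] [Fintype P]

open Classical in
/-- The chains strictly between `0̂` and `x`. -/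
def chainsBelow (x : P) : Finset (Finset P) :=
  univ.filter fun C => IsChain (· ≤ ·) (C : Set P) ∧ ∀ c ∈ C, ⊥ < c ∧ c < x

theorem mem_chainsBelow {x : P} {C : Finset P} :
    C ∈ chainsBelow x ↔ IsChain (· ≤ ·) (C : Set P) ∧ ∀ c ∈ C, ⊥ < c ∧ c < x := by
  simp [chainsBelow]

open Classical in
-- A nonempty chain is its maximum `y` together with a chain strictly below `y`. In its word, `y`
-- contributes the last `b`, at position `g y`, and only letters `e` follow.
theorem sum_chainsBelow {g : P → ℕ} (hg : StrictMono g) {x : P} :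
    ∑ C ∈ chainsBelow x, ebWord (g x - 1) (C.image g) = eVar ^ (g x - 1) +
      ∑ y with ⊥ < y ∧ y < x,
        (∑ C ∈ chainsBelow y, ebWord (g y - 1) (C.image g)) * bVar * eVar ^ (g x - g y - 1) := by
  have h0 : (∅ : Finset P) ∈ chainsBelow x := by simp [mem_chainsBelow]
  rw [← add_sum_erase _ _ h0, image_empty, ebWord_empty]
  congr 1
  simp_rw [sum_mul]
  rw [sum_sigma']
  symm
  have hmem : ∀ {y : P} {C : Finset P}, ⊥ < y → y < x → C ∈ chainsBelow y →
      insert y C ∈ chainsBelow x := by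
    intro y C hy0 hyx hC
    rw [mem_chainsBelow] at hC ⊢
    refine ⟨?_, ?_⟩
    · rw [coe_insert]
      exact hC.1.insert fun b hb _ => Or.inr (hC.2 b hb).2.le
    · intro c hc
      rcases mem_insert.1 hc with rfl | hc
      · exact ⟨hy0, hyx⟩
      · exact ⟨(hC.2 c hc).1, (hC.2 c hc).2.trans hyx⟩
  refine sum_bij (fun z _ => insert z.1 z.2) ?_ ?_ ?_ ?_
  · rintro ⟨y, C⟩ h
    simp only [mem_sigma, mem_filter, mem_univ, true_and] at h
    exact mem_erase.2 ⟨insert_ne_empty _ _, hmem h.1.1 h.1.2 h.2⟩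
  · rintro ⟨y, C⟩ h ⟨y', C'⟩ h' heq
    simp only [mem_sigma, mem_filter, mem_univ, true_and, mem_chainsBelow] at h h' heq
    have hyy : y = y' := by
      have h1 : y ∈ insert y' C' := heq ▸ mem_insert_self _ _
      have h2 : y' ∈ insert y C := heq.symm ▸ mem_insert_self _ _
      rcases mem_insert.1 h1 with h1 | h1
      · exact h1
      rcases mem_insert.1 h2 with h2 | h2
      · exact h2.symm
      exact absurd ((h'.2.2 _ h1).2.trans (h.2.2 _ h2).2) (lt_irrefl _)
    subst hyy
    have hn : y ∉ C := fun hc => lt_irrefl _ (h.2.2 _ hc).2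
    have hn' : y ∉ C' := fun hc => lt_irrefl _ (h'.2.2 _ hc).2
    have := congrArg (fun s => s.erase y) heq
    simp only [erase_insert hn, erase_insert hn'] at this
    rw [this]
  · intro D hD
    rw [mem_erase, mem_chainsBelow] at hD
    obtain ⟨y, hyD, hy⟩ := D.exists_maximal (nonempty_iff_ne_empty.2 hD.1)
    refine ⟨⟨y, D.erase y⟩, ?_, insert_erase hyD⟩
    simp only [mem_sigma, mem_filter, mem_univ, true_and, mem_chainsBelow]
    refine ⟨hD.2.2 y hyD, hD.2.1.mono (by simp), fun c hc => ?_⟩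
    rw [mem_erase] at hc
    refine ⟨(hD.2.2 c hc.2).1, ?_⟩
    rcases hD.2.1 hc.2 hyD hc.1 with h | h
    · exact lt_of_le_of_ne h hc.1
    · exact absurd (le_antisymm (hy hc.2 h) h) hc.1
  · rintro ⟨y, C⟩ h
    simp only [mem_sigma, mem_filter, mem_univ, true_and, mem_chainsBelow] at h
    have h1 := hg h.1.1
    have h2 := hg h.1.2
    rw [image_insert, ebWord_insert (by simp only; omega) (by simp only; omega)]
    · rw [show g x - 1 - g y = g x - g y - 1 by omega]
    · intro t ht
      obtain ⟨c, hc, rfl⟩ := mem_image.1 ht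
      exact hg (h.2.2 c hc).2

open Classical in
theorem abIndex_eq_sum_chains {g : P → ℕ} (hg : StrictMono g) (hg0 : g ⊥ = 0)
    (hdesc : ∀ x, x ≠ ⊥ → ∃ y < x, g x = g y + 1) :
    abIndex P = ∑ C ∈ chainsBelow (⊤ : P), ebWord (g ⊤ - 1) (C.image g) := by
  have hrk : (rk : P → ℕ) = g := funext (rk_eq hg hg0 hdesc)
  have hm : innerRank P = g ⊤ - 1 := by rw [innerRank, hrk]
  rw [abIndex_eq_sum_flagF, hm]
  have hmaps : ∀ C ∈ chainsBelow (⊤ : P), C.image g ∈ (Icc 1 (g ⊤ - 1)).powerset := by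
    intro C hC
    rw [mem_chainsBelow] at hC
    rw [mem_powerset]
    intro t ht
    obtain ⟨c, hc, rfl⟩ := mem_image.1 ht
    have h1 := hg (hC.2 c hc).1
    have h2 := hg (hC.2 c hc).2
    rw [mem_Icc]; omega
  rw [← sum_fiberwise_of_maps_to hmaps]
  refine sum_congr rfl fun T hT => ?_
  rw [sum_congr rfl (g := fun _ => ebWord (g ⊤ - 1) T) (fun C hC => by rw [(mem_filter.1 hC).2]),
    sum_const]
  congr 1
  unfold flagF
  rw [← Set.ncard_coe_finset, ← Set.ncard_image_of_injective _ (coe_injective (α := P))]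
  congr 1
  ext C
  simp only [Set.mem_ofPred_eq, Set.mem_image, mem_coe, mem_filter, mem_chainsBelow, hrk]
  constructor
  · rintro ⟨h1, h2, h3, h4⟩
    refine ⟨(Set.toFinite C).toFinset, ⟨⟨by simpa using h1, fun c hc => ?_⟩, ?_⟩, by simp⟩
    · rw [Set.Finite.mem_toFinset] at hc
      exact ⟨bot_lt_iff_ne_bot.2 (by rintro rfl; exact h2 hc),
        lt_top_iff_ne_top.2 (by rintro rfl; exact h3 hc)⟩
    · apply coe_injective
      simpa using h4
  · rintro ⟨D, ⟨⟨h1, h2⟩, h3⟩, rfl⟩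
    refine ⟨h1, fun h => lt_irrefl _ (h2 _ h).1, fun h => lt_irrefl _ (h2 _ h).2, ?_⟩
    rw [← h3]; simp

open Classical in
/-- The `ab`-index is determined by the recursion over the lower intervals. -/
theorem abIndex_eq_of_recursion {g : P → ℕ} (hg : StrictMono g) (hg0 : g ⊥ = 0)
    (hdesc : ∀ x, x ≠ ⊥ → ∃ y < x, g x = g y + 1) (hbt : (⊥ : P) ≠ ⊤) {ψ : P → ABPoly}
    (hψ : ∀ x, x ≠ ⊥ → ψ x = eVar ^ (g x - 1) +
      ∑ y with ⊥ < y ∧ y < x, ψ y * bVar * eVar ^ (g x - g y - 1)) :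
    abIndex P = ψ ⊤ := by
  rw [abIndex_eq_sum_chains hg hg0 hdesc]
  have : ∀ x : P, x ≠ ⊥ → ∑ C ∈ chainsBelow x, ebWord (g x - 1) (C.image g) = ψ x := by
    intro x
    induction x using WellFoundedLT.induction with
    | ind x ih =>
      intro hx
      rw [hψ x hx, sum_chainsBelow hg]
      congr 1
      refine sum_congr rfl fun y hy => ?_
      simp only [mem_filter, mem_univ, true_and] at hy
      rw [ih y hy.2 hy.1.ne']
  exact this ⊤ hbt.symm

end Chains

/-! ### Face posets of convex hulls of finite families -/

section Faces

variable {E : Type*} [AddCommGroup E] [Module ℝ E] [TopologicalSpace E]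

theorem le_of_mem_convexHull_range {ν : Type*} {v : ν → E} (l : StrongDual ℝ E) {c : ℝ}
    (h : ∀ j, l (v j) ≤ c) {y : E} (hy : y ∈ convexHull ℝ (Set.range v)) : l y ≤ c := by
  have hc : Convex ℝ {x : E | l x ≤ c} := convex_halfSpace_le l.toLinearMap.isLinear c
  exact convexHull_min (by rintro _ ⟨j, rfl⟩; exact h j) hc hy

/-- The indices of the vertices that lie on a face. -/
def faceVertices {ν : Type*} (v : ν → E) (F : FacePoset (convexHull ℝ (Set.range v))) : Set ν :=
  {i | v i ∈ F.1}

/-- The indices at which a function is maximal. -/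
def argmaxSet {ν : Type*} (h : ν → ℝ) : Set ν := {i | ∀ j, h j ≤ h i}

theorem faceVertices_eq_argmaxSet {ν : Type*} {v : ν → E} (l : StrongDual ℝ E)
    {F : FacePoset (convexHull ℝ (Set.range v))}
    (hF : F.1 = {x ∈ convexHull ℝ (Set.range v) | ∀ y ∈ convexHull ℝ (Set.range v), l y ≤ l x}) :
    faceVertices v F = argmaxSet fun i => l (v i) := by
  ext i
  simp only [faceVertices, argmaxSet, hF, Set.mem_ofPred_eq]
  constructor
  · exact fun h j => h.2 _ (subset_convexHull ℝ _ ⟨j, rfl⟩)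
  · exact fun h => ⟨subset_convexHull ℝ _ ⟨i, rfl⟩, fun y hy => le_of_mem_convexHull_range l h hy⟩

theorem eq_bot_or_exists_dual {Q : Set E} (F : FacePoset Q) :
    F = ⊥ ∨ ∃ l : StrongDual ℝ E, F.1 = {x ∈ Q | ∀ y ∈ Q, l y ≤ l x} := by
  rcases Set.eq_empty_or_nonempty F.1 with h | h
  · exact Or.inl (Subtype.ext h)
  · exact Or.inr (F.2 h)

/-- The value of the linear form at `x` is the weighted mean of its values at the vertices used,
none of which exceeds it. A vertex of positive weight therefore attains the maximum and lies on the
face. -/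
theorem exists_vertex_of_mem_face {ν : Type*} {v : ν → E}
    (F : FacePoset (convexHull ℝ (Set.range v))) {x : E} (hx : x ∈ F.1) :
    ∃ (κ : Type) (_ : Fintype κ) (w : κ → ℝ) (z : κ → ν), (∀ i, 0 ≤ w i) ∧ ∑ i, w i = 1 ∧
      (∑ i, w i • v (z i) = x) ∧ ∀ i, w i = 0 ∨ z i ∈ faceVertices v F := by
  obtain ⟨l, hl⟩ := F.2 ⟨x, hx⟩
  have hxF := hx
  rw [hl] at hx
  obtain ⟨hxQ, hmax⟩ := hx
  obtain ⟨κ, hκ, w, z', hw0, hw1, hz', hsum⟩ := mem_convexHull_iff_exists_fintype.1 hxQ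
  choose z hz using hz'
  have hzQ : ∀ i, v (z i) ∈ convexHull ℝ (Set.range v) := fun i => subset_convexHull ℝ _ ⟨_, rfl⟩
  simp_rw [← hz] at hsum
  -- the index type is transported to the lowest universe
  let ε := Fintype.equivFin κ
  refine ⟨Fin (Fintype.card κ), inferInstance, fun i => w (ε.symm i), fun i => z (ε.symm i),
    fun i => hw0 _, ?_, ?_, fun i => ?_⟩
  · rw [← hw1]; exact Equiv.sum_comp ε.symm w
  · rw [← hsum]; exact Equiv.sum_comp ε.symm fun i => w i • v (z i)
  · have h0 : ∑ i, w i * (l x - l (v (z i))) = 0 := by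
      have : l x = ∑ i, w i * l (v (z i)) := by rw [← hsum]; simp
      simp_rw [mul_sub, sum_sub_distrib, ← sum_mul, hw1, ← this]
      ring
    have h1 := (sum_eq_zero_iff_of_nonneg (fun i _ =>
      mul_nonneg (hw0 i) (sub_nonneg.2 (hmax _ (hzQ i))))).1 h0 (ε.symm i) (mem_univ _)
    rcases mul_eq_zero.1 h1 with h2 | h2
    · exact Or.inl h2
    · right
      change v (z (ε.symm i)) ∈ F.1
      rw [hl]
      refine ⟨hzQ _, fun y hy => ?_⟩
      rw [← sub_eq_zero.1 h2]; exact hmax y hy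

/-- Each point of `F` is a convex combination of vertices on `F`, so a form that is maximal at those
vertices is maximal at the point. Faces are thus recovered from finite sets of indices. -/
theorem faceVertices_subset_iff {ν : Type*} {v : ν → E}
    {F G : FacePoset (convexHull ℝ (Set.range v))} :
    faceVertices v F ⊆ faceVertices v G ↔ F ≤ G := by
  refine ⟨fun h x hx => ?_, fun h i hi => h hi⟩
  obtain ⟨κ, _, w, z, hw0, hw1, hsum, hz⟩ := exists_vertex_of_mem_face F hx
  have hxQ : x ∈ convexHull ℝ (Set.range v) := F.2.subset hx
  rcases eq_bot_or_exists_dual G with rfl | ⟨l, hl⟩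
  · have : ∀ i, w i = 0 := fun i => (hz i).resolve_right fun hi => h hi
    simp [this] at hw1
  · have hmem : ∀ i, w i = 0 ∨ v (z i) ∈ G.1 := fun i => (hz i).imp_right fun hi => h hi
    rw [hl] at hmem ⊢
    refine ⟨hxQ, fun y hy => ?_⟩
    have : l x = ∑ i, w i * l (v (z i)) := by rw [← hsum]; simp
    rw [this]
    calc l y = ∑ i, w i * l y := by rw [← sum_mul, hw1, one_mul]
      _ ≤ _ := sum_le_sum fun i _ => by
        rcases hmem i with h0 | h0
        · simp [h0]
        · exact mul_le_mul_of_nonneg_left (h0.2 y hy) (hw0 i)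

open Classical in
/-- The `ab`-index of the convex hull of a finite family of points can be computed in a model `Φ`
of the poset of the sets of vertices on the nonempty faces. -/
theorem psi_convexHull_eq {ν : Type*} [Finite ν] {v : ν → E}
    {Φ : Type*} [Fintype Φ] [PartialOrder Φ] {W : Φ → Set ν} (hW : ∀ x y, x ≤ y ↔ W x ⊆ W y)
    (hface : ∀ x, (W x).Nonempty ∧ ∃ l : StrongDual ℝ E, W x = argmaxSet fun i => l (v i))
    (hsurj : ∀ l : StrongDual ℝ E, ∃ x, W x = argmaxSet fun i => l (v i))
    {t : Φ} (ht : W t = Set.univ) {g : Φ → ℕ} (hg : StrictMono g) (hg1 : ∀ x, 1 ≤ g x)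
    (hdesc : ∀ x, 1 < g x → ∃ y < x, g x = g y + 1) {ψ : Φ → ABPoly}
    (hψ : ∀ x, ψ x = eVar ^ (g x - 1) + ∑ y with y < x, ψ y * bVar * eVar ^ (g x - g y - 1)) :
    psi (convexHull ℝ (Set.range v)) = ψ t := by
  set Q := convexHull ℝ (Set.range v) with hQ
  have hinj : Function.Injective (faceVertices v) := fun F G h =>
    le_antisymm (faceVertices_subset_iff.1 h.le) (faceVertices_subset_iff.1 h.ge)
  have : Finite (FacePoset Q) := Finite.of_injective _ hinj
  have : Fintype (FacePoset Q) := Fintype.ofFinite _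
  have h1 : ∀ x : Φ, ∃ F : FacePoset Q, F ≠ ⊥ ∧ faceVertices v F = W x := by
    intro x
    obtain ⟨hne, l, hl⟩ := hface x
    let F : FacePoset Q := ⟨{x ∈ Q | ∀ y ∈ Q, l y ≤ l x}, fun _ => ⟨l, rfl⟩⟩
    have hF : faceVertices v F = W x := by rw [hl]; exact faceVertices_eq_argmaxSet l rfl
    refine ⟨F, fun h => ?_, hF⟩
    rw [← hF, h] at hne
    obtain ⟨i, hi⟩ := hne
    exact hi
  choose face hface0 hfaceW using h1
  have h2 : ∀ F : FacePoset Q, F ≠ ⊥ → ∃ x, face x = F := by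
    intro F hF
    obtain ⟨l, hl⟩ := (eq_bot_or_exists_dual F).resolve_left hF
    obtain ⟨x, hx⟩ := hsurj l
    exact ⟨x, hinj (by rw [hfaceW, hx, faceVertices_eq_argmaxSet l hl])⟩
  have hle : ∀ x y, face x ≤ face y ↔ x ≤ y := by
    intro x y
    rw [← faceVertices_subset_iff, hfaceW, hfaceW, hW]
  have hlt : ∀ x y, face x < face y ↔ x < y := fun x y => by
    rw [lt_iff_le_not_ge, lt_iff_le_not_ge, hle, hle]
  have hfinj : Function.Injective face := fun x y h =>
    le_antisymm ((hle x y).1 h.le) ((hle y x).1 h.ge)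
  have : Nonempty Φ := ⟨t⟩
  let inv : FacePoset Q → Φ := Function.invFun face
  have hinv : ∀ x, inv (face x) = x := Function.leftInverse_invFun hfinj
  -- The empty face is absent from the model: it receives rank 0, and the ranks of the model start
  -- at 1.
  let g' : FacePoset Q → ℕ := fun F => if F = ⊥ then 0 else g (inv F)
  have hg' : ∀ x, g' (face x) = g x := fun x => by simp [g', hface0, hinv]
  have hg'0 : g' ⊥ = 0 := by simp [g']
  have hmono : StrictMono g' := by
    intro F G hFG
    obtain ⟨y, rfl⟩ := h2 G (ne_bot_of_gt hFG)
    rw [hg']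
    by_cases hF : F = ⊥
    · rw [hF, hg'0]; exact hg1 y
    · obtain ⟨x, rfl⟩ := h2 F hF
      rw [hg']
      exact hg ((hlt x y).1 hFG)
  have htop : (⊤ : FacePoset Q) = face t := by
    apply hinj
    rw [hfaceW, ht]
    ext i
    simp only [Set.mem_univ, iff_true]
    exact subset_convexHull ℝ _ ⟨i, rfl⟩
  have := abIndex_eq_of_recursion (P := FacePoset Q) (g := g') hmono hg'0 ?_
    (by rw [htop]; exact (hface0 t).symm) (ψ := fun F => ψ (inv F)) ?_
  · rw [psi, this, htop, hinv]
  · intro F hF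
    obtain ⟨x, rfl⟩ := h2 F hF
    rw [hg']
    rcases (hg1 x).lt_or_eq with h | h
    · obtain ⟨y, hy, hxy⟩ := hdesc x h
      exact ⟨face y, (hlt _ _).2 hy, by rw [hg', hxy]⟩
    · exact ⟨⊥, bot_lt_iff_ne_bot.2 hF, by rw [hg'0, ← h]⟩
  · intro F hF
    obtain ⟨x, rfl⟩ := h2 F hF
    rw [hg', hinv, hψ x]
    congr 1
    refine sum_bij (fun y _ => face y) ?_ (fun _ _ _ _ h => hfinj h) ?_ ?_
    · intro y hy
      simp only [mem_filter, mem_univ, true_and] at hy ⊢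
      exact ⟨bot_lt_iff_ne_bot.2 (hface0 y), (hlt _ _).2 hy⟩
    · intro G hG
      simp only [mem_filter, mem_univ, true_and] at hG
      obtain ⟨y, rfl⟩ := h2 G hG.1.ne'
      exact ⟨y, by simpa using (hlt _ _).1 hG.2, rfl⟩
    · intro y _
      rw [hg', hinv]

end Faces

/-! ### Products of simplices -/

/-- The `ab`-index of `Δ_p × Δ_q`, by recursion over the faces. -/
def prodCD (p q : ℕ) : ABPoly :=
  eVar ^ (p + q - 2) + ∑ i ∈ range (p + 1), ∑ j ∈ range (q + 1),
    if _h : 0 < i ∧ 0 < j ∧ i + j < p + q then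
      (p.choose i * q.choose j) • (prodCD i j * bVar * eVar ^ (p + q - i - j - 1)) else 0
termination_by p + q

theorem sum_powerset_card {ι M : Type*} [AddCommMonoid M] (A : Finset ι) (F : ℕ → M) :
    ∑ T ∈ A.powerset, F T.card = ∑ i ∈ range (A.card + 1), A.card.choose i • F i :=
  sum_powerset_apply_card F

/-! ### Alternating sums over Boolean intervals. -/

section SignSums

variable {ι : Type*} [DecidableEq ι]

/-- Toggling a fixed `x ∈ A \ A₀` is a sign-reversing involution. -/
theorem sum_interval_sign_eq_zero {A₀ A : Finset ι} (h : A₀ ⊂ A) :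
    ∑ T ∈ A.powerset with A₀ ⊆ T, (-1 : ℤ) ^ T.card = 0 := by
  obtain ⟨x, hxA, hx0⟩ := exists_of_ssubset h
  refine sum_involution (fun T _ => if x ∈ T then T.erase x else insert x T) ?_ ?_ ?_ ?_
  · intro T _
    split_ifs with hx
    · rw [← card_erase_add_one hx, pow_succ]; ring
    · rw [card_insert_of_notMem hx, pow_succ]; ring
  · intro T _ _
    split_ifs with hx
    · exact fun h => notMem_erase x T (h.symm ▸ hx)
    · exact fun h => hx (h ▸ mem_insert_self x T)
  · intro T hT
    simp only [mem_filter, mem_powerset] at hT ⊢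
    split_ifs with hx
    · exact ⟨(erase_subset _ _).trans hT.1,
        fun y hy => mem_erase.2 ⟨by rintro rfl; exact hx0 hy, hT.2 hy⟩⟩
    · exact ⟨insert_subset hxA hT.1, hT.2.trans (subset_insert _ _)⟩
  · intro T _
    by_cases hx : x ∈ T
    · simp [hx, insert_erase hx]
    · simp [hx]

theorem sum_interval_sign (A₀ A : Finset ι) (h : A₀ ⊆ A) :
    ∑ T ∈ A.powerset with A₀ ⊆ T, (-1 : ℤ) ^ T.card = if A₀ = A then (-1) ^ A.card else 0 := by
  split_ifs with h0
  · subst h0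
    have : (A₀.powerset.filter fun T => A₀ ⊆ T) = {A₀} := by
      ext T
      simp only [mem_filter, mem_powerset, mem_singleton]
      exact ⟨fun h => h.1.antisymm h.2, by rintro rfl; exact ⟨subset_rfl, subset_rfl⟩⟩
    rw [this, sum_singleton]
  · exact sum_interval_sign_eq_zero (h.ssubset_of_ne h0)

theorem sum_nonempty_sign {A : Finset ι} (hA : A.Nonempty) :
    ∑ T ∈ A.powerset with T.Nonempty, (-1 : ℤ) ^ T.card = -1 := by
  have h := sum_powerset_neg_one_pow_card_of_nonempty hA
  rw [← add_sum_erase _ _ (empty_mem_powerset A)] at h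
  have : A.powerset.erase ∅ = A.powerset.filter fun T => T.Nonempty := by
    ext T; simp [nonempty_iff_ne_empty, and_comm]
  rw [this] at h
  simp only [card_empty, pow_zero] at h
  linarith

end SignSums

variable {ι κ : Type*} [DecidableEq ι] [DecidableEq κ]

/-- The pairs of nonempty subsets of `A` and `B`. -/
def subPairs (A : Finset ι) (B : Finset κ) : Finset (Finset ι × Finset κ) :=
  (A.powerset.filter fun T => T.Nonempty) ×ˢ (B.powerset.filter fun T => T.Nonempty)

theorem mem_subPairs {A : Finset ι} {B : Finset κ} {x : Finset ι × Finset κ} :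
    x ∈ subPairs A B ↔ (x.1 ⊆ A ∧ x.1.Nonempty) ∧ x.2 ⊆ B ∧ x.2.Nonempty := by
  simp [subPairs]

theorem card_lt_of_mem_subPairs {A : Finset ι} {B : Finset κ} {x : Finset ι × Finset κ}
    (h : x ∈ subPairs A B) (hne : x ≠ (A, B)) : x.1.card + x.2.card < A.card + B.card := by
  rw [mem_subPairs] at h
  by_contra hlt
  have h1 : x.1.card ≤ A.card := card_le_card h.1.1
  have h2 : x.2.card ≤ B.card := card_le_card h.2.1
  exact hne (Prod.ext (eq_of_subset_of_card_le h.1.1 (by simp only; omega))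
    (eq_of_subset_of_card_le h.2.1 (by simp only; omega)))

/-- The binomial coefficients count the subsets of given sizes, so the numerical recursion is a sum
over proper faces `Δ_T × Δ_R`, with `T ⊆ A` and `R ⊆ B`. -/
theorem prodCD_eq (A : Finset ι) (B : Finset κ) :
    prodCD A.card B.card = eVar ^ (A.card + B.card - 2) + ∑ x ∈ (subPairs A B).erase (A, B),
      prodCD x.1.card x.2.card * bVar * eVar ^ (A.card + B.card - x.1.card - x.2.card - 1) := by
  rw [prodCD]
  congr 1
  have h1 : (subPairs A B).erase (A, B) = (A.powerset ×ˢ B.powerset).filter fun x =>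
      0 < x.1.card ∧ 0 < x.2.card ∧ x.1.card + x.2.card < A.card + B.card := by
    ext x
    constructor
    · intro h
      rw [mem_erase] at h
      have hlt := card_lt_of_mem_subPairs h.2 h.1
      have h2 := mem_subPairs.1 h.2
      simp only [mem_filter, mem_product, mem_powerset]
      exact ⟨⟨h2.1.1, h2.2.1⟩, card_pos.2 h2.1.2, card_pos.2 h2.2.2, hlt⟩
    · intro h
      simp only [mem_filter, mem_product, mem_powerset] at h
      refine mem_erase.2 ⟨?_, mem_subPairs.2
        ⟨⟨h.1.1, card_pos.1 h.2.1⟩, h.1.2, card_pos.1 h.2.2.1⟩⟩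
      rintro rfl
      exact lt_irrefl _ h.2.2.2
  rw [h1, sum_filter, sum_product]
  have h2 : ∀ i j : ℕ, (if _h : 0 < i ∧ 0 < j ∧ i + j < A.card + B.card then
      (A.card.choose i * B.card.choose j) •
        (prodCD i j * bVar * eVar ^ (A.card + B.card - i - j - 1)) else 0) =
      A.card.choose i • B.card.choose j •
        if 0 < i ∧ 0 < j ∧ i + j < A.card + B.card then
          prodCD i j * bVar * eVar ^ (A.card + B.card - i - j - 1) else 0 := by
    intro i j
    split_ifs
    · rw [mul_smul]
    · simp
  simp_rw [h2, ← smul_sum]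
  rw [← sum_powerset_card A (M := ABPoly) fun i => ∑ j ∈ range (B.card + 1), B.card.choose j •
        if 0 < i ∧ 0 < j ∧ i + j < A.card + B.card then
          prodCD i j * bVar * eVar ^ (A.card + B.card - i - j - 1) else 0]
  refine sum_congr rfl fun S _ => ?_
  rw [← sum_powerset_card B (M := ABPoly) fun j => if 0 < S.card ∧ 0 < j ∧ S.card + j < A.card + B.card then
    prodCD S.card j * bVar * eVar ^ (A.card + B.card - S.card - j - 1) else 0]

/-- Since `a = e + b`, the part with `e` raises all exponents in the recursion by one and the part
with `b` is the summand of the full pair `(A, B)`. This is the form in which a wall enters the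
splitting formula. -/
theorem prodCD_mul_aVar {A : Finset ι} {B : Finset κ} (hA : A.Nonempty) (hB : B.Nonempty) :
    prodCD A.card B.card * aVar = eVar ^ (A.card + B.card - 1) + ∑ x ∈ subPairs A B,
      prodCD x.1.card x.2.card * bVar * eVar ^ (A.card + B.card - x.1.card - x.2.card) := by
  have hmem : (A, B) ∈ subPairs A B := mem_subPairs.2 ⟨⟨subset_rfl, hA⟩, subset_rfl, hB⟩
  have hA' := card_pos.2 hA
  have hB' := card_pos.2 hB
  rw [← add_sum_erase _ _ hmem, aVar_eq, mul_add]
  have : prodCD A.card B.card * eVar = eVar ^ (A.card + B.card - 1) +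
      ∑ x ∈ (subPairs A B).erase (A, B),
      prodCD x.1.card x.2.card * bVar * eVar ^ (A.card + B.card - x.1.card - x.2.card) := by
    rw [prodCD_eq A B, add_mul, ← pow_succ, sum_mul]
    congr 1
    · congr 1; omega
    · refine sum_congr rfl fun x hx => ?_
      have := card_lt_of_mem_subPairs (mem_erase.1 hx).2 (mem_erase.1 hx).1
      rw [mul_assoc, ← pow_succ]
      congr 2
      omega
  rw [this]
  simp only [show A.card + B.card - A.card - B.card = 0 by omega, pow_zero, mul_one]
  abel

theorem prodCD_comm (p q : ℕ) : prodCD p q = prodCD q p := by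
  induction h : p + q using Nat.strong_induction_on generalizing p q with
  | _ n ih =>
    rw [prodCD, prodCD.eq_def q p, sum_comm, add_comm q p]
    congr 1
    refine sum_congr rfl fun j _ => sum_congr rfl fun i _ => ?_
    by_cases hij : 0 < i ∧ 0 < j ∧ i + j < p + q
    · have hji : 0 < j ∧ 0 < i ∧ j + i < p + q := ⟨hij.2.1, hij.1, by omega⟩
      rw [dif_pos hij, dif_pos hji, ih (i + j) (by omega) i j rfl, mul_comm (p.choose i),
        show p + q - i - j = p + q - j - i by omega]
    · have hji : ¬ (0 < j ∧ 0 < i ∧ j + i < p + q) := fun h => hij ⟨h.2.1, h.1, by omega⟩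
      rw [dif_neg hij, dif_neg hji]

/-- The poset of the nonempty faces of a product of two simplices. -/
def ProdFace (ι κ : Type*) : Type _ :=
  {A : Finset ι // A.Nonempty} × {B : Finset κ // B.Nonempty}

instance : PartialOrder (ProdFace ι κ) :=
  inferInstanceAs (PartialOrder ({A : Finset ι // A.Nonempty} × {B : Finset κ // B.Nonempty}))

instance [Fintype ι] [Fintype κ] : Fintype (ProdFace ι κ) :=
  inferInstanceAs (Fintype ({A : Finset ι // A.Nonempty} × {B : Finset κ // B.Nonempty}))

/-- The rank of a face of a product of two simplices. -/
def ProdFace.rank (x : ProdFace ι κ) : ℕ := x.1.1.card + x.2.1.card - 1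

theorem ProdFace.le_iff {x y : ProdFace ι κ} : x ≤ y ↔ x.1.1 ⊆ y.1.1 ∧ x.2.1 ⊆ y.2.1 := Iff.rfl

theorem ProdFace.card_pos (x : ProdFace ι κ) : 0 < x.1.1.card ∧ 0 < x.2.1.card :=
  ⟨Finset.card_pos.2 x.1.2, Finset.card_pos.2 x.2.2⟩

theorem ProdFace.rank_strictMono : StrictMono (ProdFace.rank : ProdFace ι κ → ℕ) := by
  intro x y hxy
  have hle := ProdFace.le_iff.1 hxy.le
  have h1 := card_le_card hle.1
  have h2 := card_le_card hle.2
  have h3 := x.card_pos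
  by_contra hlt
  simp only [rank] at hlt
  refine hxy.ne (Prod.ext (Subtype.ext ?_) (Subtype.ext ?_))
  · exact eq_of_subset_of_card_le hle.1 (by omega)
  · exact eq_of_subset_of_card_le hle.2 (by omega)

variable [Fintype ι] [Fintype κ]

theorem ProdFace.sum_le {M : Type*} [AddCommMonoid M] (F : Finset ι → Finset κ → M)
    (y : ProdFace ι κ) [DecidablePred fun z : ProdFace ι κ => z ≤ y] :
    ∑ z with z ≤ y, F z.1.1 z.2.1 = ∑ x ∈ subPairs y.1.1 y.2.1, F x.1 x.2 := by
  refine sum_bij (fun z _ => (z.1.1, z.2.1)) ?_ ?_ ?_ ?_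
  · intro z hz
    simp only [mem_filter, mem_univ, true_and, le_iff] at hz
    exact mem_subPairs.2 ⟨⟨hz.1, z.1.2⟩, hz.2, z.2.2⟩
  · intro z _ z' _ h
    rw [Prod.mk.injEq] at h
    exact Prod.ext (Subtype.ext h.1) (Subtype.ext h.2)
  · intro x hx
    rw [mem_subPairs] at hx
    exact ⟨(⟨x.1, hx.1.2⟩, ⟨x.2, hx.2.2⟩), mem_filter.2
      ⟨mem_univ _, le_iff.2 ⟨hx.1.1, hx.2.1⟩⟩, rfl⟩
  · intro z _
    rfl

open Classical in
theorem ProdFace.recursion (y : ProdFace ι κ) :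
    prodCD y.1.1.card y.2.1.card = eVar ^ (y.rank - 1) + ∑ z with z < y,
      prodCD z.1.1.card z.2.1.card * bVar * eVar ^ (y.rank - z.rank - 1) := by
  have hmem : (y.1.1, y.2.1) ∈ subPairs y.1.1 y.2.1 :=
    mem_subPairs.2 ⟨⟨subset_rfl, y.1.2⟩, subset_rfl, y.2.2⟩
  rw [prodCD_eq]
  congr 1
  refine (sum_bij (fun z _ => (z.1.1, z.2.1)) ?_ ?_ ?_ ?_).symm
  · intro z hz
    simp only [mem_filter, mem_univ, true_and] at hz
    refine mem_erase.2 ⟨fun h => hz.ne ?_, mem_subPairs.2 ⟨⟨hz.le.1, z.1.2⟩, hz.le.2, z.2.2⟩⟩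
    rw [Prod.mk.injEq] at h
    exact Prod.ext (Subtype.ext h.1) (Subtype.ext h.2)
  · intro z _ z' _ h
    rw [Prod.mk.injEq] at h
    exact Prod.ext (Subtype.ext h.1) (Subtype.ext h.2)
  · intro x hx
    rw [mem_erase, mem_subPairs] at hx
    refine ⟨(⟨x.1, hx.2.1.2⟩, ⟨x.2, hx.2.2.2⟩), ?_, rfl⟩
    refine mem_filter.2 ⟨mem_univ _, lt_of_le_of_ne ⟨hx.2.1.1, hx.2.2.1⟩ fun h => hx.1 ?_⟩
    rw [← h]
  · intro z hz
    simp only [mem_filter, mem_univ, true_and] at hz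
    have h1 := z.card_pos
    have h2 := y.card_pos
    simp only [rank]
    congr 2
    omega

/-- The sign of a face is `-(-1)^|A| (-1)^|B|`, so the sums in Euler's relations factor into
alternating sums over two Boolean intervals, at least one of them nontrivial when the face is
proper. -/
theorem ProdFace.prodCD_mem_cd (y : ProdFace ι κ) :
    prodCD y.1.1.card y.2.1.card ∈ cdPolynomials := by
  classical
  induction y using WellFoundedLT.induction with
  | ind y ih =>
    have hsgn : ∀ z : ProdFace ι κ, (-1 : ℤ) ^ z.rank = -((-1) ^ z.1.1.card * (-1) ^ z.2.1.card) := by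
      intro z
      have h := z.card_pos
      rw [← pow_add, show z.1.1.card + z.2.1.card = z.rank + 1 by simp only [rank]; omega, pow_succ]
      ring
    refine mem_cd_of_eulerian (g := ProdFace.rank) (ψ := fun y => prodCD y.1.1.card y.2.1.card)
      ProdFace.rank_strictMono (fun z => by have := z.card_pos; simp only [rank]; omega)
      (fun z _ => z.recursion) ?_ ?_ ih
    · simp_rw [hsgn, sum_neg_distrib]
      rw [sum_le (fun A B => (-1 : ℤ) ^ A.card * (-1) ^ B.card) y, subPairs, sum_product]
      simp only
      rw [← sum_mul_sum, sum_nonempty_sign y.1.2, sum_nonempty_sign y.2.2]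
      norm_num
    · intro x hxy
      simp_rw [hsgn, sum_neg_distrib]
      have := sum_le (fun A B => if x.1.1 ⊆ A ∧ x.2.1 ⊆ B then (-1 : ℤ) ^ A.card * (-1) ^ B.card
        else 0) y
      have h2 : ∀ z : ProdFace ι κ, (x ≤ z ∧ z ≤ y) ↔ (z ≤ y ∧ (x.1.1 ⊆ z.1.1 ∧ x.2.1 ⊆ z.2.1)) :=
        fun z => and_comm
      simp_rw [h2]
      rw [← filter_filter, sum_filter, this, ← sum_filter]
      have h3 : (subPairs y.1.1 y.2.1).filter (fun z => x.1.1 ⊆ z.1 ∧ x.2.1 ⊆ z.2) =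
          (y.1.1.powerset.filter fun T => x.1.1 ⊆ T) ×ˢ
            (y.2.1.powerset.filter fun T => x.2.1 ⊆ T) := by
        ext z
        simp only [mem_filter, mem_subPairs, mem_product, mem_powerset]
        constructor
        · rintro ⟨⟨h1, h2⟩, h3, h4⟩; exact ⟨⟨h1.1, h3⟩, h2.1, h4⟩
        · rintro ⟨⟨h1, h2⟩, h3, h4⟩
          exact ⟨⟨⟨h1, x.1.2.mono h2⟩, h3, x.2.2.mono h4⟩, h2, h4⟩
      rw [h3, sum_product]
      simp only
      rw [← sum_mul_sum, sum_interval_sign _ _ hxy.le.1, sum_interval_sign _ _ hxy.le.2]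
      by_cases hA : x.1.1 = y.1.1
      · have hB : x.2.1 ≠ y.2.1 := fun hB => hxy.ne (Prod.ext (Subtype.ext hA) (Subtype.ext hB))
        simp [hB]
      · simp [hA]

theorem prodCD_mem_cd {p q : ℕ} (hp : 1 ≤ p) (hq : 1 ≤ q) : prodCD p q ∈ cdPolynomials := by
  have := ProdFace.prodCD_mem_cd (ι := Fin p) (κ := Fin q)
    (⟨univ, ⟨⟨0, hp⟩, mem_univ _⟩⟩, ⟨univ, ⟨⟨0, hq⟩, mem_univ _⟩⟩)
  simpa using this

/-! ### Polytopes with the face structure of a product of simplices. -/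

theorem exists_max_eq {ν : Type*} [Fintype ν] [Nonempty ν] (x : ν → ℝ) :
    (argmaxSet x).Nonempty := by
  obtain ⟨i, -, hi⟩ := exists_max_image univ x univ_nonempty
  exact ⟨i, fun j => hi j (mem_univ _)⟩

/-- A function `x i + y j` is maximal exactly on the product of two argmax sets. Stated for
arbitrary vertices, the result covers `Δ_p × Δ_q` and also `Δ_m`, read as `Δ_m × Δ_1`. -/
theorem psi_prod_eq {E : Type*} [AddCommGroup E] [Module ℝ E] [TopologicalSpace E]
    [Nonempty ι] [Nonempty κ] {v : ι × κ → E}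
    (h1 : ∀ l : StrongDual ℝ E, ∃ (x : ι → ℝ) (y : κ → ℝ), ∀ i j, l (v (i, j)) = x i + y j)
    (h2 : ∀ (A : Finset ι) (B : Finset κ), A.Nonempty → B.Nonempty → ∃ l : StrongDual ℝ E,
      {p : ι × κ | p.1 ∈ A ∧ p.2 ∈ B} = argmaxSet fun p => l (v p)) :
    psi (convexHull ℝ (Set.range v)) = prodCD (Fintype.card ι) (Fintype.card κ) := by
  classical
  have key := psi_convexHull_eq (v := v) (Φ := ProdFace ι κ)
    (W := fun x => {p : ι × κ | p.1 ∈ x.1.1 ∧ p.2 ∈ x.2.1}) ?_ ?_ ?_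
    (t := (⟨univ, univ_nonempty⟩, ⟨univ, univ_nonempty⟩)) (by ext; simp)
    ProdFace.rank_strictMono (fun z => by have := z.card_pos; simp only [ProdFace.rank]; omega) ?_
    (ψ := fun y => prodCD y.1.1.card y.2.1.card) (fun x => x.recursion)
  · exact key
  · intro x y
    rw [ProdFace.le_iff]
    constructor
    · exact fun h p hp => ⟨h.1 hp.1, h.2 hp.2⟩
    · intro h
      obtain ⟨⟨A, a, ha⟩, ⟨B, b, hb⟩⟩ := x
      exact ⟨fun i hi => (h (show (i, b) ∈ _ from ⟨hi, hb⟩)).1,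
        fun j hj => (h (show (a, j) ∈ _ from ⟨ha, hj⟩)).2⟩
  · intro x
    obtain ⟨⟨A, a, ha⟩, ⟨B, b, hb⟩⟩ := x
    exact ⟨⟨(a, b), ha, hb⟩, h2 A B ⟨a, ha⟩ ⟨b, hb⟩⟩
  · intro l
    obtain ⟨x, y, hxy⟩ := h1 l
    obtain ⟨a, ha⟩ := exists_max_eq x
    obtain ⟨b, hb⟩ := exists_max_eq y
    refine ⟨(⟨univ.filter fun i => i ∈ argmaxSet x, ⟨a, by simpa using ha⟩⟩,
      ⟨univ.filter fun j => j ∈ argmaxSet y, ⟨b, by simpa using hb⟩⟩), ?_⟩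
    ext ⟨i, j⟩
    simp only [mem_filter, mem_univ, true_and, Set.mem_ofPred_eq]
    constructor
    · rintro ⟨hi, hj⟩ ⟨i', j'⟩
      simp only [hxy]
      exact add_le_add (hi i') (hj j')
    · intro h
      constructor
      · intro i'
        have := h (i', j)
        simp only [hxy] at this
        linarith
      · intro j'
        have := h (i, j')
        simp only [hxy] at this
        linarith
  · rintro ⟨⟨A, hA⟩, ⟨B, hB⟩⟩ h
    simp only [ProdFace.rank] at h
    have hA' := Finset.card_pos.2 hA
    have hB' := Finset.card_pos.2 hB
    by_cases hA2 : 1 < A.card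
    · obtain ⟨a, ha⟩ := hA
      have hc := card_erase_add_one ha
      refine ⟨(⟨A.erase a, Finset.card_pos.1 (by omega)⟩, ⟨B, hB⟩), ?_, ?_⟩
      · refine lt_of_le_of_ne (ProdFace.le_iff.2 ⟨erase_subset _ _, subset_rfl⟩) fun he => ?_
        have h2 : A.erase a = A := congrArg (fun z : ProdFace ι κ => z.1.1) he
        exact notMem_erase a A (h2.symm ▸ ha)
      · simp only [ProdFace.rank]; omega
    · obtain ⟨b, hb⟩ := hB
      have hc := card_erase_add_one hb
      refine ⟨(⟨A, hA⟩, ⟨B.erase b, Finset.card_pos.1 (by omega)⟩), ?_, ?_⟩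
      · refine lt_of_le_of_ne (ProdFace.le_iff.2 ⟨subset_rfl, erase_subset _ _⟩) fun he => ?_
        have h2 : B.erase b = B := congrArg (fun z : ProdFace ι κ => z.2.1) he
        exact notMem_erase b B (h2.symm ▸ hb)
      · simp only [ProdFace.rank]; omega

theorem argmaxSet_indicator_add {A : Finset ι} {B : Finset κ} (hA : A.Nonempty)
    (hB : B.Nonempty) :
    {p : ι × κ | p.1 ∈ A ∧ p.2 ∈ B} = argmaxSet fun p : ι × κ =>
      (if p.1 ∈ A then (1 : ℝ) else 0) + if p.2 ∈ B then 1 else 0 := by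
  obtain ⟨a, ha⟩ := hA
  obtain ⟨b, hb⟩ := hB
  ext ⟨i, j⟩
  simp only [Set.mem_ofPred_eq, argmaxSet]
  constructor
  · rintro ⟨hi, hj⟩ p
    rw [if_pos hi, if_pos hj]
    split_ifs <;> norm_num
  · intro h
    have := h (a, b)
    simp only [ha, hb, if_true] at this
    by_contra hne
    rw [not_and_or] at hne
    split_ifs at this <;> norm_num at this
    all_goals simp_all

theorem psi_simplex_prod {p q : ℕ} (hp : 1 ≤ p) (hq : 1 ≤ q) :
    psi (simplex p ×ˢ simplex q) = prodCD p q := by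
  have : Nonempty (Fin p) := ⟨⟨0, hp⟩⟩
  have : Nonempty (Fin q) := ⟨⟨0, hq⟩⟩
  have hQ : simplex p ×ˢ simplex q = convexHull ℝ (Set.range fun x : Fin p × Fin q =>
      ((Pi.single x.1 1, Pi.single x.2 1) : (Fin p → ℝ) × (Fin q → ℝ))) := by
    rw [simplex, simplex, ← convexHull_rangle_single_eq_stdSimplex,
      ← convexHull_rangle_single_eq_stdSimplex, ← convexHull_prod, Set.prod_range_range_eq]
  rw [hQ, psi_prod_eq]
  · simp
  · intro l
    refine ⟨fun i => l (Pi.single i 1, 0), fun j => l (0, Pi.single j 1), fun i j => ?_⟩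
    rw [← map_add]
    simp
  · intro A B hA hB
    refine ⟨(∑ i ∈ A, ContinuousLinearMap.proj i).comp (ContinuousLinearMap.fst ℝ _ _) +
      (∑ j ∈ B, ContinuousLinearMap.proj j).comp (ContinuousLinearMap.snd ℝ _ _), ?_⟩
    rw [argmaxSet_indicator_add hA hB]
    congr 1
    ext x
    simp [Pi.single_apply]

theorem psi_simplex {m : ℕ} (hm : 1 ≤ m) : psi (simplex m) = prodCD m 1 := by
  have : Nonempty (Fin m) := ⟨⟨0, hm⟩⟩
  have hQ : simplex m = convexHull ℝ (Set.range fun x : Fin m × Fin 1 =>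
      (Pi.single x.1 1 : Fin m → ℝ)) := by
    rw [simplex, ← convexHull_rangle_single_eq_stdSimplex]
    congr 1
    ext y
    simp
  rw [hQ, psi_prod_eq]
  · simp
  · exact fun l => ⟨fun i => l (Pi.single i 1), 0, fun i j => by simp⟩
  · intro A B hA hB
    refine ⟨∑ i ∈ A, ContinuousLinearMap.proj i, ?_⟩
    have hB' : ∀ j : Fin 1, j ∈ B := fun j => by
      obtain ⟨b, hb⟩ := hB
      rwa [Subsingleton.elim j b]
    rw [argmaxSet_indicator_add hA hB]
    ext x
    simp [argmaxSet, Pi.single_apply, hB']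

/-! ### Simplices -/

/-- The `ab`-index of `Δ_m`. -/
def simplexCD (m : ℕ) : ABPoly := prodCD m 1

section Boolean

variable {ι : Type*} [DecidableEq ι]

/-- The nonempty proper subsets. -/
def properSubsets (D : Finset ι) : Finset (Finset ι) := D.ssubsets.filter fun T => T.Nonempty

theorem mem_properSubsets {D T : Finset ι} : T ∈ properSubsets D ↔ T ⊂ D ∧ T.Nonempty := by
  simp [properSubsets]

theorem simplexCD_lower (D : Finset ι) :
    simplexCD D.card = eVar ^ (D.card - 1) +
      ∑ T ∈ properSubsets D, simplexCD T.card * bVar * eVar ^ ((D \ T).card - 1) := by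
  have h := prodCD_eq D (univ : Finset (Fin 1))
  rw [card_univ, Fintype.card_fin, show D.card + 1 - 2 = D.card - 1 by omega] at h
  rw [simplexCD, h]
  congr 1
  have huniv : ∀ B : Finset (Fin 1), B.Nonempty → B = univ := by decide
  refine sum_bij' (fun x _ => x.1) (fun T _ => (T, univ)) ?_ ?_ ?_ ?_ ?_
  · intro x hx
    rw [mem_erase, mem_subPairs] at hx
    refine mem_properSubsets.2 ⟨hx.2.1.1.ssubset_of_ne fun h => hx.1 ?_, hx.2.1.2⟩
    exact Prod.ext h (huniv _ hx.2.2.2)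
  · intro T hT
    rw [mem_properSubsets] at hT
    exact mem_erase.2 ⟨fun h => hT.1.ne (Prod.ext_iff.1 h).1,
      mem_subPairs.2 ⟨⟨hT.1.subset, hT.2⟩, subset_rfl, univ_nonempty⟩⟩
  · intro x hx
    rw [mem_erase, mem_subPairs] at hx
    exact Prod.ext rfl (huniv _ hx.2.2.2).symm
  · intro T _
    rfl
  · intro x hx
    rw [mem_erase, mem_subPairs] at hx
    rw [huniv _ hx.2.2.2, card_univ, Fintype.card_fin, card_sdiff_of_subset hx.2.1.1, simplexCD]
    congr 2
    omega

/-- The recursion by the smallest member of a chain of sets instead of the largest. Expanding both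
sides once more, by induction and by the lower recursion, gives the same sum over chains `R ⊂ T ⊂
D`, indexed on the right by `R` and `V = T \ R`. -/
theorem simplexCD_upper (D : Finset ι) :
    simplexCD D.card = eVar ^ (D.card - 1) +
      ∑ T ∈ properSubsets D, eVar ^ (T.card - 1) * bVar * simplexCD (D \ T).card := by
  induction D using Finset.strongInduction with
  | H D ih =>
    have h1 : ∑ T ∈ properSubsets D, simplexCD T.card * bVar * eVar ^ ((D \ T).card - 1) =
        ∑ T ∈ properSubsets D, eVar ^ (T.card - 1) * bVar * eVar ^ ((D \ T).card - 1) +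
        ∑ T ∈ properSubsets D, ∑ R ∈ properSubsets T,
          eVar ^ (R.card - 1) * bVar * simplexCD (T \ R).card * bVar *
            eVar ^ ((D \ T).card - 1) := by
      rw [← sum_add_distrib]
      refine sum_congr rfl fun T hT => ?_
      rw [ih T (mem_properSubsets.1 hT).1, add_mul, add_mul, sum_mul, sum_mul]
    rw [simplexCD_lower D, h1]
    congr 1
    have h2 : ∀ T ∈ properSubsets D, eVar ^ (T.card - 1) * bVar * simplexCD (D \ T).card =
        eVar ^ (T.card - 1) * bVar * eVar ^ ((D \ T).card - 1) +
        ∑ V ∈ properSubsets (D \ T), eVar ^ (T.card - 1) * bVar * simplexCD V.card * bVar *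
            eVar ^ (((D \ T) \ V).card - 1) := by
      intro T _
      rw [simplexCD_lower (D \ T), mul_add, mul_sum]
      simp only [mul_assoc]
    rw [sum_congr rfl h2, sum_add_distrib]
    congr 1
    rw [sum_sigma', sum_sigma']
    refine sum_bij' (fun x _ => ⟨x.2, x.1 \ x.2⟩) (fun x _ => ⟨x.1 ∪ x.2, x.1⟩) ?_ ?_ ?_ ?_ ?_
    · rintro ⟨T, R⟩ h
      simp only [mem_sigma, mem_properSubsets] at h ⊢
      obtain ⟨⟨hTD, -⟩, hRT, hR⟩ := h
      obtain ⟨x, hx, hx'⟩ := exists_of_ssubset hTD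
      refine ⟨⟨hRT.trans hTD, hR⟩, ⟨sdiff_subset_sdiff hTD.subset subset_rfl, fun hsub => ?_⟩,
        sdiff_nonempty.2 hRT.2⟩
      exact hx' (mem_sdiff.1 (hsub (mem_sdiff.2 ⟨hx, fun h => hx' (hRT.subset h)⟩))).1
    · rintro ⟨R, V⟩ h
      simp only [mem_sigma, mem_properSubsets] at h ⊢
      obtain ⟨⟨hRD, hR⟩, hV, v, hv⟩ := h
      obtain ⟨x, hx, hx'⟩ := exists_of_ssubset hV
      rw [mem_sdiff] at hx
      refine ⟨⟨⟨union_subset hRD.subset (hV.subset.trans sdiff_subset), fun hsub => ?_⟩,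
        hR.mono subset_union_left⟩, ⟨subset_union_left, fun hsub => ?_⟩, hR⟩
      · rcases mem_union.1 (hsub hx.1) with h | h
        · exact hx.2 h
        · exact hx' h
      · exact (mem_sdiff.1 (hV.subset hv)).2 (hsub (mem_union_right _ hv))
    · rintro ⟨T, R⟩ h
      simp only [mem_sigma, mem_properSubsets] at h
      simp [union_sdiff_of_subset h.2.1.subset]
    · rintro ⟨R, V⟩ h
      simp only [mem_sigma, mem_properSubsets] at h
      have : (R ∪ V) \ R = V := by
        rw [union_sdiff_left, Finset.sdiff_eq_self_iff_disjoint]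
        exact disjoint_of_subset_left h.2.1.subset sdiff_disjoint
      simp [this]
    · rintro ⟨T, R⟩ h
      simp only [mem_sigma, mem_properSubsets] at h
      simp only [_root_.sdiff_sdiff_left, sup_eq_union, union_sdiff_of_subset h.2.1.subset]

/-- The weight of the chains of sets that start at `S` and end below `U`. -/
def upperWeight (U S : Finset ι) : ABPoly := if S = U then 1 else bVar * simplexCD (U \ S).card

theorem upperWeight_self (U : Finset ι) : upperWeight U U = 1 := if_pos rfl

theorem upperWeight_of_ne {U S : Finset ι} (h : S ≠ U) :
    upperWeight U S = bVar * simplexCD (U \ S).card := if_neg h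

theorem sum_properSubsets_sdiff {M : Type*} [AddCommMonoid M] {T U : Finset ι} (hTU : T ⊆ U)
    (F : Finset ι → M) :
    ∑ V ∈ properSubsets (U \ T), F (T ∪ V) = ∑ S ∈ U.powerset with T ⊂ S ∧ S ≠ U, F S := by
  refine sum_bij' (fun V _ => T ∪ V) (fun S _ => S \ T) ?_ ?_ ?_ ?_ (fun _ _ => rfl)
  · intro V hV
    rw [mem_properSubsets] at hV
    obtain ⟨hV, v, hv⟩ := hV
    obtain ⟨x, hx, hx'⟩ := exists_of_ssubset hV
    rw [mem_sdiff] at hx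
    rw [mem_filter, mem_powerset]
    refine ⟨union_subset hTU (hV.subset.trans sdiff_subset),
      ⟨subset_union_left, fun hsub => ?_⟩, fun h => ?_⟩
    · exact (mem_sdiff.1 (hV.subset hv)).2 (hsub (mem_union_right _ hv))
    · rcases mem_union.1 (h.symm ▸ hx.1) with h | h
      · exact hx.2 h
      · exact hx' h
  · intro S hS
    rw [mem_filter, mem_powerset] at hS
    obtain ⟨x, hx, hx'⟩ := exists_of_ssubset (hS.1.ssubset_of_ne hS.2.2)
    refine mem_properSubsets.2 ⟨⟨sdiff_subset_sdiff hS.1 subset_rfl, fun hsub => ?_⟩,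
      sdiff_nonempty.2 hS.2.1.2⟩
    exact hx' (mem_sdiff.1 (hsub (mem_sdiff.2 ⟨hx, fun h => hx' (hS.2.1.subset h)⟩))).1
  · intro V hV
    have hV := (mem_properSubsets.1 hV).1
    rw [union_sdiff_left, Finset.sdiff_eq_self_iff_disjoint]
    exact disjoint_of_subset_left hV.subset sdiff_disjoint
  · intro S hS
    rw [mem_filter] at hS
    exact union_sdiff_of_subset hS.2.1.subset

/-- The interval from `S` to `U` is Boolean, so the lower recursion for the simplex on `U \ S`
transfers along `V ↦ S ∪ V`. -/
theorem upperWeight_lower {U S : Finset ι} (h : S ⊂ U) :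
    upperWeight U S = bVar * eVar ^ (U.card - S.card - 1) +
      ∑ S' ∈ U.powerset with S ⊂ S' ∧ S' ≠ U,
        upperWeight S' S * bVar * eVar ^ (U.card - S'.card - 1) := by
  rw [upperWeight_of_ne h.ne, simplexCD_lower, mul_add, card_sdiff_of_subset h.subset]
  congr 1
  rw [← sum_properSubsets_sdiff h.subset, mul_sum]
  refine sum_congr rfl fun V hV => ?_
  obtain ⟨hV, hV0⟩ := mem_properSubsets.1 hV
  have hd : Disjoint S V :=
    (disjoint_of_subset_left hV.subset sdiff_disjoint).symm
  have hne : S ≠ S ∪ V := fun he => by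
    obtain ⟨v, hv⟩ := hV0
    exact (disjoint_left.1 hd (he.symm ▸ mem_union_right _ hv)) hv
  rw [upperWeight_of_ne hne, union_sdiff_cancel_left hd, card_sdiff_of_subset hV.subset,
    card_sdiff_of_subset h.subset, card_union_of_disjoint hd, ← mul_assoc, ← mul_assoc,
    show U.card - S.card - V.card - 1 = U.card - (S.card + V.card) - 1 by omega]

/-- The summand `S = T` gives `b` times the index of the simplex on `U \ T`, and the remaining ones
give `e` times it by the upper recursion. The total `e + b = a` is what later completes `ba` in `d`.
-/
theorem sum_eVar_mul_upperWeight {U T : Finset ι} (h : T ⊆ U) :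
    ∑ S ∈ U.powerset with T ⊆ S, eVar ^ (S.card - T.card) * upperWeight U S =
      if T = U then 1 else aVar * simplexCD (U \ T).card := by
  split_ifs with hTU
  · subst hTU
    have : (T.powerset.filter fun S => T ⊆ S) = {T} := by
      ext S
      simp only [mem_filter, mem_powerset, mem_singleton]
      exact ⟨fun h => h.1.antisymm h.2, by rintro rfl; exact ⟨subset_rfl, subset_rfl⟩⟩
    simp [this, upperWeight_self]
  · have hss := h.ssubset_of_ne hTU
    have hsplit : (U.powerset.filter fun S => T ⊆ S) =
        insert T (insert U (U.powerset.filter fun S => T ⊂ S ∧ S ≠ U)) := by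
      ext S
      simp only [mem_filter, mem_powerset, mem_insert]
      constructor
      · rintro ⟨h1, h2⟩
        by_cases hST : S = T
        · exact Or.inl hST
        by_cases hSU : S = U
        · exact Or.inr (Or.inl hSU)
        exact Or.inr (Or.inr ⟨h1, h2.ssubset_of_ne (Ne.symm hST), hSU⟩)
      · rintro (rfl | rfl | ⟨h1, h2, -⟩)
        · exact ⟨h, subset_rfl⟩
        · exact ⟨subset_rfl, h⟩
        · exact ⟨h1, h2.subset⟩
    rw [hsplit, sum_insert (by simp [hTU]), sum_insert (by simp), upperWeight_self,
      upperWeight_of_ne hTU, Nat.sub_self, pow_zero, one_mul, mul_one, aVar_eq, add_mul, add_comm]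
    congr 1
    have hpos : 0 < (U \ T).card := card_pos.2 (sdiff_nonempty.2 hss.2)
    rw [simplexCD_upper, mul_add, ← pow_succ', Nat.sub_add_cancel hpos,
      card_sdiff_of_subset h]
    congr 1
    rw [← sum_properSubsets_sdiff h, mul_sum]
    refine sum_congr rfl fun V hV => ?_
    obtain ⟨hV, hV0⟩ := mem_properSubsets.1 hV
    have hd : Disjoint T V := (disjoint_of_subset_left hV.subset sdiff_disjoint).symm
    have hne : T ∪ V ≠ U := fun he => by
      apply hV.ne
      rw [← he, union_sdiff_cancel_left hd]
    have hVpos := card_pos.2 hV0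
    rw [upperWeight_of_ne hne, card_union_of_disjoint hd, Nat.add_sub_cancel_left,
      ← sup_eq_union, ← _root_.sdiff_sdiff_left, ← mul_assoc, ← mul_assoc, ← mul_assoc, ← pow_succ',
      Nat.sub_add_cancel hVpos]

end Boolean

/-! ### The faces of the base polytope of a rank two matroid -/

section Pairs

variable {ι κ : Type*} [LinearOrder ι]

/-- `A` contains the minimum of `A ∪ B`. -/
def Precedes (A B : Finset ι) : Prop := ∃ a ∈ A, ∀ b ∈ B, a < b

theorem Precedes.asymm {A B : Finset ι} (h : Precedes A B) : ¬ Precedes B A := by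
  rintro ⟨b, hb, hb'⟩
  obtain ⟨a, ha, ha'⟩ := h
  exact lt_asymm (ha' b hb) (hb' a ha)

theorem precedes_or_precedes {A B : Finset ι} (hA : A.Nonempty) (hB : B.Nonempty)
    (hd : Disjoint A B) : Precedes A B ∨ Precedes B A := by
  have hne : A.min' hA ≠ B.min' hB := fun h =>
    disjoint_left.1 hd (A.min'_mem hA) (h ▸ B.min'_mem hB)
  rcases hne.lt_or_gt with h | h
  · exact Or.inl ⟨_, A.min'_mem hA, fun b hb => h.trans_le (B.min'_le b hb)⟩
  · exact Or.inr ⟨_, B.min'_mem hB, fun a ha => h.trans_le (A.min'_le a ha)⟩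

open Classical in
/-- The pair, ordered such that the first set contains the minimum. -/
def orient (p : Finset ι × Finset ι) : Finset ι × Finset ι := if Precedes p.1 p.2 then p else p.swap

theorem orient_of_precedes {p : Finset ι × Finset ι} (h : Precedes p.1 p.2) : orient p = p :=
  if_pos h

theorem orient_swap_of_precedes {p : Finset ι × Finset ι} (h : Precedes p.1 p.2) :
    orient p.swap = p :=
  (if_neg h.asymm : orient p.swap = _).trans p.swap_swap

theorem orient_eq_or (p : Finset ι × Finset ι) : orient p = p ∨ orient p = p.swap := by
  unfold orient
  split_ifs
  · exact Or.inl rfl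
  · exact Or.inr rfl

/-- `{A, B}` gives a face `Δ_A × Δ_B` of the base polytope: one of the two sets is contained in a
parallelism class that does not meet the other. -/
def IsSplit (f : ι → κ) (A B : Finset ι) : Prop :=
  A.Nonempty ∧ B.Nonempty ∧ (∀ a ∈ A, ∀ b ∈ B, f a ≠ f b) ∧
    ((∀ a ∈ A, ∀ a' ∈ A, f a = f a') ∨ (∀ b ∈ B, ∀ b' ∈ B, f b = f b'))

variable {f : ι → κ} {A B A' B' S S' T : Finset ι}

theorem IsSplit.symm (h : IsSplit f A B) : IsSplit f B A :=
  ⟨h.2.1, h.1, fun b hb a ha => (h.2.2.1 a ha b hb).symm, h.2.2.2.symm⟩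

theorem IsSplit.mono (h : IsSplit f A B) (hA : A' ⊆ A) (hB : B' ⊆ B) (hA' : A'.Nonempty)
    (hB' : B'.Nonempty) : IsSplit f A' B' :=
  ⟨hA', hB', fun a ha b hb => h.2.2.1 a (hA ha) b (hB hb), h.2.2.2.imp
    (fun h a ha a' ha' => h a (hA ha) a' (hA ha')) (fun h b hb b' hb' => h b (hB hb) b' (hB hb'))⟩

theorem IsSplit.disjoint (h : IsSplit f A B) : Disjoint A B :=
  disjoint_left.2 fun _ ha hb => h.2.2.1 _ ha _ hb rfl

theorem IsSplit.card_union (h : IsSplit f A B) : (A ∪ B).card = A.card + B.card :=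
  card_union_of_disjoint h.disjoint

theorem IsSplit.orient {p : Finset ι × Finset ι} (h : IsSplit f p.1 p.2) :
    IsSplit f (orient p).1 (orient p).2 ∧ Precedes (orient p).1 (orient p).2 := by
  rcases precedes_or_precedes h.1 h.2.1 h.disjoint with hp | hp
  · rw [orient_of_precedes hp]; exact ⟨h, hp⟩
  · have : RankTwoCD.orient p = p.swap := if_neg hp.asymm
    rw [this]; exact ⟨h.symm, hp⟩

/-- The vertices `e_i + e_j`, for `i` and `j` in different classes. -/
abbrev CrossPair (f : ι → κ) : Type _ := {p : ι × ι // f p.1 ≠ f p.2}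

/-- The vertices of the face of `{A, B}`. -/
def pairVertices (f : ι → κ) (A B : Finset ι) : Set (CrossPair f) :=
  {p | (p.1.1 ∈ A ∧ p.1.2 ∈ B) ∨ (p.1.1 ∈ B ∧ p.1.2 ∈ A)}

/-- The vertices of the face supported on `S`. -/
def bigVertices (f : ι → κ) (S : Finset ι) : Set (CrossPair f) := {p | p.1.1 ∈ S ∧ p.1.2 ∈ S}

theorem pairVertices_comm : pairVertices f A B = pairVertices f B A := by
  ext p; exact or_comm

/-- A single vertex decides which of `A'` and `B'` receives `A`; disjointness of `A'` and `B'`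
forces the same choice at all other vertices. -/
theorem pairVertices_subset_iff (h : IsSplit f A B) (h' : IsSplit f A' B') :
    pairVertices f A B ⊆ pairVertices f A' B' ↔ (A ⊆ A' ∧ B ⊆ B') ∨ (A ⊆ B' ∧ B ⊆ A') := by
  constructor
  · intro hs
    obtain ⟨a, ha⟩ := h.1
    obtain ⟨b, hb⟩ := h.2.1
    have key : ∀ x ∈ A, ∀ y ∈ B, (x ∈ A' ∧ y ∈ B') ∨ (x ∈ B' ∧ y ∈ A') := fun x hx y hy =>
      hs (show (⟨(x, y), h.2.2.1 x hx y hy⟩ : CrossPair f) ∈ _ from Or.inl ⟨hx, hy⟩)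
    have hd := disjoint_left.1 h'.disjoint
    rcases key a ha b hb with ⟨ha', hb'⟩ | ⟨ha', hb'⟩
    · exact Or.inl ⟨fun x hx => ((key x hx b hb).resolve_right fun h => hd h.2 hb').1,
        fun y hy => ((key a ha y hy).resolve_right fun h => hd ha' h.1).2⟩
    · exact Or.inr ⟨fun x hx => ((key x hx b hb).resolve_left fun h => hd hb' h.2).1,
        fun y hy => ((key a ha y hy).resolve_left fun h => hd h.1 ha').2⟩
  · rintro (⟨hA, hB⟩ | ⟨hA, hB⟩) p (hp | hp)
    · exact Or.inl ⟨hA hp.1, hB hp.2⟩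
    · exact Or.inr ⟨hB hp.1, hA hp.2⟩
    · exact Or.inr ⟨hA hp.1, hB hp.2⟩
    · exact Or.inl ⟨hB hp.1, hA hp.2⟩

theorem pairVertices_subset_bigVertices_iff (h : IsSplit f A B) :
    pairVertices f A B ⊆ bigVertices f S ↔ A ⊆ S ∧ B ⊆ S := by
  constructor
  · intro hs
    obtain ⟨a, ha⟩ := h.1
    obtain ⟨b, hb⟩ := h.2.1
    have key : ∀ x ∈ A, ∀ y ∈ B, x ∈ S ∧ y ∈ S := fun x hx y hy =>
      hs (show (⟨(x, y), h.2.2.1 x hx y hy⟩ : CrossPair f) ∈ _ from Or.inl ⟨hx, hy⟩)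
    exact ⟨fun x hx => (key x hx b hb).1, fun y hy => (key a ha y hy).2⟩
  · rintro ⟨hA, hB⟩ p (hp | hp)
    · exact ⟨hA hp.1, hB hp.2⟩
    · exact ⟨hB hp.1, hA hp.2⟩

variable [DecidableEq κ]

/-- `S` meets at least three classes. -/
def IsBig (f : ι → κ) (S : Finset ι) : Prop := 3 ≤ (S.image f).card

instance (f : ι → κ) : DecidablePred (IsBig f) := fun _ => inferInstanceAs (Decidable (3 ≤ _))

theorem IsBig.mono (h : IsBig f S) (hS : S ⊆ S') : IsBig f S' :=
  le_trans h (card_le_card (image_subset_image hS))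

theorem IsBig.card_le (h : IsBig f S) : 3 ≤ S.card := le_trans h card_image_le

theorem IsBig.exists_three (h : IsBig f S) : ∃ x ∈ S, ∃ y ∈ S, ∃ z ∈ S,
    f x ≠ f y ∧ f x ≠ f z ∧ f y ≠ f z := by
  obtain ⟨a, b, c, ha, hb, hc, hab, hac, hbc⟩ := two_lt_card_iff.1 h
  obtain ⟨x, hx, rfl⟩ := mem_image.1 ha
  obtain ⟨y, hy, rfl⟩ := mem_image.1 hb
  obtain ⟨z, hz, rfl⟩ := mem_image.1 hc
  exact ⟨x, hx, y, hy, z, hz, hab, hac, hbc⟩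

theorem IsBig.exists_ne (h : IsBig f S) (x : ι) : ∃ y ∈ S, f x ≠ f y := by
  obtain ⟨a, ha, b, hb, _, _, hab, _, _⟩ := h.exists_three
  by_cases hx : f x = f a
  · exact ⟨b, hb, hx ▸ hab⟩
  · exact ⟨a, ha, hx⟩

/-- Three elements in three classes span a triangle of vertices, but the pairs between `A` and `B`
form a bipartite graph. -/
theorem not_bigVertices_subset_pairVertices (h : IsBig f S) (h' : IsSplit f A B) :
    ¬ bigVertices f S ⊆ pairVertices f A B := by
  intro hs
  obtain ⟨x, hx, y, hy, z, hz, hxy, hxz, hyz⟩ := h.exists_three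
  have hd := disjoint_left.1 h'.disjoint
  have h1 : (x ∈ A ∧ y ∈ B) ∨ (x ∈ B ∧ y ∈ A) :=
    hs (show (⟨(x, y), hxy⟩ : CrossPair f) ∈ _ from ⟨hx, hy⟩)
  have h2 : (x ∈ A ∧ z ∈ B) ∨ (x ∈ B ∧ z ∈ A) :=
    hs (show (⟨(x, z), hxz⟩ : CrossPair f) ∈ _ from ⟨hx, hz⟩)
  have h3 : (y ∈ A ∧ z ∈ B) ∨ (y ∈ B ∧ z ∈ A) :=
    hs (show (⟨(y, z), hyz⟩ : CrossPair f) ∈ _ from ⟨hy, hz⟩)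
  have hx' := @hd x
  have hy' := @hd y
  have hz' := @hd z
  tauto

theorem bigVertices_subset_iff (h : IsBig f S) :
    bigVertices f S ⊆ bigVertices f S' ↔ S ⊆ S' := by
  refine ⟨fun hs x hx => ?_, fun hs p hp => ⟨hs hp.1, hs hp.2⟩⟩
  obtain ⟨y, hy, hxy⟩ := h.exists_ne x
  exact (hs (show (⟨(x, y), hxy⟩ : CrossPair f) ∈ _ from ⟨hx, hy⟩)).1

variable [Fintype ι]

open Classical in
/-- The pairs `{A, B}` that give a face of the base polytope. -/
def splitPairs (f : ι → κ) : Finset (Finset ι × Finset ι) :=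
  univ.filter fun p => IsSplit f p.1 p.2 ∧ Precedes p.1 p.2

theorem mem_splitPairs {p : Finset ι × Finset ι} :
    p ∈ splitPairs f ↔ IsSplit f p.1 p.2 ∧ Precedes p.1 p.2 := by
  simp [splitPairs]

theorem orient_mem_splitPairs {p : Finset ι × Finset ι} (h : IsSplit f p.1 p.2) :
    orient p ∈ splitPairs f := mem_splitPairs.2 h.orient

/-- The nonempty faces of the base polytope. -/
def RankTwoFace (f : ι → κ) : Type _ := {p // p ∈ splitPairs f} ⊕ {S // IsBig f S}

instance (f : ι → κ) : Fintype (RankTwoFace f) :=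
  inferInstanceAs (Fintype ({p // p ∈ splitPairs f} ⊕ {S // IsBig f S}))

namespace RankTwoFace

/-- The face `Δ_A × Δ_B`. -/
def pair (p : Finset ι × Finset ι) (h : p ∈ splitPairs f) : RankTwoFace f := Sum.inl ⟨p, h⟩

/-- The face supported on `S`. -/
def big (S : Finset ι) (h : IsBig f S) : RankTwoFace f := Sum.inr ⟨S, h⟩

theorem cases {motive : RankTwoFace f → Prop} (h1 : ∀ p h, motive (pair p h))
    (h2 : ∀ S h, motive (big S h)) (x : RankTwoFace f) : motive x := by
  rcases x with ⟨p, h⟩ | ⟨S, h⟩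
  · exact h1 p h
  · exact h2 S h

/-- The set of vertices on a face. -/
def vertices : RankTwoFace f → Set (CrossPair f)
  | Sum.inl p => pairVertices f p.1.1 p.1.2
  | Sum.inr S => bigVertices f S.1

/-- The rank of a face. -/
def rank : RankTwoFace f → ℕ
  | Sum.inl p => p.1.1.card + p.1.2.card - 1
  | Sum.inr S => S.1.card

theorem vertices_injective : Function.Injective (vertices : RankTwoFace f → _) := by
  intro x y
  induction x using cases with
  | h1 p hp =>
    have hs := (mem_splitPairs.1 hp).1
    induction y using cases with
    | h1 q hq =>
      have hs' := (mem_splitPairs.1 hq).1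
      intro heq
      have hd := hs.disjoint
      have hd' := hs'.disjoint
      rcases (pairVertices_subset_iff hs hs').1 heq.subset with ⟨h1, h2⟩ | ⟨h1, h2⟩ <;>
      rcases (pairVertices_subset_iff hs' hs).1 heq.superset with ⟨h3, h4⟩ | ⟨h3, h4⟩
      · have : p = q := Prod.ext (h1.antisymm h3) (h2.antisymm h4)
        subst this; rfl
      · obtain ⟨a, ha⟩ := hs.1
        exact absurd (h3 (h1 ha)) (disjoint_left.1 hd ha)
      · obtain ⟨a, ha⟩ := hs.1
        exact absurd (h4 (h1 ha)) (disjoint_left.1 hd ha)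
      · have hp2 := (mem_splitPairs.1 hp).2
        have hq2 := (mem_splitPairs.1 hq).2
        rw [h1.antisymm h4, h2.antisymm h3] at hp2
        exact absurd hp2 hq2.asymm
    | h2 S hS => exact fun heq => absurd heq.superset (not_bigVertices_subset_pairVertices hS hs)
  | h2 S hS =>
    induction y using cases with
    | h1 q hq =>
      exact fun heq => absurd heq.subset
        (not_bigVertices_subset_pairVertices hS (mem_splitPairs.1 hq).1)
    | h2 S' hS' =>
      intro heq
      have : S = S' := ((bigVertices_subset_iff hS).1 heq.subset).antisymm
        ((bigVertices_subset_iff hS').1 heq.superset)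
      subst this; rfl

instance : PartialOrder (RankTwoFace f) := PartialOrder.lift vertices vertices_injective

theorem le_iff {x y : RankTwoFace f} : x ≤ y ↔ x.vertices ⊆ y.vertices := Iff.rfl

theorem pair_le_pair {p q : Finset ι × Finset ι} {hp : p ∈ splitPairs f} {hq : q ∈ splitPairs f} :
    pair p hp ≤ pair q hq ↔ (p.1 ⊆ q.1 ∧ p.2 ⊆ q.2) ∨ (p.1 ⊆ q.2 ∧ p.2 ⊆ q.1) :=
  pairVertices_subset_iff (mem_splitPairs.1 hp).1 (mem_splitPairs.1 hq).1

theorem pair_le_big {p : Finset ι × Finset ι} {hp : p ∈ splitPairs f} {hS : IsBig f S} :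
    pair p hp ≤ big S hS ↔ p.1 ∪ p.2 ⊆ S := by
  rw [union_subset_iff]
  exact pairVertices_subset_bigVertices_iff (mem_splitPairs.1 hp).1

theorem not_big_le_pair {p : Finset ι × Finset ι} {hp : p ∈ splitPairs f} {hS : IsBig f S} :
    ¬ big S hS ≤ pair p hp :=
  not_bigVertices_subset_pairVertices hS (mem_splitPairs.1 hp).1

theorem big_le_big {hS : IsBig f S} {hS' : IsBig f S'} : big S hS ≤ big S' hS' ↔ S ⊆ S' :=
  bigVertices_subset_iff hS

theorem pair_lt_big {p : Finset ι × Finset ι} {hp : p ∈ splitPairs f} {hS : IsBig f S} :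
    pair p hp < big S hS ↔ p.1 ∪ p.2 ⊆ S := by
  rw [lt_iff_le_not_ge, pair_le_big]
  exact and_iff_left not_big_le_pair

theorem big_lt_big {hS : IsBig f S} {hS' : IsBig f S'} : big S hS < big S' hS' ↔ S ⊂ S' := by
  rw [lt_iff_le_not_ge, big_le_big, big_le_big]; rfl

theorem card_pos {p : Finset ι × Finset ι} (hp : p ∈ splitPairs f) :
    0 < p.1.card ∧ 0 < p.2.card :=
  ⟨Finset.card_pos.2 (mem_splitPairs.1 hp).1.1, Finset.card_pos.2 (mem_splitPairs.1 hp).1.2.1⟩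

theorem one_le_rank (x : RankTwoFace f) : 1 ≤ x.rank := by
  induction x using cases with
  | h1 p hp =>
    have := card_pos hp
    simp only [pair, rank]; omega
  | h2 S hS =>
    have := hS.card_le
    simp only [big, rank]; omega

theorem rank_strictMono : StrictMono (rank : RankTwoFace f → ℕ) := by
  intro x y hxy
  induction x using cases with
  | h1 p hp =>
    have hpos := card_pos hp
    induction y using cases with
    | h1 q hq =>
      have hpos' := card_pos hq
      simp only [pair, rank]
      by_contra hlt
      refine hxy.not_ge ?_
      rw [pair_le_pair]
      rcases pair_le_pair.1 hxy.le with ⟨h1, h2⟩ | ⟨h1, h2⟩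
      · have e1 := card_le_card h1
        have e2 := card_le_card h2
        exact Or.inl ⟨(eq_of_subset_of_card_le h1 (by omega)).superset,
          (eq_of_subset_of_card_le h2 (by omega)).superset⟩
      · have e1 := card_le_card h1
        have e2 := card_le_card h2
        exact Or.inr ⟨(eq_of_subset_of_card_le h2 (by omega)).superset,
          (eq_of_subset_of_card_le h1 (by omega)).superset⟩
    | h2 S hS =>
      have := card_le_card (pair_le_big.1 hxy.le)
      rw [(mem_splitPairs.1 hp).1.card_union] at this
      simp only [pair, big, rank]; omega
  | h2 S hS =>
    induction y using cases with
    | h1 q hq => exact absurd hxy.le not_big_le_pair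
    | h2 S' hS' => exact card_lt_card (big_lt_big.1 hxy)

theorem exists_vertices_eq (h : IsSplit f A B) :
    ∃ x : RankTwoFace f, x.vertices = pairVertices f A B ∧ x.rank = A.card + B.card - 1 := by
  have hm : orient (A, B) ∈ splitPairs f := orient_mem_splitPairs h
  refine ⟨pair (orient (A, B)) hm, ?_⟩
  simp only [vertices, rank, pair]
  rcases orient_eq_or (A, B) with h' | h'
  · rw [h']; exact ⟨rfl, rfl⟩
  · rw [h']; exact ⟨pairVertices_comm, by simp [add_comm]⟩

theorem IsBig_split (h : IsBig f S) {c : κ} (hc : c ∈ S.image f) :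
    IsSplit f (S.filter fun x => f x = c) (S.filter fun x => f x ≠ c) := by
  obtain ⟨x, hx, rfl⟩ := mem_image.1 hc
  obtain ⟨y, hy, hxy⟩ := h.exists_ne x
  refine ⟨⟨x, by simp [hx]⟩, ⟨y, by simp [hy, hxy.symm]⟩, ?_, Or.inl ?_⟩
  · intro a ha b hb hab
    rw [mem_filter] at ha hb
    exact hb.2 (hab ▸ ha.2)
  · intro a ha b hb
    rw [mem_filter] at ha hb
    rw [ha.2, hb.2]

/-- Below a product face, delete one element from a set that has at least two. Below a big face,
split one class off `S`: the sizes then add up to `|S|`, so the rank falls by one. -/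
theorem exists_lt_rank (x : RankTwoFace f) (hx : 1 < x.rank) : ∃ y < x, x.rank = y.rank + 1 := by
  have main : ∀ A B : Finset ι, IsSplit f A B → pairVertices f A B ⊆ x.vertices →
      x.rank = A.card + B.card → ∃ y < x, x.rank = y.rank + 1 := by
    intro A B h hsub hr
    have := Finset.card_pos.2 h.1
    obtain ⟨y, hy, hyr⟩ := exists_vertices_eq h
    refine ⟨y, lt_of_le_of_ne (le_iff.2 (hy ▸ hsub)) ?_, by omega⟩
    rintro rfl
    omega
  induction x using cases with
  | h1 p hp =>
    have hs := (mem_splitPairs.1 hp).1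
    simp only [pair, rank] at hx main ⊢
    have hpos := card_pos hp
    by_cases hA : 1 < p.1.card
    · obtain ⟨a, ha⟩ := hs.1
      have hc := card_erase_add_one ha
      have hs' := hs.mono (erase_subset a p.1) subset_rfl
        (Finset.card_pos.1 (by omega)) hs.2.1
      exact main _ _ hs' ((pairVertices_subset_iff hs' hs).2
        (Or.inl ⟨erase_subset _ _, subset_rfl⟩)) (by omega)
    · obtain ⟨b, hb⟩ := hs.2.1
      have hc := card_erase_add_one hb
      have hs' := hs.mono subset_rfl (erase_subset b p.2) hs.1
        (Finset.card_pos.1 (by omega))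
      exact main _ _ hs' ((pairVertices_subset_iff hs' hs).2
        (Or.inl ⟨subset_rfl, erase_subset _ _⟩)) (by omega)
  | h2 S hS =>
    obtain ⟨x, hx, -⟩ := hS.exists_three
    have hs := IsBig_split hS (mem_image_of_mem f hx)
    refine main _ _ hs ((pairVertices_subset_bigVertices_iff hs).2
      ⟨filter_subset _ _, filter_subset _ _⟩) ?_
    exact (card_filter_add_card_filter_not _).symm

end RankTwoFace

end Pairs

/-! ### The closed formula for the index of a big face and its recursion. -/

section Formula

variable {ι κ : Type*} [LinearOrder ι] [Fintype ι] [DecidableEq κ]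

/-- The weight of the chains of faces of product type below the face supported on `S`. -/
def splitWeight (f : ι → κ) (S : Finset ι) : ABPoly :=
  eVar ^ (S.card - 1) + ∑ p ∈ splitPairs f with p.1 ∪ p.2 ⊆ S,
    prodCD p.1.card p.2.card * bVar * eVar ^ (S.card - p.1.card - p.2.card)

/-- The `ab`-index of the face supported on `U`. -/
def bigCD (f : ι → κ) (U : Finset ι) : ABPoly :=
  ∑ S ∈ U.powerset with IsBig f S, splitWeight f S * upperWeight U S

variable {f : ι → κ}

/-- Expanding `upperWeight U S` by the largest proper big member `S'` of the chain and regrouping by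
`S'` turns the inner sum into `bigCD f S'`. -/
theorem bigCD_eq {U : Finset ι} (hU : IsBig f U) :
    bigCD f U = splitWeight f U + ∑ S ∈ U.powerset with IsBig f S ∧ S ≠ U,
      bigCD f S * bVar * eVar ^ (U.card - S.card - 1) := by
  have h1 : (U.powerset.filter fun S => IsBig f S) =
      insert U (U.powerset.filter fun S => IsBig f S ∧ S ≠ U) := by
    ext S
    simp only [mem_filter, mem_powerset, mem_insert]
    constructor
    · rintro ⟨h1, h2⟩
      by_cases h : S = U
      · exact Or.inl h
      · exact Or.inr ⟨h1, h2, h⟩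
    · rintro (rfl | ⟨h1, h2, -⟩)
      · exact ⟨subset_rfl, hU⟩
      · exact ⟨h1, h2⟩
  rw [bigCD, h1, sum_insert (by simp), upperWeight_self, mul_one]
  congr 1
  have h2 : ∀ S ∈ U.powerset.filter (fun S => IsBig f S ∧ S ≠ U),
      splitWeight f S * upperWeight U S =
        splitWeight f S * upperWeight S S * bVar * eVar ^ (U.card - S.card - 1) +
        ∑ S' ∈ U.powerset with S ⊂ S' ∧ S' ≠ U,
          splitWeight f S * upperWeight S' S * bVar * eVar ^ (U.card - S'.card - 1) := by
    intro S hS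
    simp only [mem_filter, mem_powerset] at hS
    rw [upperWeight_lower (hS.1.ssubset_of_ne hS.2.2), mul_add, upperWeight_self, mul_one, mul_sum]
    simp only [mul_assoc]
  rw [sum_congr rfl h2, sum_add_distrib]
  have h3 : ∀ S ∈ U.powerset.filter (fun S => IsBig f S ∧ S ≠ U),
      bigCD f S * bVar * eVar ^ (U.card - S.card - 1) =
        splitWeight f S * upperWeight S S * bVar * eVar ^ (U.card - S.card - 1) +
        ∑ S' ∈ S.powerset with IsBig f S' ∧ S' ≠ S,
          splitWeight f S' * upperWeight S S' * bVar * eVar ^ (U.card - S.card - 1) := by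
    intro S hS
    simp only [mem_filter, mem_powerset] at hS
    have h1 : (S.powerset.filter fun S' => IsBig f S') =
        insert S (S.powerset.filter fun S' => IsBig f S' ∧ S' ≠ S) := by
      ext S'
      simp only [mem_filter, mem_powerset, mem_insert]
      constructor
      · rintro ⟨h1, h2⟩
        by_cases h : S' = S
        · exact Or.inl h
        · exact Or.inr ⟨h1, h2, h⟩
      · rintro (rfl | ⟨h1, h2, -⟩)
        · exact ⟨subset_rfl, hS.2.1⟩
        · exact ⟨h1, h2⟩
    rw [bigCD, h1, sum_insert (by simp), add_mul, add_mul, sum_mul, sum_mul]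
  rw [sum_congr rfl h3, sum_add_distrib]
  congr 1
  rw [sum_sigma', sum_sigma']
  refine sum_bij' (fun x _ => ⟨x.2, x.1⟩) (fun x _ => ⟨x.2, x.1⟩) ?_ ?_ (fun _ _ => rfl)
    (fun _ _ => rfl) (fun _ _ => rfl)
  · rintro ⟨S, S'⟩ h
    simp only [mem_sigma, mem_filter, mem_powerset] at h ⊢
    exact ⟨⟨h.2.1, h.1.2.1.mono h.2.2.1.subset, h.2.2.2⟩, h.2.2.1.subset, h.1.2.1, h.2.2.1.ne⟩
  · rintro ⟨S', S⟩ h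
    simp only [mem_sigma, mem_filter, mem_powerset] at h ⊢
    refine ⟨⟨h.2.1.trans h.1.1, h.2.2.1, ?_⟩, h.1.1, h.2.1.ssubset_of_ne h.2.2.2, h.1.2.2⟩
    rintro rfl
    exact h.1.2.2 (h.1.1.antisymm h.2.1)

namespace RankTwoFace

theorem sum_eq {M : Type*} [AddCommMonoid M] {P : RankTwoFace f → Prop} [DecidablePred P]
    {F : RankTwoFace f → M} {Q : Finset ι × Finset ι → Prop} [DecidablePred Q]
    {R : Finset ι → Prop} [DecidablePred R] {G : Finset ι × Finset ι → M} {H : Finset ι → M}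
    (hQ : ∀ p hp, P (pair p hp) ↔ Q p) (hR : ∀ S hS, P (big S hS) ↔ R S)
    (hG : ∀ p hp, F (pair p hp) = G p) (hH : ∀ S hS, F (big S hS) = H S) :
    ∑ y with P y, F y = ∑ p ∈ splitPairs f with Q p, G p + ∑ S with IsBig f S ∧ R S, H S := by
  rw [sum_filter]
  have h1 : ∑ y, (if P y then F y else 0) =
      ∑ p : {p // p ∈ splitPairs f}, (if P (pair p.1 p.2) then F (pair p.1 p.2) else 0) +
      ∑ S : {S // IsBig f S}, (if P (big S.1 S.2) then F (big S.1 S.2) else 0) :=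
    Fintype.sum_sum_type _
  rw [h1]
  congr 1
  · simp_rw [hQ, hG]
    rw [sum_filter, ← sum_coe_sort (splitPairs f)]
  · simp_rw [hR, hH]
    rw [← filter_filter, sum_filter]
    exact (sum_subtype _ (by simp) fun S => if R S then H S else 0).symm

/-- The `ab`-index of a face. -/
def abIdx : RankTwoFace f → ABPoly
  | Sum.inl p => prodCD p.1.1.card p.1.2.card
  | Sum.inr S => bigCD f S.1

theorem abIdx_pair (p : Finset ι × Finset ι) (hp : p ∈ splitPairs f) :
    abIdx (pair p hp) = prodCD p.1.card p.2.card := rfl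

theorem abIdx_big (S : Finset ι) (hS : IsBig f S) : abIdx (big S hS) = bigCD f S := rfl

theorem rank_pair (p : Finset ι × Finset ι) (hp : p ∈ splitPairs f) :
    rank (pair p hp) = p.1.card + p.2.card - 1 := rfl

theorem rank_big (S : Finset ι) (hS : IsBig f S) : rank (big S hS) = S.card := rfl

/-- The faces below `{A, B}` correspond to the pairs of nonempty subsets of `A` and `B`. Orienting
such pairs is injective because `A` and `B` are disjoint, and weights are unaffected because
`prodCD` is symmetric. -/
theorem recursion_pair (p : Finset ι × Finset ι) (hp : p ∈ splitPairs f)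
    [DecidablePred fun y => y < pair p hp] :
    abIdx (pair p hp) = eVar ^ (rank (pair p hp) - 1) + ∑ y with y < pair p hp,
      abIdx y * bVar * eVar ^ (rank (pair p hp) - rank y - 1) := by
  have hs := (mem_splitPairs.1 hp).1
  have hsub : ∀ x ∈ (subPairs p.1 p.2).erase (p.1, p.2), IsSplit f x.1 x.2 := by
    intro x hx
    rw [mem_erase, mem_subPairs] at hx
    exact hs.mono hx.2.1.1 hx.2.2.1 hx.2.1.2 hx.2.2.2
  rw [abIdx_pair, prodCD_eq, rank_pair, Nat.sub_sub]
  congr 1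
  refine sum_bij (fun x hx => pair (orient x) (orient_mem_splitPairs (hsub x hx))) ?_ ?_ ?_ ?_
  · intro x hx
    have hxs := hsub x hx
    have hlt := card_lt_of_mem_subPairs (mem_erase.1 hx).2 (mem_erase.1 hx).1
    rw [mem_erase, mem_subPairs] at hx
    rw [mem_filter]
    have hle : pair (orient x) (orient_mem_splitPairs hxs) ≤ pair p hp := by
      rw [pair_le_pair]
      rcases orient_eq_or x with h | h
      · rw [h]; exact Or.inl ⟨hx.2.1.1, hx.2.2.1⟩
      · rw [h]; exact Or.inr ⟨hx.2.2.1, hx.2.1.1⟩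
    refine ⟨mem_univ _, lt_of_le_of_ne hle fun he => ?_⟩
    have hr := congrArg rank he
    rw [rank_pair, rank_pair] at hr
    have h1 := card_pos hp
    have h2 := Finset.card_pos.2 hxs.1
    rcases orient_eq_or x with h | h
    · rw [h] at hr; omega
    · rw [h] at hr; simp only [Prod.fst_swap, Prod.snd_swap] at hr; omega
  · intro x hx y hy he
    have hxs := hsub x hx
    have he' : orient x = orient y := congrArg Subtype.val (Sum.inl_injective he)
    rw [mem_erase, mem_subPairs] at hx hy
    have hd := disjoint_left.1 hs.disjoint
    have hno : x ≠ y.swap := by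
      rintro rfl
      obtain ⟨b, hb⟩ := hy.2.2.2
      exact hd (hx.2.1.1 hb) (hy.2.2.1 hb)
    rcases orient_eq_or x with h | h <;> rcases orient_eq_or y with h' | h' <;> rw [h, h'] at he'
    · exact he'
    · exact absurd he' hno
    · exact absurd (by rw [← he', Prod.swap_swap]) hno
    · exact Prod.swap_injective he'
  · intro y hy
    rw [mem_filter] at hy
    induction y using cases with
    | h1 q hq =>
      have hqs := (mem_splitPairs.1 hq)
      have hne : q ≠ p := by
        rintro rfl; exact lt_irrefl _ hy.2
      rcases pair_le_pair.1 hy.2.le with h | h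
      · refine ⟨q, mem_erase.2 ⟨fun h => hne h,
          mem_subPairs.2 ⟨⟨h.1, hqs.1.1⟩, h.2, hqs.1.2.1⟩⟩, ?_⟩
        congr 1
        exact orient_of_precedes hqs.2
      · refine ⟨q.swap, mem_erase.2 ⟨fun h' => ?_,
          mem_subPairs.2 ⟨⟨h.2, hqs.1.2.1⟩, h.1, hqs.1.1⟩⟩, ?_⟩
        · have h2 : q = p.swap := by rw [← Prod.swap_swap q, h']
          have := hqs.2
          rw [h2] at this
          exact this.asymm (mem_splitPairs.1 hp).2
        · congr 1
          exact orient_swap_of_precedes hqs.2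
    | h2 S hS => exact absurd hy.2.le not_big_le_pair
  · intro x hx
    have hxs := hsub x hx
    have h1 := Finset.card_pos.2 hxs.1
    have hlt := card_lt_of_mem_subPairs (mem_erase.1 hx).2 (mem_erase.1 hx).1
    rw [abIdx_pair, rank_pair]
    rcases orient_eq_or x with h | h
    · rw [h]
      congr 2
      omega
    · rw [h, Prod.fst_swap, Prod.snd_swap, prodCD_comm]
      congr 2
      omega

theorem recursion_big (S : Finset ι) (hS : IsBig f S) [DecidablePred fun y => y < big S hS] :
    abIdx (big S hS) = eVar ^ (rank (big S hS) - 1) + ∑ y with y < big S hS,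
      abIdx y * bVar * eVar ^ (rank (big S hS) - rank y - 1) := by
  have h := sum_eq (f := f) (P := fun y => y < big S hS)
    (F := fun y => abIdx y * bVar * eVar ^ (rank (big S hS) - rank y - 1))
    (Q := fun p => p.1 ∪ p.2 ⊆ S) (R := fun T => T ⊂ S)
    (G := fun p => prodCD p.1.card p.2.card * bVar * eVar ^ (S.card - p.1.card - p.2.card))
    (H := fun T => bigCD f T * bVar * eVar ^ (S.card - T.card - 1))
    (fun p hp => pair_lt_big) (fun T hT => big_lt_big)
    (fun p hp => by
      have := card_pos hp
      rw [abIdx_pair, rank_pair, rank_big]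
      congr 2
      omega)
    (fun T hT => by rw [abIdx_big, rank_big, rank_big])
  rw [h, abIdx_big, bigCD_eq hS, rank_big, splitWeight, add_assoc]
  congr 2
  refine sum_congr ?_ fun _ _ => rfl
  ext T
  simp only [mem_filter, mem_powerset, mem_univ, true_and]
  exact ⟨fun h => ⟨h.2.1, h.1.ssubset_of_ne h.2.2⟩, fun h => ⟨h.2.subset, h.1, h.2.ne⟩⟩

open Classical in
theorem recursion (x : RankTwoFace f) :
    abIdx x = eVar ^ (rank x - 1) + ∑ y with y < x,
      abIdx y * bVar * eVar ^ (rank x - rank y - 1) := by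
  induction x using cases with
  | h1 p hp => exact recursion_pair p hp
  | h2 S hS => exact recursion_big S hS

end RankTwoFace

end Formula

/-! ### Euler's relation for the faces of the base polytope -/

section Euler

variable {ι κ : Type*} [LinearOrder ι] [DecidableEq κ] {f : ι → κ}

theorem orient_swap {p : Finset ι × Finset ι} (h : IsSplit f p.1 p.2) :
    orient p.swap = orient p := by
  rcases precedes_or_precedes h.1 h.2.1 h.disjoint with hp | hp
  · rw [orient_of_precedes hp, orient_swap_of_precedes hp]
  · have : Precedes p.swap.1 p.swap.2 := hp
    rw [orient_of_precedes this]
    conv_rhs => rw [← Prod.swap_swap p]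
    rw [orient_swap_of_precedes this]

/-- The pair that splits off the class `c` from `T`. -/
def splitOff (f : ι → κ) (T : Finset ι) (c : κ) : Finset ι × Finset ι :=
  (T.filter fun x => f x = c, T.filter fun x => f x ≠ c)

theorem splitOff_union (T : Finset ι) (c : κ) : (splitOff f T c).1 ∪ (splitOff f T c).2 = T :=
  filter_union_filter_not_eq _ _

theorem isSplit_splitOff {T : Finset ι} (hT : 2 ≤ (T.image f).card) {c : κ} (hc : c ∈ T.image f) :
    IsSplit f (splitOff f T c).1 (splitOff f T c).2 := by
  obtain ⟨d, hd, hdc⟩ := exists_mem_ne hT c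
  obtain ⟨x, hx, rfl⟩ := mem_image.1 hc
  obtain ⟨y, hy, rfl⟩ := mem_image.1 hd
  refine ⟨⟨x, by simp [splitOff, hx]⟩, ⟨y, by simp [splitOff, hy, hdc]⟩, ?_, Or.inl ?_⟩
  · intro a ha b hb hab
    simp only [splitOff, mem_filter] at ha hb
    exact hb.2 (hab ▸ ha.2)
  · intro a ha b hb
    simp only [splitOff, mem_filter] at ha hb
    rw [ha.2, hb.2]

theorem eq_splitOff {A B : Finset ι} (h : IsSplit f A B) {a : ι} (ha : a ∈ A)
    (hA : ∀ x ∈ A, f x = f a) : (A, B) = splitOff f (A ∪ B) (f a) := by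
  refine Prod.ext ?_ ?_
  · ext x
    simp only [splitOff, mem_filter, mem_union]
    exact ⟨fun hx => ⟨Or.inl hx, hA x hx⟩,
      fun hx => hx.1.resolve_right fun hb => h.2.2.1 a ha x hb hx.2.symm⟩
  · ext x
    simp only [splitOff, mem_filter, mem_union]
    exact ⟨fun hx => ⟨Or.inr hx, (h.2.2.1 a ha x hx).symm⟩,
      fun hx => hx.1.resolve_left fun hb => hx.2 (hA x hb)⟩

variable [Fintype ι]

/-- One of the two sets lies in a class that the other avoids. As their union is `T`, it must be all
of `T` in that class. -/
theorem splitPairs_fiber {T : Finset ι} (hT : 2 ≤ (T.image f).card) :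
    (splitPairs f).filter (fun p => p.1 ∪ p.2 = T) =
      (T.image f).image fun c => orient (splitOff f T c) := by
  ext p
  simp only [mem_filter, mem_splitPairs]
  constructor
  · rintro ⟨⟨hs, hp⟩, rfl⟩
    rcases hs.2.2.2 with hA | hB
    · obtain ⟨a, ha⟩ := hs.1
      refine mem_image.2 ⟨f a, mem_image_of_mem f (mem_union_left _ ha), ?_⟩
      rw [← eq_splitOff hs ha fun x hx => hA x hx a ha]
      exact orient_of_precedes hp
    · obtain ⟨b, hb⟩ := hs.2.1
      refine mem_image.2 ⟨f b, mem_image_of_mem f (mem_union_right _ hb), ?_⟩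
      rw [union_comm, ← eq_splitOff hs.symm hb fun x hx => hB x hx b hb]
      exact orient_swap_of_precedes hp
  · intro h
    obtain ⟨c, hc, rfl⟩ := mem_image.1 h
    refine ⟨(isSplit_splitOff hT hc).orient, ?_⟩
    rcases orient_eq_or (splitOff f T c) with h | h
    · rw [h, splitOff_union]
    · rw [h, Prod.fst_swap, Prod.snd_swap, union_comm, splitOff_union]

theorem splitPairs_fiber_eq_empty {T : Finset ι} (hT : (T.image f).card < 2) :
    (splitPairs f).filter (fun p => p.1 ∪ p.2 = T) = ∅ := by
  refine filter_eq_empty_iff.2 fun p hp hpT => ?_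
  have hs := (mem_splitPairs.1 hp).1
  obtain ⟨a, ha⟩ := hs.1
  obtain ⟨b, hb⟩ := hs.2.1
  refine hT.not_ge (one_lt_card.2 ⟨f a, ?_, f b, ?_, hs.2.2.1 a ha b hb⟩)
  · exact mem_image_of_mem f (hpT ▸ mem_union_left _ ha)
  · exact mem_image_of_mem f (hpT ▸ mem_union_right _ hb)

theorem orient_splitOff_eq_of_card_two {T : Finset ι} (hT : (T.image f).card = 2) {c c' : κ}
    (hc : c ∈ T.image f) (hc' : c' ∈ T.image f) :
    orient (splitOff f T c) = orient (splitOff f T c') := by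
  by_cases hcc : c = c'
  · rw [hcc]
  have himg : T.image f = {c, c'} := (eq_of_subset_of_card_le
    (insert_subset hc (singleton_subset_iff.2 hc')) (by rw [hT, card_pair hcc])).symm
  have h1 : splitOff f T c = (splitOff f T c').swap := by
    have key : ∀ x ∈ T, f x = c ∨ f x = c' := fun x hx => by
      have := mem_image_of_mem f hx
      rw [himg] at this
      simpa using this
    refine Prod.ext (filter_congr fun x hx => ?_) (filter_congr fun x hx => ?_)
    · rcases key x hx with h | h <;> simp [h, hcc, Ne.symm hcc]
    · rcases key x hx with h | h <;> simp [h, hcc, Ne.symm hcc]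
  rw [h1, orient_swap (isSplit_splitOff hT.ge hc')]

theorem orient_splitOff_injOn {T : Finset ι} (hT : IsBig f T) :
    Set.InjOn (fun c => orient (splitOff f T c)) (T.image f) := by
  intro c hc c' hc' h
  simp only at h
  rw [mem_coe] at hc hc'
  by_contra hcc
  obtain ⟨x, hx, rfl⟩ := mem_image.1 hc
  obtain ⟨y, hy, rfl⟩ := mem_image.1 hc'
  have h1 : (splitOff f T (f x)).1 = (splitOff f T (f y)).1 ∨
      ((splitOff f T (f x)).1 = (splitOff f T (f y)).2) := by
    rcases orient_eq_or (splitOff f T (f x)) with h2 | h2 <;>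
    rcases orient_eq_or (splitOff f T (f y)) with h3 | h3 <;> rw [h2, h3] at h
    · exact Or.inl (congrArg Prod.fst h)
    · exact Or.inr (congrArg Prod.fst h)
    · exact Or.inr (congrArg Prod.snd h)
    · exact Or.inl (congrArg Prod.snd h)
  simp only [splitOff] at h1
  rcases h1 with h1 | h1
  · have : x ∈ T.filter fun z => f z = f y := h1 ▸ mem_filter.2 ⟨hx, rfl⟩
    exact hcc (mem_filter.1 this).2
  · have : T.image f ⊆ {f x, f y} := by
      intro c hc
      obtain ⟨z, hz, rfl⟩ := mem_image.1 hc
      by_cases hzy : f z = f y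
      · simp [hzy]
      · have : z ∈ T.filter fun z => f z = f x := h1.symm ▸ mem_filter.2 ⟨hz, hzy⟩
        simp [(mem_filter.1 this).2]
    have h2 := card_le_card this
    have h3 := card_le_two (a := f x) (b := f y)
    have h4 : 3 ≤ (T.image f).card := hT
    omega

/-- If `T` meets `k` classes, there are `k` product faces with support `T` for `k ≥ 3`, one for `k =
2` (both classes give the same pair) and none for `k < 2`. The count of the big face makes the
expression uniform in `k`, up to a correction at `T = ∅`. -/
theorem card_splitPairs_fiber (T : Finset ι) :
    ((if IsBig f T then 1 else 0 : ℤ)) - ((splitPairs f).filter fun p => p.1 ∪ p.2 = T).card =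
      1 - (T.image f).card - if T = ∅ then 1 else 0 := by
  have hE : T = ∅ ↔ (T.image f).card = 0 := by rw [card_eq_zero, image_eq_empty]
  by_cases h2 : (T.image f).card < 2
  · have hb : ¬ IsBig f T := fun h => by have : 3 ≤ (T.image f).card := h; omega
    rw [splitPairs_fiber_eq_empty h2, if_neg hb]
    by_cases h0 : T = ∅
    · simp [h0]
    · have : (T.image f).card = 1 := by
        have : (T.image f).card ≠ 0 := fun h => h0 (hE.2 h)
        omega
      simp [h0, this]
  · have h0 : T ≠ ∅ := fun h => by have := hE.1 h; omega
    rw [splitPairs_fiber (not_lt.1 h2), if_neg h0]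
    by_cases hb : IsBig f T
    · rw [if_pos hb, card_image_of_injOn (orient_splitOff_injOn hb)]; ring
    · have hcard : (T.image f).card = 2 := by
        have : ¬ 3 ≤ (T.image f).card := hb
        omega
      rw [if_neg hb, hcard]
      have : ((T.image f).image fun c => orient (splitOff f T c)).card = 1 := by
        refine le_antisymm (card_le_one.2 ?_) (card_pos.2 ?_)
        · intro p hp q hq
          obtain ⟨c, hc, rfl⟩ := mem_image.1 hp
          obtain ⟨c', hc', rfl⟩ := mem_image.1 hq
          exact orient_splitOff_eq_of_card_two hcard hc hc'
        · exact (card_pos.1 (by omega)).image _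
      rw [this]
      norm_num

/-- Count classes one at a time. For a fixed class both the sum over all `T` and the sum over the
`T` that avoid it vanish, since `S` has elements outside that class. -/
theorem sum_sign_card_image {S : Finset ι} (hS : IsBig f S) :
    ∑ T ∈ S.powerset, (-1 : ℤ) ^ T.card * (T.image f).card = 0 := by
  have h1 : ∀ T ∈ S.powerset, (-1 : ℤ) ^ T.card * (T.image f).card =
      ∑ c ∈ S.image f, ((-1 : ℤ) ^ T.card - if c ∉ T.image f then (-1 : ℤ) ^ T.card else 0) := by
    intro T hT
    rw [mem_powerset] at hT
    have : T.image f = (S.image f).filter fun c => c ∈ T.image f := by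
      ext c
      rw [mem_filter]
      exact ⟨fun h => ⟨image_subset_image hT h, h⟩, fun h => h.2⟩
    conv_lhs => rw [this, card_filter]
    rw [Nat.cast_sum, mul_sum]
    refine sum_congr rfl fun c _ => ?_
    by_cases hc : c ∈ T.image f <;> simp only [hc, if_true, if_false, not_true, not_false_iff] <;>
      simp
  have hne : S.Nonempty := card_pos.1 (by have := hS.card_le; omega)
  rw [sum_congr rfl h1, sum_comm]
  refine sum_eq_zero fun c _ => ?_
  rw [sum_sub_distrib, sum_powerset_neg_one_pow_card_of_nonempty hne, ← sum_filter]
  have h2 : (S.powerset.filter fun T => c ∉ T.image f) = (S.filter fun x => f x ≠ c).powerset := by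
    ext T
    simp only [mem_filter, mem_powerset, mem_image, not_exists, not_and]
    constructor
    · exact fun h x hx => mem_filter.2 ⟨h.1 hx, h.2 x hx⟩
    · exact fun h => ⟨fun x hx => (mem_filter.1 (h hx)).1, fun x hx => (mem_filter.1 (h hx)).2⟩
  rw [h2, sum_powerset_neg_one_pow_card_of_nonempty, sub_zero]
  obtain ⟨x, hx, y, hy, _, _, hxy, _, _⟩ := hS.exists_three
  by_cases hc : f x = c
  · exact ⟨y, mem_filter.2 ⟨hy, fun h => hxy (hc.trans h.symm)⟩⟩
  · exact ⟨x, mem_filter.2 ⟨hx, hc⟩⟩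

theorem sum_sign_splitPairs (S : Finset ι) (Q : Finset ι × Finset ι → Prop) [DecidablePred Q] :
    ∑ p ∈ splitPairs f with p.1 ∪ p.2 ⊆ S ∧ Q p, (-1 : ℤ) ^ (p.1.card + p.2.card - 1) =
      ∑ T ∈ S.powerset, -((-1 : ℤ) ^ T.card *
        (((splitPairs f).filter fun p => p.1 ∪ p.2 = T).filter Q).card) := by
  have hm : ∀ p ∈ (splitPairs f).filter (fun p => p.1 ∪ p.2 ⊆ S ∧ Q p),
      p.1 ∪ p.2 ∈ S.powerset := fun p hp => mem_powerset.2 (mem_filter.1 hp).2.1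
  rw [← sum_fiberwise_of_maps_to hm]
  refine sum_congr rfl fun T hT => ?_
  rw [mem_powerset] at hT
  have hf : ((splitPairs f).filter (fun p => p.1 ∪ p.2 ⊆ S ∧ Q p)).filter
      (fun p => p.1 ∪ p.2 = T) = ((splitPairs f).filter fun p => p.1 ∪ p.2 = T).filter Q := by
    ext p
    simp only [mem_filter]
    constructor
    · rintro ⟨⟨h1, -, h2⟩, h3⟩; exact ⟨⟨h1, h3⟩, h2⟩
    · rintro ⟨⟨h1, h3⟩, h2⟩; exact ⟨⟨h1, h3 ▸ hT, h2⟩, h3⟩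
  rw [hf, sum_congr rfl (g := fun _ => -(-1 : ℤ) ^ T.card), sum_const, nsmul_eq_mul]
  · ring
  · intro p hp
    simp only [mem_filter] at hp
    have hs := (mem_splitPairs.1 hp.1.1).1
    have h1 := hs.card_union
    rw [hp.1.2] at h1
    have := card_pos.2 hs.1
    rw [h1, show p.1.card + p.2.card = p.1.card + p.2.card - 1 + 1 by omega, pow_succ,
      Nat.add_sub_cancel]
    ring

theorem orient_splitOff_above_iff {A B T : Finset ι} (h : IsSplit f A B) (hT : A ∪ B ⊆ T)
    {c : κ} {q : Finset ι × Finset ι} (hq : q = orient (splitOff f T c)) :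
    ((A ⊆ q.1 ∧ B ⊆ q.2) ∨ (A ⊆ q.2 ∧ B ⊆ q.1)) ↔ (∀ a ∈ A, f a = c) ∨ ∀ b ∈ B, f b = c := by
  have hA := union_subset_left hT
  have hB := union_subset_right hT
  have h1 : ((A ⊆ q.1 ∧ B ⊆ q.2) ∨ (A ⊆ q.2 ∧ B ⊆ q.1)) ↔
      ((A ⊆ (splitOff f T c).1 ∧ B ⊆ (splitOff f T c).2) ∨
        (A ⊆ (splitOff f T c).2 ∧ B ⊆ (splitOff f T c).1)) := by
    rcases orient_eq_or (splitOff f T c) with h | h <;> rw [hq, h]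
    exact or_comm
  rw [h1]
  obtain ⟨a, ha⟩ := h.1
  obtain ⟨b, hb⟩ := h.2.1
  simp only [splitOff]
  constructor
  · rintro (h2 | h2)
    · exact Or.inl fun x hx => (mem_filter.1 (h2.1 hx)).2
    · exact Or.inr fun x hx => (mem_filter.1 (h2.2 hx)).2
  · rintro (h2 | h2)
    · exact Or.inl ⟨fun x hx => mem_filter.2 ⟨hA hx, h2 x hx⟩,
        fun x hx => mem_filter.2 ⟨hB hx, fun h3 => h.2.2.1 a ha x hx ((h2 a ha).trans h3.symm)⟩⟩
    · exact Or.inr ⟨fun x hx =>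
        mem_filter.2 ⟨hA hx, fun h3 => h.2.2.1 x hx b hb (h3.trans (h2 b hb).symm)⟩,
        fun x hx => mem_filter.2 ⟨hB hx, h2 x hx⟩⟩

open Classical in
-- The pairs above `{A, B}` with support `T` split off a class that contains `A` or `B`. If each of
-- `A` and `B` lies in one class, there are two such pairs for big `T`, and they coincide otherwise.
-- In the remaining case there is exactly one pair and `T` is big. Hence the difference does not
-- depend on `T`.
theorem card_splitPairs_fiber_above {A B T : Finset ι} (h : IsSplit f A B) (hT : A ∪ B ⊆ T) :
    ((if IsBig f T then 1 else 0 : ℤ)) - (((splitPairs f).filter fun p => p.1 ∪ p.2 = T).filter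
      fun q => (A ⊆ q.1 ∧ B ⊆ q.2) ∨ (A ⊆ q.2 ∧ B ⊆ q.1)).card =
      if IsBig f (A ∪ B) then 0 else -1 := by
  obtain ⟨a, ha⟩ := h.1
  obtain ⟨b, hb⟩ := h.2.1
  have hab := h.2.2.1 a ha b hb
  have hfa : f a ∈ T.image f := mem_image_of_mem f (hT (mem_union_left _ ha))
  have hfb : f b ∈ T.image f := mem_image_of_mem f (hT (mem_union_right _ hb))
  have h2 : 2 ≤ (T.image f).card := one_lt_card.2 ⟨_, hfa, _, hfb, hab⟩
  rw [splitPairs_fiber h2, filter_image]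
  have h3 : ((T.image f).filter fun c =>
      (A ⊆ (orient (splitOff f T c)).1 ∧ B ⊆ (orient (splitOff f T c)).2) ∨
        (A ⊆ (orient (splitOff f T c)).2 ∧ B ⊆ (orient (splitOff f T c)).1)) =
      (T.image f).filter fun c => (∀ a ∈ A, f a = c) ∨ ∀ b ∈ B, f b = c :=
    filter_congr fun c _ => orient_splitOff_above_iff h hT rfl
  rw [h3]
  have hbig : ∀ X Y : Finset ι, IsSplit f X Y → (∀ x ∈ X, ∀ x' ∈ X, f x = f x') →
      ¬ (∀ y ∈ Y, ∀ y' ∈ Y, f y = f y') → IsBig f (X ∪ Y) := by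
    intro X Y hs _ hY
    push Not at hY
    obtain ⟨y, hy, y', hy', hyy⟩ := hY
    obtain ⟨x, hx⟩ := hs.1
    exact two_lt_card_iff.2 ⟨f x, f y, f y', mem_image_of_mem f (mem_union_left _ hx),
      mem_image_of_mem f (mem_union_right _ hy), mem_image_of_mem f (mem_union_right _ hy'),
      hs.2.2.1 x hx y hy, hs.2.2.1 x hx y' hy', hyy⟩
  by_cases hA : ∀ x ∈ A, ∀ x' ∈ A, f x = f x'
  · by_cases hB : ∀ x ∈ B, ∀ x' ∈ B, f x = f x'
    · have himg : (A ∪ B).image f ⊆ {f a, f b} := by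
        intro c hc
        obtain ⟨x, hx, rfl⟩ := mem_image.1 hc
        rcases mem_union.1 hx with hx | hx
        · simp [hA x hx a ha]
        · simp [hB x hx b hb]
      have hnb : ¬ IsBig f (A ∪ B) := fun hbig => by
        have h4 := card_le_card himg
        have h5 := card_le_two (a := f a) (b := f b)
        have h6 : 3 ≤ ((A ∪ B).image f).card := hbig
        omega
      have hset : ((T.image f).filter fun c => (∀ a ∈ A, f a = c) ∨ ∀ b ∈ B, f b = c) =
          {f a, f b} := by
        ext c
        simp only [mem_filter, mem_insert, mem_singleton]
        constructor
        · rintro ⟨-, h4 | h4⟩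
          · exact Or.inl (h4 a ha).symm
          · exact Or.inr (h4 b hb).symm
        · rintro (rfl | rfl)
          · exact ⟨hfa, Or.inl fun x hx => hA x hx a ha⟩
          · exact ⟨hfb, Or.inr fun x hx => hB x hx b hb⟩
      rw [hset, if_neg hnb]
      by_cases hTb : IsBig f T
      · rw [if_pos hTb, card_image_of_injOn ((orient_splitOff_injOn hTb).mono _), card_pair hab]
        · norm_num
        · intro c hc
          rw [mem_coe, mem_insert, mem_singleton] at hc
          rcases hc with rfl | rfl
          · exact hfa
          · exact hfb
      · have hcard : (T.image f).card = 2 := by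
          have : ¬ 3 ≤ (T.image f).card := hTb
          omega
        rw [if_neg hTb, image_insert, image_singleton,
          orient_splitOff_eq_of_card_two hcard hfa hfb]
        simp
    · have hTb := hbig A B h hA hB
      have hset : ((T.image f).filter fun c => (∀ a ∈ A, f a = c) ∨ ∀ b ∈ B, f b = c) =
          {f a} := by
        ext c
        simp only [mem_filter, mem_singleton]
        constructor
        · rintro ⟨-, h4 | h4⟩
          · exact (h4 a ha).symm
          · exact absurd (fun x hx y hy => (h4 x hx).trans (h4 y hy).symm) hB
        · rintro rfl
          exact ⟨hfa, Or.inl fun x hx => hA x hx a ha⟩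
      rw [hset, if_pos hTb, if_pos (hTb.mono hT), image_singleton, card_singleton]
      norm_num
  · have hB := h.2.2.2.resolve_left hA
    have hTb := hbig B A h.symm hB hA
    rw [union_comm] at hTb
    have hset : ((T.image f).filter fun c => (∀ a ∈ A, f a = c) ∨ ∀ b ∈ B, f b = c) =
        {f b} := by
      ext c
      simp only [mem_filter, mem_singleton]
      constructor
      · rintro ⟨-, h4 | h4⟩
        · exact absurd (fun x hx y hy => (h4 x hx).trans (h4 y hy).symm) hA
        · exact (h4 b hb).symm
      · rintro rfl
        exact ⟨hfb, Or.inr fun x hx => hB x hx b hb⟩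
    rw [hset, if_pos hTb, if_pos (hTb.mono hT), image_singleton, card_singleton]
    norm_num

namespace RankTwoFace

open Classical in
theorem euler_bot {S : Finset ι} (hS : IsBig f S) :
    ∑ z with z ≤ big S hS, (-1 : ℤ) ^ rank z = -1 := by
  rw [sum_eq (f := f) (Q := fun p => p.1 ∪ p.2 ⊆ S ∧ True) (R := fun T => T ⊆ S)
    (G := fun p => (-1 : ℤ) ^ (p.1.card + p.2.card - 1)) (H := fun T => (-1 : ℤ) ^ T.card)
    (fun p hp => by rw [pair_le_big, and_true]) (fun T hT => big_le_big) (fun _ _ => rfl)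
    (fun _ _ => rfl), sum_sign_splitPairs]
  have h1 : ∑ T with IsBig f T ∧ T ⊆ S, (-1 : ℤ) ^ T.card =
      ∑ T ∈ S.powerset, (-1 : ℤ) ^ T.card * if IsBig f T then 1 else 0 := by
    simp_rw [mul_ite, mul_one, mul_zero]
    rw [← sum_filter]
    refine sum_congr ?_ fun _ _ => rfl
    ext T
    simp [and_comm]
  have hne : S.Nonempty := Finset.card_pos.1 (by have := hS.card_le; omega)
  rw [h1, ← sum_add_distrib, sum_congr rfl (g := fun T => (-1 : ℤ) ^ T.card -
    (-1 : ℤ) ^ T.card * (T.image f).card - if T = ∅ then 1 else 0)]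
  · rw [sum_sub_distrib, sum_sub_distrib, sum_sign_card_image hS,
      sum_powerset_neg_one_pow_card_of_nonempty hne, sum_ite_eq' S.powerset ∅]
    simp
  · intro T _
    rw [filter_true, neg_add_eq_sub, ← mul_sub, card_splitPairs_fiber]
    split_ifs with h
    · simp [h]
    · ring

open Classical in
-- Grouped by support, the faces above a product face contribute a constant times `(-1)^|T|`. The
-- constant is zero when `p.1 ∪ p.2` is big; otherwise `p.1 ∪ p.2 ≠ S`, and the alternating sum over
-- the Boolean interval vanishes.
theorem euler_interval {S : Finset ι} (hS : IsBig f S) {x : RankTwoFace f} (hx : x < big S hS) :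
    ∑ z with x ≤ z ∧ z ≤ big S hS, (-1 : ℤ) ^ rank z = 0 := by
  induction x using cases with
  | h1 p hp =>
    have hs := (mem_splitPairs.1 hp).1
    have hpS := pair_lt_big.1 hx
    rw [sum_eq (f := f) (Q := fun q => q.1 ∪ q.2 ⊆ S ∧
        ((p.1 ⊆ q.1 ∧ p.2 ⊆ q.2) ∨ (p.1 ⊆ q.2 ∧ p.2 ⊆ q.1)))
      (R := fun T => p.1 ∪ p.2 ⊆ T ∧ T ⊆ S)
      (G := fun p => (-1 : ℤ) ^ (p.1.card + p.2.card - 1)) (H := fun T => (-1 : ℤ) ^ T.card)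
      (fun q hq => by rw [pair_le_big, pair_le_pair, and_comm])
      (fun T hT => by rw [big_le_big, pair_le_big]) (fun _ _ => rfl) (fun _ _ => rfl),
      sum_sign_splitPairs]
    have h1 : ∑ T with IsBig f T ∧ p.1 ∪ p.2 ⊆ T ∧ T ⊆ S, (-1 : ℤ) ^ T.card =
        ∑ T ∈ S.powerset with p.1 ∪ p.2 ⊆ T, (-1 : ℤ) ^ T.card * if IsBig f T then 1 else 0 := by
      simp_rw [mul_ite, mul_one, mul_zero]
      rw [← sum_filter, filter_filter]
      refine sum_congr ?_ fun _ _ => rfl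
      ext T
      simp only [mem_filter, mem_univ, mem_powerset, true_and]
      tauto
    have h2 : ∑ T ∈ S.powerset, -((-1 : ℤ) ^ T.card *
        (((splitPairs f).filter fun p => p.1 ∪ p.2 = T).filter fun q =>
          ((p.1 ⊆ q.1 ∧ p.2 ⊆ q.2) ∨ (p.1 ⊆ q.2 ∧ p.2 ⊆ q.1))).card) =
        ∑ T ∈ S.powerset with p.1 ∪ p.2 ⊆ T, -((-1 : ℤ) ^ T.card *
        (((splitPairs f).filter fun p => p.1 ∪ p.2 = T).filter fun q =>
          ((p.1 ⊆ q.1 ∧ p.2 ⊆ q.2) ∨ (p.1 ⊆ q.2 ∧ p.2 ⊆ q.1))).card) := by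
      rw [sum_filter]
      refine sum_congr rfl fun T _ => ?_
      split_ifs with hT
      · rfl
      · rw [filter_eq_empty_iff.2]
        · simp
        · intro q hq hle
          rw [mem_filter] at hq
          apply hT
          rw [← hq.2]
          rcases hle with hle | hle
          · exact union_subset_union hle.1 hle.2
          · rw [union_comm q.1]
            exact union_subset_union hle.1 hle.2
    rw [h1, h2, ← sum_add_distrib, sum_congr rfl (g := fun T => (-1 : ℤ) ^ T.card *
      if IsBig f (p.1 ∪ p.2) then 0 else -1)]
    · rw [← sum_mul]
      by_cases hb : IsBig f (p.1 ∪ p.2)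
      · simp [hb]
      · have hne : p.1 ∪ p.2 ≠ S := fun h => hb (h ▸ hS)
        rw [sum_interval_sign_eq_zero (hpS.ssubset_of_ne hne), zero_mul]
    · intro T hT
      rw [mem_filter] at hT
      rw [neg_add_eq_sub, ← mul_sub, card_splitPairs_fiber_above hs hT.2]
  | h2 S₀ hS₀ =>
    have hlt := big_lt_big.1 hx
    rw [sum_eq (f := f) (Q := fun _ => False) (R := fun T => S₀ ⊆ T ∧ T ⊆ S)
      (G := fun p => (-1 : ℤ) ^ (p.1.card + p.2.card - 1)) (H := fun T => (-1 : ℤ) ^ T.card)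
      (fun p hp => iff_false_intro fun h => not_big_le_pair h.1)
      (fun T hT => by rw [big_le_big, big_le_big]) (fun _ _ => rfl) (fun _ _ => rfl),
      filter_false, sum_empty, zero_add, ← sum_interval_sign_eq_zero hlt]
    refine sum_congr ?_ fun _ _ => rfl
    ext T
    simp only [mem_filter, mem_univ, mem_powerset, true_and]
    exact ⟨fun h => ⟨h.2.2, h.2.1⟩, fun h => ⟨hS₀.mono h.2, h.2, h.1⟩⟩

theorem abIdx_mem_cd (x : RankTwoFace f) : abIdx x ∈ cdPolynomials := by
  induction x using WellFoundedLT.induction with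
  | ind x ih =>
    induction x using cases with
    | h1 p hp =>
      have := card_pos hp
      exact prodCD_mem_cd this.1 this.2
    | h2 S hS =>
      exact mem_cd_of_eulerian rank_strictMono one_le_rank (fun z _ => recursion z)
        (euler_bot hS) (fun x hx => euler_interval hS hx) ih

end RankTwoFace

theorem bigCD_mem_cd {S : Finset ι} (hS : IsBig f S) : bigCD f S ∈ cdPolynomials :=
  RankTwoFace.abIdx_mem_cd (RankTwoFace.big S hS)

end Euler

/-! ### The base polytope of a rank two matroid -/

section Geometry

variable {ι κ : Type*} {f : ι → κ}

theorem rankTwoMatroid_indep_iff [Finite ι] {I : Set ι} :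
    (rankTwoMatroid f).Indep I ↔ Set.InjOn f I ∧ I.ncard ≤ 2 := by
  simp [rankTwoMatroid]

theorem rankTwoMatroid_isBase_iff [Finite ι] (hf : ∃ i j, f i ≠ f j) {B : Set ι} :
    (rankTwoMatroid f).IsBase B ↔ ∃ i j, f i ≠ f j ∧ B = {i, j} := by
  have hpair : ∀ i j, f i ≠ f j → (rankTwoMatroid f).Indep {i, j} ∧ ({i, j} : Set ι).ncard = 2 := by
    intro i j hij
    have hne : i ≠ j := fun h => hij (h ▸ rfl)
    have h2 : ({i, j} : Set ι).ncard = 2 := Set.ncard_pair hne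
    refine ⟨rankTwoMatroid_indep_iff.2 ⟨?_, h2.le⟩, h2⟩
    rintro x (rfl | rfl) y (rfl | rfl) hxy
    · rfl
    · exact absurd hxy hij
    · exact absurd hxy.symm hij
    · rfl
  have hle : ∀ I, (rankTwoMatroid f).Indep I → I.ncard ≤ 2 :=
    fun I hI => (rankTwoMatroid_indep_iff.1 hI).2
  constructor
  · intro hB
    obtain ⟨i, j, hij⟩ := hf
    obtain ⟨hI, h2⟩ := hpair i j hij
    obtain ⟨B', hB', hsub⟩ := hI.exists_isBase_superset
    have h3 := Set.ncard_le_ncard hsub (Set.toFinite _)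
    have h4 := hle B hB.indep
    have h5 := hB.ncard_eq_ncard_of_isBase hB'
    obtain ⟨x, y, hxy, rfl⟩ := Set.ncard_eq_two.1 (show B.ncard = 2 by omega)
    exact ⟨x, y, fun h => hxy ((rankTwoMatroid_indep_iff.1 hB.indep).1 (by simp) (by simp) h), rfl⟩
  · rintro ⟨i, j, hij, rfl⟩
    obtain ⟨hI, h2⟩ := hpair i j hij
    obtain ⟨B', hB', hsub⟩ := hI.exists_isBase_superset
    have := Set.eq_of_subset_of_ncard_le hsub (by rw [h2]; exact hle _ hB'.indep) (Set.toFinite _)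
    rwa [this]

/-- The vertex `e_i + e_j`. -/
def crossVertex [DecidableEq ι] (f : ι → κ) (p : CrossPair f) : ι → ℝ :=
  Pi.single p.1.1 1 + Pi.single p.1.2 1

theorem basePolytope_rankTwoMatroid [Finite ι] [DecidableEq ι] (hf : ∃ i j, f i ≠ f j) :
    basePolytope (rankTwoMatroid f) = convexHull ℝ (Set.range (crossVertex f)) := by
  have hinc : ∀ i j, f i ≠ f j →
      incidence ({i, j} : Set ι) = (Pi.single i 1 + Pi.single j 1 : ι → ℝ) := by
    intro i j hij
    have hne : i ≠ j := fun h => hij (h ▸ rfl)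
    funext x
    by_cases hi : x = i
    · subst hi; simp [incidence, hne]
    · by_cases hj : x = j
      · subst hj; simp [incidence, hi]
      · simp [incidence, hi, hj]
  rw [basePolytope]
  congr 1
  ext x
  simp only [rankTwoMatroid_isBase_iff hf, Set.mem_ofPred_eq, Set.mem_range]
  constructor
  · rintro ⟨_, ⟨i, j, hij, rfl⟩, rfl⟩
    exact ⟨⟨(i, j), hij⟩, (hinc i j hij).symm⟩
  · rintro ⟨⟨⟨i, j⟩, hij⟩, rfl⟩
    exact ⟨_, ⟨i, j, hij, rfl⟩, (hinc i j hij).symm⟩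

theorem argmaxSet_eq {ν : Type*} {h : ν → ℝ} {M : ℝ} (hle : ∀ i, h i ≤ M) {i₀ : ν}
    (h0 : h i₀ = M) : argmaxSet h = {i | h i = M} := by
  ext i
  exact ⟨fun hi => (hle i).antisymm (h0 ▸ hi i₀), fun hi j => (hle j).trans_eq hi.symm⟩

variable [LinearOrder ι]

/-- When `A` lies in one class, take weight 2 on `A`, 1 on `B` and 0 elsewhere. No vertex uses two
elements of `A`, so the maximum is 3, attained exactly between `A` and `B`. -/
theorem exists_argmaxSet_eq_pairVertices {A B : Finset ι} (h : IsSplit f A B) :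
    ∃ w : ι → ℝ, pairVertices f A B = argmaxSet fun p : CrossPair f => w p.1.1 + w p.1.2 := by
  have main : ∀ A B : Finset ι, IsSplit f A B → (∀ a ∈ A, ∀ a' ∈ A, f a = f a') →
      ∃ w : ι → ℝ, pairVertices f A B = argmaxSet fun p : CrossPair f => w p.1.1 + w p.1.2 := by
    intro A B h hA
    let w : ι → ℝ := fun x => if x ∈ A then 2 else if x ∈ B then 1 else 0
    have hd := disjoint_left.1 h.disjoint
    obtain ⟨a, ha⟩ := h.1
    obtain ⟨b, hb⟩ := h.2.1
    have hbA : b ∉ A := fun h => hd h hb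
    refine ⟨w, ?_⟩
    rw [argmaxSet_eq (M := 3) (i₀ := ⟨(a, b), h.2.2.1 a ha b hb⟩)]
    · ext ⟨⟨x, y⟩, hxy⟩
      have hx := @hd x
      have hy := @hd y
      have hAA : ¬ (x ∈ A ∧ y ∈ A) := fun h => hxy (hA x h.1 y h.2)
      simp only [pairVertices, Set.mem_ofPred_eq, w]
      by_cases hxA : x ∈ A <;> by_cases hyA : y ∈ A <;> by_cases hxB : x ∈ B <;>
        by_cases hyB : y ∈ B <;> simp_all <;> norm_num
    · rintro ⟨⟨x, y⟩, hxy⟩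
      have hAA : ¬ (x ∈ A ∧ y ∈ A) := fun h => hxy (hA x h.1 y h.2)
      simp only [w]
      by_cases hxA : x ∈ A <;> by_cases hyA : y ∈ A <;> by_cases hxB : x ∈ B <;>
        by_cases hyB : y ∈ B <;> simp_all <;> norm_num
    · simp only [w, ha, hbA, hb, if_true, if_false]
      norm_num
  rcases h.2.2.2 with hA | hB
  · exact main A B h hA
  · obtain ⟨w, hw⟩ := main B A h.symm hB
    exact ⟨w, by rw [pairVertices_comm, hw]⟩

variable [DecidableEq κ]

theorem argmaxSet_eq_bigVertices {S : Finset ι} (h : IsBig f S) :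
    bigVertices f S = argmaxSet fun p : CrossPair f =>
      (if p.1.1 ∈ S then (1 : ℝ) else 0) + if p.1.2 ∈ S then 1 else 0 := by
  obtain ⟨x, hx, y, hy, _, _, hxy, _, _⟩ := h.exists_three
  rw [argmaxSet_eq (M := 2) (i₀ := ⟨(x, y), hxy⟩)]
  · ext ⟨⟨x, y⟩, hxy⟩
    simp only [bigVertices, Set.mem_ofPred_eq]
    split_ifs <;> simp_all
    norm_num
  · rintro ⟨⟨x, y⟩, hxy⟩
    simp only
    split_ifs <;> norm_num
  · simp only [hx, hy, if_true]
    norm_num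

variable [Fintype ι]

/-- The maximum is attained greedily: `i₀` is heaviest, `j₀` is heaviest outside the class of `i₀`.
If the elements of maximal weight meet three classes, they support a big face. Otherwise the face
pairs the heaviest elements of the class of `i₀` with the elements outside it of weight `w j₀`. -/
theorem exists_face_eq_argmaxSet (hf : IsBig f univ) (w : ι → ℝ) :
    ∃ x : RankTwoFace f, x.vertices = argmaxSet fun p : CrossPair f => w p.1.1 + w p.1.2 := by
  obtain ⟨a, -, -⟩ := hf.exists_three
  obtain ⟨i₀, -, hi₀⟩ := exists_max_image univ w ⟨a, mem_univ _⟩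
  obtain ⟨b, -, hb⟩ := hf.exists_ne i₀
  obtain ⟨j₀, hj₀, hmax⟩ := exists_max_image (univ.filter fun x => f i₀ ≠ f x) w ⟨b, by simp [hb]⟩
  simp only [mem_filter, mem_univ, true_and, forall_const] at hi₀ hj₀ hmax
  have hle : ∀ p : CrossPair f, w p.1.1 + w p.1.2 ≤ w i₀ + w j₀ := by
    rintro ⟨⟨x, y⟩, hxy⟩
    by_cases hx : f i₀ = f x
    · exact add_le_add (hi₀ x) (hmax y fun h => hxy (hx.symm.trans h))
    · have := hmax x hx
      have := hi₀ y
      simp only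
      linarith
  rw [argmaxSet_eq hle (i₀ := ⟨(i₀, j₀), hj₀⟩) rfl]
  set S : Finset ι := univ.filter fun x => w x = w i₀ with hS
  by_cases hc : w j₀ = w i₀ ∧ IsBig f S
  · refine ⟨RankTwoFace.big S hc.2, ?_⟩
    ext ⟨⟨x, y⟩, hxy⟩
    simp only [RankTwoFace.big, RankTwoFace.vertices, bigVertices, Set.mem_ofPred_eq, hS,
      mem_filter, mem_univ, true_and]
    have hx := hi₀ x
    have hy := hi₀ y
    rw [hc.1]
    exact ⟨fun h => by rw [h.1, h.2], fun h => ⟨by linarith, by linarith⟩⟩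
  · have hs : IsSplit f (univ.filter fun x => f i₀ = f x ∧ w x = w i₀)
        (univ.filter fun x => f i₀ ≠ f x ∧ w x = w j₀) := by
      refine ⟨⟨i₀, by simp⟩, ⟨j₀, by simp [hj₀]⟩, fun x hx y hy h => ?_, Or.inl fun x hx y hy => ?_⟩
      · simp only [mem_filter, mem_univ, true_and] at hx hy
        exact hy.1 (hx.1.trans h)
      · simp only [mem_filter, mem_univ, true_and] at hx hy
        exact hx.1.symm.trans hy.1
    obtain ⟨x, hx, -⟩ := RankTwoFace.exists_vertices_eq hs
    refine ⟨x, ?_⟩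
    rw [hx]
    ext ⟨⟨x, y⟩, hxy⟩
    have hxy' : f x ≠ f y := hxy
    simp only [pairVertices, Set.mem_ofPred_eq, mem_filter, mem_univ, true_and]
    have hx := hi₀ x
    have hy := hi₀ y
    by_cases h1 : f i₀ = f x
    · have h2 : f i₀ ≠ f y := fun h => hxy' (h1.symm.trans h)
      have := hmax y h2
      simp only [h1, true_and, hxy', not_true, false_and, or_false, ne_eq, not_false_iff]
      exact ⟨fun h => by rw [h.1, h.2], fun h => ⟨by linarith, by linarith⟩⟩
    · by_cases h2 : f i₀ = f y
      · have := hmax x h1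
        simp only [h2, true_and, not_true, false_and, false_or, ne_eq, not_false_iff, hxy'.symm]
        exact ⟨fun h => by rw [h.1, h.2, add_comm], fun h => ⟨by linarith, by linarith⟩⟩
      · have h3 := hmax x h1
        have h4 := hmax y h2
        simp only [h1, h2, false_and, or_false, and_false, false_iff]
        intro h
        -- A maximal vertex with both ends outside the class of `i₀` makes `i₀`, `x`, `y` equally
        -- heavy and in three classes, which is the case already excluded.
        have h5 : w j₀ = w i₀ := (hi₀ j₀).antisymm (by linarith)
        refine hc ⟨h5, two_lt_card_iff.2 ⟨f i₀, f x, f y, mem_image_of_mem f (by simp [hS]),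
          mem_image_of_mem f ?_, mem_image_of_mem f ?_, h1, h2, hxy'⟩⟩
        · simp only [hS, mem_filter, mem_univ, true_and]; linarith
        · simp only [hS, mem_filter, mem_univ, true_and]; linarith

theorem psi_rankTwoMatroid (hf : IsBig f univ) :
    psi (basePolytope (rankTwoMatroid f)) = bigCD f univ := by
  obtain ⟨i, -, j, -, -, -, hij, -, -⟩ := hf.exists_three
  rw [basePolytope_rankTwoMatroid ⟨i, j, hij⟩]
  have hl : ∀ (l : StrongDual ℝ (ι → ℝ)) (p : CrossPair f),
      l (crossVertex f p) = l (Pi.single p.1.1 1) + l (Pi.single p.1.2 1) :=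
    fun l p => map_add _ _ _
  have hw : ∀ w : ι → ℝ, ∃ l : StrongDual ℝ (ι → ℝ), ∀ p : CrossPair f,
      l (crossVertex f p) = w p.1.1 + w p.1.2 := by
    intro w
    refine ⟨∑ i, w i • ContinuousLinearMap.proj i, fun p => ?_⟩
    rw [hl]
    simp [Pi.single_apply]
  refine psi_convexHull_eq (v := crossVertex f) (W := RankTwoFace.vertices)
    (fun x y => RankTwoFace.le_iff) ?_ ?_ (t := RankTwoFace.big univ hf) ?_
    RankTwoFace.rank_strictMono RankTwoFace.one_le_rank RankTwoFace.exists_lt_rank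
    RankTwoFace.recursion
  · intro x
    induction x using RankTwoFace.cases with
    | h1 p hp =>
      have hs := (mem_splitPairs.1 hp).1
      obtain ⟨w, hw'⟩ := exists_argmaxSet_eq_pairVertices hs
      obtain ⟨l, hl'⟩ := hw w
      obtain ⟨a, ha⟩ := hs.1
      obtain ⟨b, hb⟩ := hs.2.1
      exact ⟨⟨⟨(a, b), hs.2.2.1 a ha b hb⟩, Or.inl ⟨ha, hb⟩⟩, l, by simp_rw [hl']; exact hw'⟩
    | h2 S hS =>
      obtain ⟨l, hl'⟩ := hw fun x => if x ∈ S then 1 else 0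
      obtain ⟨x, hx, y, hy, _, _, hxy, _, _⟩ := hS.exists_three
      exact ⟨⟨⟨(x, y), hxy⟩, hx, hy⟩, l, by simp_rw [hl']; exact argmaxSet_eq_bigVertices hS⟩
  · intro l
    simp_rw [hl]
    exact exists_face_eq_argmaxSet hf fun i => l (Pi.single i 1)
  · ext p
    simp [RankTwoFace.big, RankTwoFace.vertices, bigVertices]

end Geometry

/-! ### Splitting the base polytope -/

section Splitting

variable {ι κ : Type*} [LinearOrder κ]

/-- The three classes of elements before, in and after the class `i`. -/
def cmpClass (f : ι → κ) (i : κ) : ι → Ordering := fun x => cmp (f x) i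

theorem cmpClass_eq_lt {f : ι → κ} {i : κ} {x : ι} : cmpClass f i x = .lt ↔ f x < i :=
  cmp_eq_lt_iff _ _

theorem cmpClass_eq_eq {f : ι → κ} {i : κ} {x : ι} : cmpClass f i x = .eq ↔ f x = i :=
  cmp_eq_eq_iff _ _

theorem cmpClass_eq_gt {f : ι → κ} {i : κ} {x : ι} : cmpClass f i x = .gt ↔ i < f x :=
  cmp_eq_gt_iff _ _

/-- The elements of `T` in the classes up to `t`. -/
def cutBelow (f : ι → κ) (T : Finset ι) (t : κ) : Finset ι := T.filter fun x => f x ≤ t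

/-- The elements of `T` in the classes after `t`. -/
def cutAbove (f : ι → κ) (T : Finset ι) (t : κ) : Finset ι := T.filter fun x => t < f x

/-- The classes that meet `T`, except for the first and the last. -/
def innerClasses (f : ι → κ) (T : Finset ι) : Finset κ :=
  (T.image f).filter fun i => (∃ j ∈ T.image f, j < i) ∧ ∃ j ∈ T.image f, i < j

/-- The positions that cut the classes that meet `T` such that there are at least two classes on
both sides. -/
def innerCuts (f : ι → κ) (T : Finset ι) : Finset κ :=
  (innerClasses f T).filter fun t => ∃ j ∈ innerClasses f T, t < j

/-- The weight of the face `Δ_A × Δ_B`, where `(A, B)` is obtained by cutting `T` at `t`. -/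
def cutCD (f : ι → κ) (T : Finset ι) (t : κ) : ABPoly :=
  prodCD (cutBelow f T t).card (cutAbove f T t).card

theorem card_cutBelow_add (f : ι → κ) (T : Finset ι) (t : κ) :
    (cutBelow f T t).card + (cutAbove f T t).card = T.card := by
  unfold cutBelow cutAbove
  simp_rw [← not_le]
  exact card_filter_add_card_filter_not _

theorem mem_innerClasses {f : ι → κ} {T : Finset ι} {i : κ} :
    i ∈ innerClasses f T ↔
      (∃ x ∈ T, f x = i) ∧ (∃ x ∈ T, f x < i) ∧ ∃ x ∈ T, i < f x := by
  simp [innerClasses]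

theorem mem_innerCuts {f : ι → κ} {T : Finset ι} {t : κ} :
    t ∈ innerCuts f T ↔ t ∈ innerClasses f T ∧ ∃ j ∈ innerClasses f T, t < j := by
  simp [innerCuts]

theorem isBig_cmpClass_iff {f : ι → κ} {i : κ} {T : Finset ι} :
    IsBig (cmpClass f i) T ↔ i ∈ innerClasses f T := by
  have h1 : IsBig (cmpClass f i) T ↔ T.image (cmpClass f i) = univ := by
    have hcard : (univ : Finset Ordering).card = 3 := by decide
    constructor
    · intro h
      exact eq_of_subset_of_card_le (subset_univ _) (by rw [hcard]; exact h)
    · intro h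
      rw [IsBig, h, hcard]
  have h2 : T.image (cmpClass f i) = univ ↔ ∀ o : Ordering, o ∈ T.image (cmpClass f i) := by
    simp [Finset.ext_iff]
  rw [h1, h2, mem_innerClasses]
  constructor
  · intro h
    obtain ⟨x, hx, hx'⟩ := mem_image.1 (h .lt)
    obtain ⟨y, hy, hy'⟩ := mem_image.1 (h .eq)
    obtain ⟨z, hz, hz'⟩ := mem_image.1 (h .gt)
    exact ⟨⟨y, hy, cmpClass_eq_eq.1 hy'⟩, ⟨x, hx, cmpClass_eq_lt.1 hx'⟩,
      ⟨z, hz, cmpClass_eq_gt.1 hz'⟩⟩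
  · rintro ⟨⟨y, hy, hy'⟩, ⟨x, hx, hx'⟩, ⟨z, hz, hz'⟩⟩ o
    rw [mem_image]
    cases o
    · exact ⟨x, hx, cmpClass_eq_lt.2 hx'⟩
    · exact ⟨y, hy, cmpClass_eq_eq.2 hy'⟩
    · exact ⟨z, hz, cmpClass_eq_gt.2 hz'⟩

variable [LinearOrder ι]

theorem innerClasses_nonempty_iff {f : ι → κ} {T : Finset ι} :
    (innerClasses f T).Nonempty ↔ IsBig f T := by
  constructor
  · rintro ⟨i, hi⟩
    obtain ⟨⟨y, hy, rfl⟩, ⟨x, hx, hx'⟩, ⟨z, hz, hz'⟩⟩ := mem_innerClasses.1 hi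
    exact two_lt_card_iff.2 ⟨f x, f y, f z, mem_image_of_mem f hx, mem_image_of_mem f hy,
      mem_image_of_mem f hz, hx'.ne, (hx'.trans hz').ne, hz'.ne⟩
  · intro h
    obtain ⟨x, hx, y, hy, z, hz, hxy, hxz, hyz⟩ := h.exists_three
    have key : ∀ x ∈ T, ∀ y ∈ T, ∀ z ∈ T, f x < f y → f y < f z → (innerClasses f T).Nonempty :=
      fun x hx y hy z hz h1 h2 =>
        ⟨f y, mem_innerClasses.2 ⟨⟨y, hy, rfl⟩, ⟨x, hx, h1⟩, ⟨z, hz, h2⟩⟩⟩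
    rcases hxy.lt_or_gt with h1 | h1 <;> rcases hxz.lt_or_gt with h2 | h2 <;>
      rcases hyz.lt_or_gt with h3 | h3
    · exact key x hx y hy z hz h1 h3
    · exact key x hx z hz y hy h2 h3
    · exact absurd (h1.trans h3) h2.not_gt
    · exact key z hz x hx y hy h2 h1
    · exact key y hy x hx z hz h1 h2
    · exact absurd (h1.trans h2) h3.not_gt
    · exact key y hy z hz x hx h3 h2
    · exact key z hz y hy x hx h3 h1

/-- Only the last inner class fails to be a cut: the pieces form a row with one wall between
neighbours. -/
theorem card_innerClasses {f : ι → κ} {T : Finset ι} (h : (innerClasses f T).Nonempty) :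
    (innerClasses f T).card = (innerCuts f T).card + 1 := by
  have : innerCuts f T = (innerClasses f T).erase ((innerClasses f T).max' h) := by
    ext t
    rw [mem_innerCuts, mem_erase]
    constructor
    · rintro ⟨ht, j, hj, htj⟩
      exact ⟨(htj.trans_le (le_max' _ j hj)).ne, ht⟩
    · rintro ⟨hne, ht⟩
      exact ⟨ht, _, max'_mem _ h, lt_of_le_of_ne (le_max' _ t ht) hne⟩
  rw [this, card_erase_add_one (max'_mem _ h)]

variable {f : ι → κ}

/-- The pairs of disjoint sets that are not separated by a parallelism class. -/
def IsCrossing (f : ι → κ) (p : Finset ι × Finset ι) : Prop :=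
  p.1.Nonempty ∧ p.2.Nonempty ∧ (∀ a ∈ p.1, ∀ b ∈ p.2, f a ≠ f b) ∧ Precedes p.1 p.2

open Classical in
/-- The number of the pieces of a splitting with a given face, for faces that are separated. -/
theorem card_pieces_of_separated {A B S : Finset ι} (hS : IsBig f S) (hA : A.Nonempty)
    (hB : B.Nonempty) (hsub : A ∪ B ⊆ S) (hlt : ∀ a ∈ A, ∀ b ∈ B, f a < f b) :
    ((innerClasses f S).filter fun i => IsSplit (cmpClass f i) A B).card =
      ((innerCuts f S).filter fun t => A ⊆ cutBelow f S t ∧ B ⊆ cutAbove f S t).card + 1 := by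
  have hAS := union_subset_left hsub
  have hBS := union_subset_right hsub
  obtain ⟨a, ha, hmax⟩ := exists_max_image A f hA
  obtain ⟨b, hb, hmin⟩ := exists_min_image B f hB
  have hab := hlt a ha b hb
  have e1 : ((innerClasses f S).filter fun i => IsSplit (cmpClass f i) A B) =
      (innerClasses f S).filter fun i => f a ≤ i ∧ i ≤ f b := by
    refine filter_congr fun i _ => ⟨fun h => ?_, fun h => ?_⟩
    · have h1 := h.2.2.1 a ha b hb
      by_contra hn
      rw [not_and_or, not_le, not_le] at hn
      rcases hn with hn | hn
      · exact h1 (by rw [cmpClass_eq_gt.2 hn, cmpClass_eq_gt.2 (hn.trans hab)])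
      · exact h1 (by rw [cmpClass_eq_lt.2 hn, cmpClass_eq_lt.2 (hab.trans hn)])
    · refine ⟨hA, hB, fun x hx y hy hxy => ?_, ?_⟩
      · have h1 := (hmax x hx).trans h.1
        have h2 := h.2.trans (hmin y hy)
        rcases h1.lt_or_eq with h3 | h3
        · rw [cmpClass_eq_lt.2 h3] at hxy
          exact absurd (cmpClass_eq_lt.1 hxy.symm) h2.not_gt
        · rw [cmpClass_eq_eq.2 h3] at hxy
          have := hlt x hx y hy
          rw [cmpClass_eq_eq.1 hxy.symm, h3] at this
          exact lt_irrefl _ this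
      · rcases h.1.lt_or_eq with h3 | h3
        · refine Or.inl fun x hx y hy => ?_
          rw [cmpClass_eq_lt.2 ((hmax x hx).trans_lt h3), cmpClass_eq_lt.2 ((hmax y hy).trans_lt h3)]
        · refine Or.inr fun x hx y hy => ?_
          rw [cmpClass_eq_gt.2 (h3 ▸ hab.trans_le (hmin x hx)),
            cmpClass_eq_gt.2 (h3 ▸ hab.trans_le (hmin y hy))]
  have e2 : ((innerCuts f S).filter fun t => A ⊆ cutBelow f S t ∧ B ⊆ cutAbove f S t) =
      (innerCuts f S).filter fun t => f a ≤ t ∧ t < f b := by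
    refine filter_congr fun t _ => ⟨fun h => ?_, fun h => ⟨fun x hx => ?_, fun x hx => ?_⟩⟩
    · exact ⟨(mem_filter.1 (h.1 ha)).2, (mem_filter.1 (h.2 hb)).2⟩
    · exact mem_filter.2 ⟨hAS hx, (hmax x hx).trans h.1⟩
    · exact mem_filter.2 ⟨hBS hx, h.2.trans_le (hmin x hx)⟩
  rw [e1, e2]
  set I := (innerClasses f S).filter fun i => f a ≤ i ∧ i ≤ f b with hI
  -- If `f a` is not the first class of `S`, it is inner; if `f b` is not the last, it is inner.
  -- Otherwise every class of `S` lies between them, and any inner class will do.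
  have hIne : I.Nonempty := by
    obtain ⟨i, hi⟩ := innerClasses_nonempty_iff.2 hS
    by_cases h1 : ∃ x ∈ S, f x < f a
    · exact ⟨f a, mem_filter.2 ⟨mem_innerClasses.2 ⟨⟨a, hAS ha, rfl⟩, h1, ⟨b, hBS hb, hab⟩⟩,
        le_rfl, hab.le⟩⟩
    by_cases h2 : ∃ x ∈ S, f b < f x
    · exact ⟨f b, mem_filter.2 ⟨mem_innerClasses.2 ⟨⟨b, hBS hb, rfl⟩, ⟨a, hAS ha, hab⟩, h2⟩,
        hab.le, le_rfl⟩⟩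
    push Not at h1 h2
    obtain ⟨⟨x, hx, rfl⟩, -⟩ := mem_innerClasses.1 hi
    exact ⟨f x, mem_filter.2 ⟨hi, h1 x hx, h2 x hx⟩⟩
  -- The pieces that contain the face form an interval of the row, and the walls that contain it are
  -- those between consecutive pieces of this interval.
  have e3 : ((innerCuts f S).filter fun t => f a ≤ t ∧ t < f b) = I.erase (I.max' hIne) := by
    have hM := mem_filter.1 (I.max'_mem hIne)
    ext t
    rw [mem_filter, mem_innerCuts, mem_erase]
    refine Iff.trans ?_ (and_congr_right fun _ => mem_filter).symm
    constructor
    · rintro ⟨⟨ht, j, hj, htj⟩, hat, htb⟩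
      refine ⟨?_, ht, hat, htb.le⟩
      have hlt' : ∃ s ∈ I, t < s := by
        rcases le_or_gt j (f b) with h | h
        · exact ⟨j, mem_filter.2 ⟨hj, hat.trans htj.le, h⟩, htj⟩
        · obtain ⟨⟨x, hx, rfl⟩, -⟩ := mem_innerClasses.1 hj
          exact ⟨f b, mem_filter.2 ⟨mem_innerClasses.2
            ⟨⟨b, hBS hb, rfl⟩, ⟨a, hAS ha, hab⟩, ⟨x, hx, h⟩⟩, hab.le, le_rfl⟩, htb⟩
      obtain ⟨s, hs, hts⟩ := hlt'
      exact (hts.trans_le (le_max' _ s hs)).ne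
    · rintro ⟨hne, ht, hat, htb⟩
      have hlt' : t < I.max' hIne :=
        lt_of_le_of_ne (le_max' _ t (mem_filter.2 ⟨ht, hat, htb⟩)) hne
      exact ⟨⟨ht, _, hM.1, hlt'⟩, hat, hlt'.trans_le hM.2.2⟩
  rw [e3, card_erase_add_one (max'_mem _ _)]

open Classical in
/-- The number of the pieces of a splitting with a given face, for faces that are not separated. -/
theorem card_pieces_of_not_separated (hf : ∀ x y, f x < f y → x < y) {A B S : Finset ι}
    (hsub : A ∪ B ⊆ S) (hc : IsCrossing f (A, B)) (hlt : ¬ ∀ a ∈ A, ∀ b ∈ B, f a < f b) :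
    ((innerClasses f S).filter fun i => IsSplit (cmpClass f i) A B).card =
      if IsSplit f A B then 1 else 0 := by
  obtain ⟨hA, hB, hd, a₁, ha₁, ha₁'⟩ := hc
  simp only at hA hB hd ha₁ ha₁'
  have hAS := union_subset_left hsub
  have hBS := union_subset_right hsub
  push Not at hlt
  obtain ⟨a₀, ha₀, b₀, hb₀, hab₀⟩ := hlt
  have hba : f b₀ < f a₀ := lt_of_le_of_ne hab₀ (hd a₀ ha₀ b₀ hb₀).symm
  -- `a₁` comes before all of `B`, and the order on elements refines the order on classes, so the
  -- class of `b₀` lies strictly between two classes of `A`.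
  have hab : f a₁ < f b₀ :=
    lt_of_le_of_ne (not_lt.1 fun h => (hf _ _ h).not_gt (ha₁' b₀ hb₀)) (hd a₁ ha₁ b₀ hb₀)
  have key : ∀ i, IsSplit (cmpClass f i) A B ↔ ∀ b ∈ B, f b = i := by
    intro i
    constructor
    · intro h
      have h1 := h.2.2.1 a₁ ha₁ b₀ hb₀
      have h2 := h.2.2.1 a₀ ha₀ b₀ hb₀
      have hb : f b₀ = i := by
        rcases lt_trichotomy (f b₀) i with h3 | h3 | h3
        · exact absurd (by rw [cmpClass_eq_lt.2 h3, cmpClass_eq_lt.2 (hab.trans h3)]) h1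
        · exact h3
        · exact absurd (by rw [cmpClass_eq_gt.2 h3, cmpClass_eq_gt.2 (h3.trans hba)]) h2
      rcases h.2.2.2 with h3 | h3
      · have := h3 a₁ ha₁ a₀ ha₀
        rw [cmpClass_eq_lt.2 (hb ▸ hab)] at this
        exact absurd (cmpClass_eq_lt.1 this.symm) (hb ▸ hba).not_gt
      · intro b hbB
        have := h3 b hbB b₀ hb₀
        rw [cmpClass_eq_eq.2 hb] at this
        exact cmpClass_eq_eq.1 this
    · intro h
      refine ⟨hA, hB, fun x hx y hy hxy => ?_, Or.inr fun x hx y hy => ?_⟩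
      · rw [cmpClass_eq_eq.2 (h y hy)] at hxy
        exact hd x hx y hy ((cmpClass_eq_eq.1 hxy).trans (h y hy).symm)
      · rw [cmpClass_eq_eq.2 (h x hx), cmpClass_eq_eq.2 (h y hy)]
  simp_rw [key]
  split_ifs with hs
  · have hBc : ∀ b ∈ B, f b = f b₀ := by
      rcases hs.2.2.2 with h | h
      · exact absurd (h a₁ ha₁ a₀ ha₀) (hab.trans hba).ne
      · exact fun b hb => h b hb b₀ hb₀
    rw [card_eq_one]
    refine ⟨f b₀, ?_⟩
    ext i
    rw [mem_filter, mem_singleton]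
    constructor
    · exact fun h => (h.2 b₀ hb₀).symm
    · rintro rfl
      exact ⟨mem_innerClasses.2 ⟨⟨b₀, hBS hb₀, rfl⟩, ⟨a₁, hAS ha₁, hab⟩, ⟨a₀, hAS ha₀, hba⟩⟩, hBc⟩
  · rw [card_eq_zero, filter_eq_empty_iff]
    intro i _ h
    exact hs ⟨hA, hB, hd, Or.inr fun x hx y hy => (h x hx).trans (h y hy).symm⟩

/-- Both sets meet at least two classes, and the classes of `A` precede those of `B`. -/
def IsInner (f : ι → κ) (p : Finset ι × Finset ι) : Prop :=
  (∀ a ∈ p.1, ∀ b ∈ p.2, f a < f b) ∧ (∃ a ∈ p.1, ∃ a' ∈ p.1, f a < f a') ∧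
    ∃ b ∈ p.2, ∃ b' ∈ p.2, f b < f b'

open Classical in
-- For a separated pair there is one more piece than walls, and exactly one of the two indicators is
-- 1: failing to be split means that both sets meet two classes. For a non-separated pair no wall
-- contains the face and it is not inner; a piece that contains it must single out a class
-- containing `B`.
theorem card_pieces (hf : ∀ x y, f x < f y → x < y) {A B S : Finset ι} (hS : IsBig f S)
    (hsub : A ∪ B ⊆ S) (hc : IsCrossing f (A, B)) :
    ((innerClasses f S).filter fun i => IsSplit (cmpClass f i) A B).card =
      (if IsSplit f A B then 1 else 0) +
      ((innerCuts f S).filter fun t => A ⊆ cutBelow f S t ∧ B ⊆ cutAbove f S t).card +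
      if IsInner f (A, B) then 1 else 0 := by
  obtain ⟨hA, hB, hd, hp⟩ := id hc
  simp only at hA hB hd
  by_cases hlt : ∀ a ∈ A, ∀ b ∈ B, f a < f b
  · rw [card_pieces_of_separated hS hA hB hsub hlt]
    have hiff : IsInner f (A, B) ↔ ¬ IsSplit f A B := by
      have hconst : ∀ X : Finset ι, (∃ a ∈ X, ∃ a' ∈ X, f a < f a') ↔
          ¬ ∀ a ∈ X, ∀ a' ∈ X, f a = f a' := by
        intro X
        constructor
        · rintro ⟨a, ha, a', ha', h⟩ h'
          exact h.ne (h' a ha a' ha')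
        · intro h
          push Not at h
          obtain ⟨a, ha, a', ha', h⟩ := h
          rcases h.lt_or_gt with h | h
          · exact ⟨a, ha, a', ha', h⟩
          · exact ⟨a', ha', a, ha, h⟩
      constructor
      · rintro ⟨-, h1, h2⟩ h3
        rcases h3.2.2.2 with h4 | h4
        · exact (hconst A).1 h1 h4
        · exact (hconst B).1 h2 h4
      · intro h
        refine ⟨hlt, (hconst A).2 fun h1 => h ⟨hA, hB, hd, Or.inl h1⟩,
          (hconst B).2 fun h1 => h ⟨hA, hB, hd, Or.inr h1⟩⟩
    by_cases hs : IsSplit f A B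
    · rw [if_pos hs, if_neg fun h => hiff.1 h hs]; ring
    · rw [if_neg hs, if_pos (hiff.2 hs)]; ring
  · rw [card_pieces_of_not_separated hf hsub hc hlt,
      if_neg (c := IsInner f (A, B)) fun h => hlt h.1, add_zero, left_eq_add, card_eq_zero,
      filter_eq_empty_iff]
    rintro t _ ⟨h1, h2⟩
    exact hlt fun a ha b hb => (mem_filter.1 (h1 ha)).2.trans_lt (mem_filter.1 (h2 hb)).2

end Splitting

/-! ### The splitting formula -/

section Identity

variable {ι κ : Type*} [LinearOrder ι] [Fintype ι] [LinearOrder κ] {f : ι → κ}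

open Classical in
/-- The pairs of subsets of `S` that are not separated by a parallelism class. -/
def crossings (f : ι → κ) (S : Finset ι) : Finset (Finset ι × Finset ι) :=
  univ.filter fun p => p.1 ∪ p.2 ⊆ S ∧ IsCrossing f p

theorem mem_crossings {S : Finset ι} {p : Finset ι × Finset ι} :
    p ∈ crossings f S ↔ p.1 ∪ p.2 ⊆ S ∧ IsCrossing f p := by
  simp [crossings]

/-- The contribution of the face `Δ_A × Δ_B` to the weight of `S`. -/
def pairTerm (S : Finset ι) (p : Finset ι × Finset ι) : ABPoly :=
  prodCD p.1.card p.2.card * bVar * eVar ^ (S.card - p.1.card - p.2.card)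

open Classical in
theorem splitWeight_eq_sum_crossings {κ' : Type*} (g : ι → κ') (S : Finset ι)
    (h : ∀ x y, f x = f y → g x = g y) :
    splitWeight g S = eVar ^ (S.card - 1) +
      ∑ p ∈ crossings f S with IsSplit g p.1 p.2, pairTerm S p := by
  rw [splitWeight]
  congr 1
  refine sum_congr ?_ fun _ _ => rfl
  ext p
  simp only [mem_filter, mem_splitPairs, mem_crossings]
  constructor
  · rintro ⟨⟨h1, h2⟩, h3⟩
    exact ⟨⟨h3, h1.1, h1.2.1, fun a ha b hb hab => h1.2.2.1 a ha b hb (h _ _ hab), h2⟩, h1⟩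
  · rintro ⟨⟨h1, h2⟩, h3⟩
    exact ⟨⟨h3, h2.2.2.2⟩, h1⟩

theorem isCrossing_of_cut (hf : ∀ x y, f x < f y → x < y) {p : Finset ι × Finset ι}
    (h1 : p.1.Nonempty) (h2 : p.2.Nonempty) (h : ∀ a ∈ p.1, ∀ b ∈ p.2, f a < f b) :
    IsCrossing f p := by
  obtain ⟨a, ha⟩ := id h1
  exact ⟨h1, h2, fun a ha b hb => (h a ha b hb).ne, a, ha, fun b hb => hf _ _ (h a ha b hb)⟩

theorem cutBelow_union_cutAbove (T : Finset ι) (t : κ) : cutBelow f T t ∪ cutAbove f T t = T := by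
  ext x
  simp only [cutBelow, cutAbove, mem_union, mem_filter]
  have := le_or_gt (f x) t
  tauto

theorem lt_of_mem_cut {T : Finset ι} {t : κ} {a b : ι} (ha : a ∈ cutBelow f T t)
    (hb : b ∈ cutAbove f T t) : f a < f b :=
  (mem_filter.1 ha).2.trans_lt (mem_filter.1 hb).2

open Classical in
theorem cutCD_mul_aVar (hf : ∀ x y, f x < f y → x < y) {S : Finset ι} {t : κ}
    (ht : t ∈ innerCuts f S) :
    cutCD f S t * aVar = eVar ^ (S.card - 1) +
      ∑ p ∈ crossings f S with p.1 ⊆ cutBelow f S t ∧ p.2 ⊆ cutAbove f S t, pairTerm S p := by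
  obtain ⟨⟨x, hx, hxt⟩, -, ⟨z, hz, hzt⟩⟩ := mem_innerClasses.1 (mem_innerCuts.1 ht).1
  have hB : (cutBelow f S t).Nonempty := ⟨x, mem_filter.2 ⟨hx, hxt.le⟩⟩
  have hA : (cutAbove f S t).Nonempty := ⟨z, mem_filter.2 ⟨hz, hzt⟩⟩
  rw [cutCD, prodCD_mul_aVar hB hA, card_cutBelow_add]
  congr 1
  refine sum_congr ?_ fun _ _ => rfl
  ext p
  rw [mem_subPairs, mem_filter, mem_crossings]
  constructor
  · rintro ⟨⟨h1, h2⟩, h3, h4⟩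
    refine ⟨⟨?_, isCrossing_of_cut hf h2 h4 fun a ha b hb => lt_of_mem_cut (h1 ha) (h3 hb)⟩, h1, h3⟩
    exact (union_subset_union h1 h3).trans (cutBelow_union_cutAbove S t).subset
  · rintro ⟨⟨-, h⟩, h1, h2⟩
    exact ⟨⟨h1, h.1⟩, h2, h.2.1⟩

open Classical in
-- An inner pair `(A, B)` determines its wall: `T = A ∪ B`, and `t` is the last class of `A`.
theorem sum_innerCuts_eq (hf : ∀ x y, f x < f y → x < y) (S : Finset ι) :
    ∑ T ∈ S.powerset, ∑ t ∈ innerCuts f T, cutCD f T t * bVar * eVar ^ (S.card - T.card) =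
      ∑ p ∈ crossings f S with IsInner f p, pairTerm S p := by
  rw [sum_sigma']
  refine sum_bij (fun x _ => (cutBelow f x.1 x.2, cutAbove f x.1 x.2)) ?_ ?_ ?_ ?_
  · rintro ⟨T, t⟩ h
    simp only [mem_sigma, mem_powerset, mem_innerCuts, mem_innerClasses] at h
    obtain ⟨hTS, ⟨⟨y, hy, hyt⟩, ⟨x, hx, hxt⟩, -⟩, j, ⟨⟨w, hw, hwj⟩, -, z, hz, hzj⟩, htj⟩ := h
    have hyB : y ∈ cutBelow f T t := mem_filter.2 ⟨hy, hyt.le⟩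
    have hwA : w ∈ cutAbove f T t := mem_filter.2 ⟨hw, hwj ▸ htj⟩
    rw [mem_filter, mem_crossings]
    refine ⟨⟨(cutBelow_union_cutAbove T t).subset.trans hTS, isCrossing_of_cut hf ⟨y, hyB⟩ ⟨w, hwA⟩
      fun a ha b hb => lt_of_mem_cut ha hb⟩, fun a ha b hb => lt_of_mem_cut ha hb,
      ⟨x, mem_filter.2 ⟨hx, hxt.le⟩, y, hyB, hyt ▸ hxt⟩,
      ⟨w, hwA, z, mem_filter.2 ⟨hz, htj.trans hzj⟩, hwj ▸ hzj⟩⟩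
  · rintro ⟨T, t⟩ h ⟨T', t'⟩ h' he
    simp only [Prod.mk.injEq] at he
    have hT : T = T' := by
      rw [← cutBelow_union_cutAbove (f := f) T t, ← cutBelow_union_cutAbove (f := f) T' t', he.1,
        he.2]
    subst hT
    simp only [mem_sigma, mem_powerset, mem_innerCuts, mem_innerClasses] at h h'
    obtain ⟨-, ⟨⟨y, hy, hyt⟩, -⟩, -⟩ := h
    obtain ⟨-, ⟨⟨y', hy', hyt'⟩, -⟩, -⟩ := h'
    have h1 : y ∈ cutBelow f T t' := he.1 ▸ mem_filter.2 ⟨hy, hyt.le⟩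
    have h2 : y' ∈ cutBelow f T t := he.1.symm ▸ mem_filter.2 ⟨hy', hyt'.le⟩
    have : t = t' := le_antisymm (hyt ▸ (mem_filter.1 h1).2) (hyt' ▸ (mem_filter.1 h2).2)
    rw [this]
  · rintro ⟨A, B⟩ h
    rw [mem_filter, mem_crossings] at h
    obtain ⟨⟨hsub, hA, -⟩, hlt, ⟨a₁, ha₁, a₂, ha₂, ha⟩, b₁, hb₁, b₂, hb₂, hb⟩ := h
    obtain ⟨a, haA, hmax⟩ := exists_max_image A f hA
    simp only at hlt ha₁ ha₂ hb₁ hb₂ hsub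
    have e1 : cutBelow f (A ∪ B) (f a) = A := by
      ext x
      simp only [cutBelow, mem_filter, mem_union]
      refine ⟨fun h => h.1.resolve_right fun h' => (hlt a haA x h').not_ge h.2,
        fun h => ⟨Or.inl h, hmax x h⟩⟩
    have e2 : cutAbove f (A ∪ B) (f a) = B := by
      ext x
      simp only [cutAbove, mem_filter, mem_union]
      refine ⟨fun h => h.1.resolve_left fun h' => (hmax x h').not_gt h.2,
        fun h => ⟨Or.inr h, hlt a haA x h⟩⟩
    refine ⟨⟨A ∪ B, f a⟩, ?_, Prod.ext e1 e2⟩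
    simp only [mem_sigma, mem_powerset, mem_innerCuts, mem_innerClasses]
    exact ⟨hsub, ⟨⟨a, mem_union_left _ haA, rfl⟩,
      ⟨a₁, mem_union_left _ ha₁, ha.trans_le (hmax a₂ ha₂)⟩,
      ⟨b₁, mem_union_right _ hb₁, hlt a haA b₁ hb₁⟩⟩, f b₁, ⟨⟨b₁, mem_union_right _ hb₁, rfl⟩,
      ⟨a, mem_union_left _ haA, hlt a haA b₁ hb₁⟩, ⟨b₂, mem_union_right _ hb₂, hb⟩⟩,
      hlt a haA b₁ hb₁⟩
  · rintro ⟨T, t⟩ h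
    rw [pairTerm, cutCD, Nat.sub_sub, card_cutBelow_add]

/-- The coefficient of each pair is supplied by `card_pieces`; the pure powers of `e` match because
there is one more inner class than cuts. -/
theorem splitWeight_splitting (hf : ∀ x y, f x < f y → x < y) {S : Finset ι} (hS : IsBig f S) :
    splitWeight f S + ∑ t ∈ innerCuts f S, cutCD f S t * aVar +
        ∑ T ∈ S.powerset, ∑ t ∈ innerCuts f T, cutCD f T t * bVar * eVar ^ (S.card - T.card) =
      ∑ i ∈ innerClasses f S, splitWeight (cmpClass f i) S := by
  classical
  rw [sum_innerCuts_eq hf, sum_congr rfl fun t ht => cutCD_mul_aVar hf ht,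
    splitWeight_eq_sum_crossings f S fun _ _ h => h,
    sum_congr rfl fun i _ => splitWeight_eq_sum_crossings (f := f) (cmpClass f i) S
      fun x y h => by rw [cmpClass, cmpClass, h]]
  simp_rw [sum_add_distrib, sum_filter, sum_const]
  rw [sum_comm, sum_comm (s := innerClasses f S),
    card_innerClasses (innerClasses_nonempty_iff.2 hS), add_smul, one_smul]
  have key : ∀ p ∈ crossings f S,
      (∑ i ∈ innerClasses f S, if IsSplit (cmpClass f i) p.1 p.2 then pairTerm S p else 0) =
      (if IsSplit f p.1 p.2 then pairTerm S p else 0) +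
      (∑ t ∈ innerCuts f S, if p.1 ⊆ cutBelow f S t ∧ p.2 ⊆ cutAbove f S t then pairTerm S p else 0)
      + if IsInner f p then pairTerm S p else 0 := by
    intro p hp
    rw [mem_crossings] at hp
    have h := congrArg (· • pairTerm S p) (card_pieces hf hS hp.1 hp.2)
    simp only [add_smul, ite_smul, one_smul, zero_smul] at h
    rw [← sum_filter, ← sum_filter, sum_const, sum_const]
    exact h
  rw [sum_congr rfl key, sum_add_distrib, sum_add_distrib]
  abel

theorem bigCD_splitting (hf : ∀ x y, f x < f y → x < y) (U : Finset ι) [Fintype κ] :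
    bigCD f U + ∑ t ∈ innerCuts f U, cutCD f U t * cVar +
        ∑ T ∈ U.powerset with T ≠ U, ∑ t ∈ innerCuts f T,
          cutCD f T t * dVar * simplexCD (U \ T).card =
      ∑ i, bigCD (cmpClass f i) U := by
  classical
  have hcut : ∀ {S : Finset ι}, ¬ IsBig f S → innerCuts f S = ∅ := fun {S} h => by
    rw [← innerClasses_nonempty_iff, not_nonempty_iff_eq_empty] at h
    simp [innerCuts, h]
  have h1 : ∑ i, bigCD (cmpClass f i) U = ∑ S ∈ U.powerset with IsBig f S,
      (∑ i ∈ innerClasses f S, splitWeight (cmpClass f i) S) * upperWeight U S := by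
    simp_rw [bigCD, sum_mul, isBig_cmpClass_iff, sum_filter]
    rw [sum_comm]
    refine sum_congr rfl fun S _ => ?_
    rw [← sum_filter, filter_mem_eq_inter, univ_inter]
    split_ifs with h
    · rfl
    · rw [← innerClasses_nonempty_iff, not_nonempty_iff_eq_empty] at h
      simp [h]
  have h2 : ∑ S ∈ U.powerset with IsBig f S, (∑ t ∈ innerCuts f S, cutCD f S t * aVar) *
        upperWeight U S = ∑ T ∈ U.powerset, ∑ t ∈ innerCuts f T,
        cutCD f T t * aVar * upperWeight U T := by
    simp_rw [sum_mul]
    rw [sum_filter]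
    refine sum_congr rfl fun S _ => ?_
    split_ifs with h
    · rfl
    · rw [hcut h, sum_empty]
  have h3 : ∑ S ∈ U.powerset with IsBig f S, (∑ T ∈ S.powerset, ∑ t ∈ innerCuts f T,
        cutCD f T t * bVar * eVar ^ (S.card - T.card)) * upperWeight U S =
      ∑ T ∈ U.powerset, ∑ t ∈ innerCuts f T, cutCD f T t * bVar *
        if T = U then 1 else aVar * simplexCD (U \ T).card := by
    -- The restriction to big `S` can be dropped, since a set that is not big contains no `T` with a
    -- cut. This allows the sums over `S` and `T` to be exchanged.
    have e1 : ∀ S ∈ U.powerset, (if IsBig f S then (∑ T ∈ S.powerset, ∑ t ∈ innerCuts f T,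
        cutCD f T t * bVar * eVar ^ (S.card - T.card)) * upperWeight U S else 0) =
        ∑ T ∈ U.powerset, if T ⊆ S then ∑ t ∈ innerCuts f T,
          cutCD f T t * bVar * (eVar ^ (S.card - T.card) * upperWeight U S) else 0 := by
      intro S hS
      have hp : U.powerset.filter (fun T => T ⊆ S) = S.powerset := by
        ext T
        rw [mem_filter, mem_powerset, mem_powerset]
        exact ⟨fun h => h.2, fun h => ⟨h.trans (mem_powerset.1 hS), h⟩⟩
      rw [← sum_filter, hp]
      split_ifs with h
      · simp_rw [sum_mul, mul_assoc]
      · refine (sum_eq_zero fun T hT => ?_).symm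
        rw [hcut fun h' => h (h'.mono (mem_powerset.1 hT)), sum_empty]
    rw [sum_filter, sum_congr rfl e1, sum_comm]
    refine sum_congr rfl fun T hT => ?_
    rw [← sum_filter, sum_comm]
    refine sum_congr rfl fun t _ => ?_
    rw [← mul_sum, sum_eVar_mul_upperWeight (mem_powerset.1 hT)]
  have h0 : ∀ S ∈ U.powerset.filter (fun S => IsBig f S),
      (∑ i ∈ innerClasses f S, splitWeight (cmpClass f i) S) * upperWeight U S =
      splitWeight f S * upperWeight U S +
        (∑ t ∈ innerCuts f S, cutCD f S t * aVar) * upperWeight U S +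
        (∑ T ∈ S.powerset, ∑ t ∈ innerCuts f T,
          cutCD f T t * bVar * eVar ^ (S.card - T.card)) * upperWeight U S := fun S hS => by
    rw [← splitWeight_splitting hf (mem_filter.1 hS).2, add_mul, add_mul]
  rw [h1, sum_congr rfl h0, sum_add_distrib, sum_add_distrib, h2, h3, bigCD, add_assoc, add_assoc,
    ← sum_add_distrib]
  congr 1
  have hU : U.powerset = insert U (U.powerset.filter fun T => T ≠ U) := by
    ext T
    simp only [mem_insert, mem_filter, mem_powerset]
    refine ⟨fun h => ?_, fun h => ?_⟩
    · by_cases h' : T = U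
      · exact Or.inl h'
      · exact Or.inr ⟨h, h'⟩
    · rcases h with h | h
      · exact h.subset
      · exact h.1
  -- The term `T = U` yields `a + b = c`. For `T ≠ U` the wall gives `a · b` through `upperWeight`,
  -- the sum over larger `S` gives `b · a`, and together they make `d`.
  conv_rhs => rw [hU, sum_insert (by simp)]
  congr 1
  · rw [← sum_add_distrib]
    refine sum_congr rfl fun t _ => ?_
    rw [upperWeight_self, if_pos rfl, mul_one, mul_one, cVar, mul_add]
  · refine sum_congr rfl fun T hT => ?_
    rw [← sum_add_distrib]
    refine sum_congr rfl fun t _ => ?_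
    rw [upperWeight_of_ne (mem_filter.1 hT).2, if_neg (mem_filter.1 hT).2, dVar]
    noncomm_ring

end Identity

/-! ### Independence of the labels -/

section Relabel

variable {ι ι' κ κ' : Type*} [LinearOrder ι] [LinearOrder ι'] {f : ι → κ} {f' : ι' → κ'}

theorem isSplit_map_iff (e : ι' ≃o ι) (hf : ∀ x y, f' x = f' y ↔ f (e x) = f (e y))
    {A B : Finset ι'} :
    IsSplit f (A.map e.toEquiv.toEmbedding) (B.map e.toEquiv.toEmbedding) ↔ IsSplit f' A B := by
  simp [IsSplit, hf, e.surjective.forall]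

theorem precedes_map_iff (e : ι' ≃o ι) {A B : Finset ι'} :
    Precedes (A.map e.toEquiv.toEmbedding) (B.map e.toEquiv.toEmbedding) ↔ Precedes A B := by
  simp [Precedes, e.surjective.forall, e.surjective.exists]

variable [DecidableEq κ] [DecidableEq κ']

theorem isBig_iff {S : Finset ι} : IsBig f S ↔
    ∃ x ∈ S, ∃ y ∈ S, ∃ z ∈ S, f x ≠ f y ∧ f x ≠ f z ∧ f y ≠ f z := by
  refine ⟨IsBig.exists_three, ?_⟩
  rintro ⟨x, hx, y, hy, z, hz, h1, h2, h3⟩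
  exact two_lt_card_iff.2 ⟨f x, f y, f z, mem_image_of_mem f hx, mem_image_of_mem f hy,
    mem_image_of_mem f hz, h1, h2, h3⟩

theorem isBig_map_iff (e : ι' ≃o ι) (hf : ∀ x y, f' x = f' y ↔ f (e x) = f (e y))
    {S : Finset ι'} : IsBig f (S.map e.toEquiv.toEmbedding) ↔ IsBig f' S := by
  simp [isBig_iff, hf, e.surjective.exists]

variable [Fintype ι] [Fintype ι']

theorem splitWeight_map (e : ι' ≃o ι) (hf : ∀ x y, f' x = f' y ↔ f (e x) = f (e y))
    (S : Finset ι') : splitWeight f' S = splitWeight f (S.map e.toEquiv.toEmbedding) := by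
  rw [splitWeight, splitWeight, card_map]
  congr 1
  refine sum_equiv (e.toEquiv.finsetCongr.prodCongr e.toEquiv.finsetCongr) (fun p => ?_) ?_
  · simp only [mem_filter, mem_splitPairs, Equiv.prodCongr_apply, Prod.map_fst, Prod.map_snd,
      Equiv.finsetCongr_apply, isSplit_map_iff e hf, precedes_map_iff, ← map_union,
      map_subset_map]
  · intro p _
    simp

theorem bigCD_map (e : ι' ≃o ι) (hf : ∀ x y, f' x = f' y ↔ f (e x) = f (e y)) (U : Finset ι') :
    bigCD f' U = bigCD f (U.map e.toEquiv.toEmbedding) := by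
  refine sum_equiv e.toEquiv.finsetCongr (fun S => ?_) fun S _ => ?_
  · simp only [mem_filter, mem_powerset, Equiv.finsetCongr_apply, isBig_map_iff e hf,
      map_subset_map]
  · rw [splitWeight_map e hf, Equiv.finsetCongr_apply]
    simp only [upperWeight, map_inj, ← Finset.map_sdiff, card_map]

end Relabel

/-! ### Removing the auxiliary order on the ground set. -/

section Unordered

variable {ι ι' κ κ' : Type*} [Fintype ι] [Fintype ι']

theorem psi_rankTwoMatroid_congr [DecidableEq κ] [DecidableEq κ'] {f : ι → κ} {f' : ι' → κ'}
    (e : ι' ≃ ι) (hf : ∀ x y, f' x = f' y ↔ f (e x) = f (e y)) (hbig : IsBig f univ) :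
    psi (basePolytope (rankTwoMatroid f')) = psi (basePolytope (rankTwoMatroid f)) := by
  let _ : LinearOrder ι := LinearOrder.lift' (Fintype.equivFin ι) (Fintype.equivFin ι).injective
  let _ : LinearOrder ι' := LinearOrder.lift' e e.injective
  let e' : ι' ≃o ι := ⟨e, Iff.rfl⟩
  have hu : univ.map e'.toEquiv.toEmbedding = univ := map_univ_equiv e
  rw [psi_rankTwoMatroid hbig, psi_rankTwoMatroid, bigCD_map e' hf, hu]
  rw [← isBig_map_iff e' hf, hu]
  exact hbig

theorem psi_rankTwoMatroid_mem_cd [DecidableEq κ] {f : ι → κ} (hbig : IsBig f univ) :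
    psi (basePolytope (rankTwoMatroid f)) ∈ cdPolynomials := by
  let _ : LinearOrder ι := LinearOrder.lift' (Fintype.equivFin ι) (Fintype.equivFin ι).injective
  rw [psi_rankTwoMatroid hbig]
  exact bigCD_mem_cd hbig

theorem psi_rankTwoMatroid_splitting [LinearOrder κ] [Fintype κ] {f : ι → κ}
    (hbig : IsBig f univ) [DecidableEq (Finset ι)] :
    psi (basePolytope (rankTwoMatroid f)) + (∑ t ∈ innerCuts f univ, cutCD f univ t) * cVar +
        ∑ T : Finset ι with T ≠ univ, (∑ t ∈ innerCuts f T, cutCD f T t) * dVar *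
          simplexCD (Fintype.card ι - T.card) =
      ∑ i ∈ innerClasses f univ, psi (basePolytope (rankTwoMatroid (cmpClass f i))) := by
  -- The ground set is ordered lexicographically, class first, so that the order on elements refines
  -- that on classes.
  let g : ι → κ ×ₗ Fin (Fintype.card ι) := fun x => toLex (f x, Fintype.equivFin ι x)
  have hg : Function.Injective g := fun x y h =>
    (Fintype.equivFin ι).injective (congrArg (fun z => (ofLex z).2) h)
  let _ : LinearOrder ι := LinearOrder.lift' g hg
  have hf : ∀ x y, f x < f y → x < y := fun x y h => Prod.Lex.left _ _ h
  have h := bigCD_splitting hf univ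
  rw [psi_rankTwoMatroid hbig, sum_congr rfl fun i hi =>
    psi_rankTwoMatroid (isBig_cmpClass_iff.2 hi)]
  -- For other `i` fewer than three of the classes before, at and after `i` are met, so no set is
  -- big and the sum defining `bigCD` is empty.
  have h1 : ∑ i ∈ innerClasses f univ, bigCD (cmpClass f i) univ =
      ∑ i, bigCD (cmpClass f i) univ := by
    refine sum_subset (subset_univ _) fun i _ hi => ?_
    refine sum_eq_zero fun S hS => absurd ((mem_filter.1 hS).2.mono (subset_univ S)) ?_
    rwa [isBig_cmpClass_iff]
  rw [h1, ← h, sum_mul]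
  congr 1
  refine sum_congr (by ext; simp) fun T _ => ?_
  rw [card_univ_sdiff, sum_mul, sum_mul]

end Unordered

/-! ### Compositions and profiles -/

theorem length_filter_eq_sum {α : Type*} (p : α → Prop) [DecidablePred p] (l : List α) :
    (l.filter p).length = (l.map fun a => if p a then 1 else 0).sum := by
  induction l with
  | nil => rfl
  | cons a l ih => by_cases h : p a <;> simp [h, ih, add_comm]

theorem sum_filter_ne_zero (l : List ℕ) : (l.filter (· ≠ 0)).sum = l.sum := by
  induction l with
  | nil => rfl
  | cons a l ih => by_cases h : a = 0 <;> simp_all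

section WeakComposition

variable {k : ℕ} (β : Fin k → ℕ)

/-- The number of nonzero parts among the first parts, up to and including the part `t`. -/
def nonzeroUpTo (t : Fin k) : ℕ := (univ.filter fun j => j ≤ t ∧ β j ≠ 0).card

theorem length_deleteZeros : (deleteZeros β).length = (univ.filter fun j => β j ≠ 0).card := by
  rw [deleteZeros, length_filter_eq_sum, List.map_ofFn, List.sum_ofFn, card_filter]
  rfl

theorem sum_deleteZeros : (deleteZeros β).sum = ∑ j, β j := by
  rw [deleteZeros, sum_filter_ne_zero, List.sum_ofFn]

theorem deleteZeros_take (t : Fin k) : (deleteZeros β).take (nonzeroUpTo β t) =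
    ((List.ofFn β).take (t + 1)).filter (· ≠ 0) := by
  have h1 : deleteZeros β = ((List.ofFn β).take (t + 1)).filter (· ≠ 0) ++
      ((List.ofFn β).drop (t + 1)).filter (· ≠ 0) := by
    rw [← List.filter_append, List.take_append_drop, deleteZeros]
  have h2 : nonzeroUpTo β t = (((List.ofFn β).take (t + 1)).filter (· ≠ 0)).length := by
    rw [length_filter_eq_sum, List.map_take, List.map_ofFn, List.sum_take_ofFn, nonzeroUpTo,
      ← filter_filter, card_filter]
    refine sum_congr (filter_congr fun j _ => ?_) fun _ _ => rfl
    rw [Fin.le_def, Nat.lt_succ_iff]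
  rw [h1, h2, List.take_left]

theorem mu₁_deleteZeros (t : Fin k) :
    mu₁ (deleteZeros β) (nonzeroUpTo β t) = ∑ j with j ≤ t, β j := by
  rw [mu₁, deleteZeros_take, sum_filter_ne_zero, List.sum_take_ofFn]
  refine sum_congr (filter_congr fun j _ => ?_) fun _ _ => rfl
  rw [Fin.le_def, Nat.lt_succ_iff]

theorem mu₁_add_mu₂ (l : List ℕ) (i : ℕ) : mu₁ l i + mu₂ l i = l.sum :=
  List.sum_take_add_sum_drop l i

theorem one_le_mu₁_deleteZeros {i : ℕ} (h1 : 1 ≤ i) (h2 : i < (deleteZeros β).length) :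
    1 ≤ mu₁ (deleteZeros β) i := by
  have h : (deleteZeros β)[0]'(by omega) ∈ (deleteZeros β).take i :=
    List.mem_take_iff_getElem.2 ⟨0, by omega, rfl⟩
  have h0 : (deleteZeros β)[0]'(by omega) ≠ 0 := by
    have := (List.mem_filter.1 (List.mem_of_mem_take h)).2
    simpa using this
  exact (Nat.one_le_iff_ne_zero.2 h0).trans (List.le_sum_of_mem h)

theorem one_le_mu₂_deleteZeros {i : ℕ} (h2 : i < (deleteZeros β).length) :
    1 ≤ mu₂ (deleteZeros β) i := by
  have h : (deleteZeros β)[i] ∈ (deleteZeros β).drop i :=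
    List.mem_drop_iff_getElem.2 ⟨0, by omega, rfl⟩
  have h0 : (deleteZeros β)[i] ≠ 0 := by
    have := (List.mem_filter.1 (List.mem_of_mem_drop h)).2
    simpa using this
  exact (Nat.one_le_iff_ne_zero.2 h0).trans (List.le_sum_of_mem h)

end WeakComposition

/-! ### Profiles of subsets and the sum over cuts. -/

section Profile

variable {ι : Type*} {k : ℕ} (f : ι → Fin k)

/-- The numbers of elements of `T` in the classes. -/
def profile (T : Finset ι) (j : Fin k) : ℕ := (T.filter fun x => f x = j).card

theorem profile_ne_zero {T : Finset ι} {j : Fin k} : profile f T j ≠ 0 ↔ ∃ x ∈ T, f x = j := by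
  rw [profile, Finset.card_ne_zero, filter_nonempty_iff]

theorem card_filter_class (T : Finset ι) (P : Fin k → Prop) [DecidablePred P] :
    (T.filter fun x => P (f x)).card = ∑ j with P j, profile f T j := by
  rw [card_eq_sum_card_fiberwise (f := f) (t := univ.filter P) fun x hx => by
    simpa using (mem_filter.1 hx).2]
  refine sum_congr rfl fun j hj => ?_
  rw [profile, filter_filter]
  congr 1
  refine filter_congr fun x _ => ⟨fun h => h.2, fun h => ⟨?_, h⟩⟩
  rw [h]
  exact (mem_filter.1 hj).2

theorem sum_profile (T : Finset ι) : ∑ j, profile f T j = T.card := by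
  have := card_filter_class f T fun _ => True
  simpa using this.symm

/-- A cut `t` is numbered by the count `i` of nonzero parts up to and including it. At least two
classes on each side means `2 ≤ i ≤ ℓ - 2`, an empty range for `ℓ < 4` even with truncated
subtraction. -/
theorem sum_cutCD (T : Finset ι) : ∑ t ∈ innerCuts f T, cutCD f T t =
    ∑ i ∈ Icc 2 ((deleteZeros (profile f T)).length - 2),
      prodCD (mu₁ (deleteZeros (profile f T)) i) (mu₂ (deleteZeros (profile f T)) i) := by
  set β := profile f T with hβ
  set s : Finset (Fin k) := univ.filter fun j => β j ≠ 0 with hs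
  have hmem : ∀ {j}, j ∈ s ↔ ∃ x ∈ T, f x = j := fun {j} => by
    rw [hs, mem_filter, profile_ne_zero]; simp
  have hrank : ∀ t, nonzeroUpTo β t = (s.filter fun j => j ≤ t).card := fun t => by
    rw [nonzeroUpTo, hs, filter_filter]
    simp_rw [and_comm]
  have hrank' : ∀ t, nonzeroUpTo β t + (s.filter fun j => t < j).card = s.card := fun t => by
    rw [hrank, ← card_filter_add_card_filter_not (s := s) (fun j => j ≤ t)]
    simp_rw [not_le]
  have hcuts : ∀ t, t ∈ innerCuts f T ↔
      t ∈ s ∧ 2 ≤ nonzeroUpTo β t ∧ 2 ≤ (s.filter fun j => t < j).card := by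
    intro t
    rw [mem_innerCuts, mem_innerClasses]
    have h1 : ∀ i, (∃ x ∈ T, f x < i) ↔ ∃ j ∈ s, j < i := fun i => by
      simp only [hmem]
      exact ⟨fun ⟨x, hx, h⟩ => ⟨f x, ⟨x, hx, rfl⟩, h⟩, by rintro ⟨_, ⟨x, hx, rfl⟩, h⟩; exact ⟨x, hx, h⟩⟩
    have h2 : ∀ i, (∃ x ∈ T, i < f x) ↔ ∃ j ∈ s, i < j := fun i => by
      simp only [hmem]
      exact ⟨fun ⟨x, hx, h⟩ => ⟨f x, ⟨x, hx, rfl⟩, h⟩, by rintro ⟨_, ⟨x, hx, rfl⟩, h⟩; exact ⟨x, hx, h⟩⟩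
    simp only [mem_innerClasses, h1, h2, ← hmem]
    rw [hrank]
    constructor
    · rintro ⟨⟨ht, ⟨i, hi, hit⟩, -⟩, j, ⟨hj, -, l, hl, hjl⟩, htj⟩
      exact ⟨ht, one_lt_card.2 ⟨i, mem_filter.2 ⟨hi, hit.le⟩, t, mem_filter.2 ⟨ht, le_rfl⟩, hit.ne⟩,
        one_lt_card.2 ⟨j, mem_filter.2 ⟨hj, htj⟩, l, mem_filter.2 ⟨hl, htj.trans hjl⟩, hjl.ne⟩⟩
    · rintro ⟨ht, h1, h2⟩
      obtain ⟨i, hi, hit⟩ := exists_mem_ne h1 t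
      rw [mem_filter] at hi
      have hit := lt_of_le_of_ne hi.2 hit
      obtain ⟨j, hj, l, hl, hjl⟩ := one_lt_card.1 h2
      rw [mem_filter] at hj hl
      refine ⟨⟨ht, ⟨i, hi.1, hit⟩, j, hj⟩, ?_⟩
      rcases hjl.lt_or_gt with h | h
      · exact ⟨j, ⟨hj.1, ⟨t, ht, hj.2⟩, l, hl.1, h⟩, hj.2⟩
      · exact ⟨l, ⟨hl.1, ⟨t, ht, hl.2⟩, j, hj.1, h⟩, hl.2⟩
  rw [length_deleteZeros, ← hs]
  refine sum_bij (fun t _ => nonzeroUpTo β t) ?_ ?_ ?_ ?_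
  · intro t ht
    rw [hcuts] at ht
    rw [mem_Icc]
    have := hrank' t
    omega
  · intro t ht t' ht' he
    have key : ∀ {t t'}, t' ∈ s → nonzeroUpTo β t = nonzeroUpTo β t' → ¬ t < t' := by
      intro t t' ht' he hlt
      rw [hrank, hrank] at he
      refine he.not_lt (card_lt_card ⟨fun j hj => ?_, fun h => ?_⟩)
      · rw [mem_filter] at hj ⊢
        exact ⟨hj.1, hj.2.trans hlt.le⟩
      · exact (mem_filter.1 (h (mem_filter.2 ⟨ht', le_rfl⟩))).2.not_gt hlt
    rw [hcuts] at ht ht'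
    exact le_antisymm (not_lt.1 (key ht.1 he.symm)) (not_lt.1 (key ht'.1 he))
  · intro i hi
    rw [mem_Icc] at hi
    -- The `i`-th class that meets `T`; the enumeration of `s` starts at 0.
    let a : Fin s.card := ⟨i - 1, by omega⟩
    have hr : nonzeroUpTo β (s.orderEmbOfFin rfl a) = i := by
      have himg : (s.filter fun j => j ≤ s.orderEmbOfFin rfl a) =
          (Iic a).image (s.orderEmbOfFin rfl) := by
        ext j
        rw [mem_filter, mem_image]
        constructor
        · rintro ⟨hj, hja⟩
          rw [← image_orderEmbOfFin_univ s rfl, mem_image] at hj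
          obtain ⟨b, -, rfl⟩ := hj
          exact ⟨b, mem_Iic.2 ((s.orderEmbOfFin rfl).le_iff_le.1 hja), rfl⟩
        · rintro ⟨b, hb, rfl⟩
          exact ⟨orderEmbOfFin_mem _ _ _, (s.orderEmbOfFin rfl).le_iff_le.2 (mem_Iic.1 hb)⟩
      rw [hrank, himg, card_image_of_injective _ (s.orderEmbOfFin rfl).injective, Fin.card_Iic]
      show i - 1 + 1 = i
      omega
    refine ⟨s.orderEmbOfFin rfl a, ?_, hr⟩
    rw [hcuts]
    have := hrank' (s.orderEmbOfFin rfl a)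
    exact ⟨orderEmbOfFin_mem _ _ _, by omega, by omega⟩
  · intro t _
    have h1 : (cutBelow f T t).card = mu₁ (deleteZeros β) (nonzeroUpTo β t) := by
      rw [mu₁_deleteZeros, cutBelow, card_filter_class f T fun j => j ≤ t]
    have h2 := mu₁_add_mu₂ (deleteZeros β) (nonzeroUpTo β t)
    rw [sum_deleteZeros, hβ, sum_profile, ← hβ, ← card_cutBelow_add f T t, h1] at h2
    rw [cutCD, h1, Nat.add_left_cancel h2]

end Profile

/-! ### Counting the subsets with a given profile. -/

section Ground

variable {k : ℕ} (a : Fin k → ℕ)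

open Classical in
-- A subset is an independent choice of `β j` elements from each class.
theorem card_filter_profile (β : Fin k → ℕ) :
    (univ.filter fun T : Finset (Σ j, Fin (a j)) => profile Sigma.fst T = β).card =
      ∏ j, (a j).choose (β j) := by
  have : ∏ j, (a j).choose (β j) =
      (Fintype.piFinset fun j => (univ : Finset (Fin (a j))).powersetCard (β j)).card := by
    simp [Fintype.card_piFinset]
  rw [this]
  have hprof : ∀ (T : Finset (Σ j, Fin (a j))) j, profile Sigma.fst T j =
      (univ.filter fun y : Fin (a j) => (⟨j, y⟩ : Σ j, Fin (a j)) ∈ T).card := by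
    intro T j
    rw [profile, ← card_map (s := univ.filter fun y : Fin (a j) => (⟨j, y⟩ : Σ j, Fin (a j)) ∈ T)
      (Function.Embedding.sigmaMk (β := fun j => Fin (a j)) j)]
    congr 1
    ext ⟨i, y⟩
    simp only [mem_filter, mem_map, mem_univ, true_and, Function.Embedding.sigmaMk_apply]
    constructor
    · rintro ⟨h, rfl⟩
      exact ⟨y, h, rfl⟩
    · rintro ⟨z, hz, h⟩
      cases h
      exact ⟨hz, rfl⟩
  refine card_bij' (fun T _ j => univ.filter fun y => (⟨j, y⟩ : Σ j, Fin (a j)) ∈ T)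
    (fun t _ => univ.sigma t) ?_ ?_ ?_ ?_
  · intro T hT
    rw [Fintype.mem_piFinset]
    intro j
    rw [mem_powersetCard_univ, ← hprof, (mem_filter.1 hT).2]
  · intro t ht
    rw [Fintype.mem_piFinset] at ht
    rw [mem_filter]
    refine ⟨mem_univ _, funext fun j => ?_⟩
    rw [hprof, ← mem_powersetCard_univ.1 (ht j)]
    congr 1
    ext y
    simp
  · intro T _
    ext ⟨j, y⟩
    simp
  · intro t _
    funext j
    ext y
    simp

theorem profile_univ : profile Sigma.fst (univ : Finset (Σ j, Fin (a j))) = a := by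
  funext j
  rw [profile, ← Fintype.card_subtype]
  simpa using Fintype.card_congr (Equiv.sigmaSubtype (β := fun j => Fin (a j)) j)

theorem profile_le (T : Finset (Σ j, Fin (a j))) : profile Sigma.fst T ≤ a := by
  intro j
  conv_rhs => rw [← profile_univ a]
  exact card_le_card (filter_subset_filter _ (subset_univ _))

theorem profile_eq_iff {T : Finset (Σ j, Fin (a j))} : profile Sigma.fst T = a ↔ T = univ := by
  constructor
  · intro h
    rw [← card_eq_iff_eq_univ, ← sum_profile Sigma.fst T, ← card_univ,
      ← sum_profile Sigma.fst univ, h, profile_univ]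
  · rintro rfl
    exact profile_univ a

theorem sum_profile_comp {M : Type*} [AddCommMonoid M] [DecidableEq (Finset (Σ j, Fin (a j)))]
    (F : (Fin k → ℕ) → M) :
    ∑ T : Finset (Σ j, Fin (a j)) with T ≠ univ, F (profile Sigma.fst T) =
      ∑ β ∈ Iio a, (∏ j, (a j).choose (β j)) • F β := by
  classical
  have hmaps : ∀ T ∈ (univ : Finset (Finset (Σ j, Fin (a j)))).filter (fun T => T ≠ univ),
      profile Sigma.fst T ∈ Iio a := fun T hT =>
    mem_Iio.2 (lt_of_le_of_ne (profile_le a T) fun h =>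
      (mem_filter.1 hT).2 ((profile_eq_iff a).1 h))
  rw [← sum_fiberwise_of_maps_to hmaps]
  refine sum_congr rfl fun β hβ => ?_
  rw [← card_filter_profile, ← sum_const, filter_filter]
  refine sum_congr (filter_congr fun T _ => ?_) fun T hT => by rw [(mem_filter.1 hT).2]
  refine ⟨fun h => h.2, fun h => ⟨?_, h⟩⟩
  rintro rfl
  rw [profile_univ] at h
  exact (mem_Iio.1 hβ).ne h.symm

end Ground

/-! ### Translation to the blocks of a composition. -/

section Blocks

variable {l : List ℕ}

theorem isBig_ground (hl : ∀ p ∈ l, 0 < p) (h3 : 3 ≤ l.length) :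
    IsBig (fun x : Ground l => x.1) univ := by
  have : univ.image (fun x : Ground l => x.1) = univ := by
    refine eq_univ_of_forall fun j => mem_image.2 ⟨⟨j, ⟨0, hl _ (l.get_mem j)⟩⟩, mem_univ _, rfl⟩
  rw [IsBig, this, card_univ, Fintype.card_fin]
  exact h3

theorem mem_innerClasses_ground (hl : ∀ p ∈ l, 0 < p) {t : Fin l.length} :
    t ∈ innerClasses (fun x : Ground l => x.1) univ ↔ 1 ≤ (t : ℕ) ∧ (t : ℕ) + 1 < l.length := by
  have hex : ∀ j : Fin l.length, ∃ x : Ground l, x.1 = j := fun j =>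
    ⟨⟨j, ⟨0, hl _ (l.get_mem j)⟩⟩, rfl⟩
  rw [mem_innerClasses]
  simp only [mem_univ, true_and]
  constructor
  · rintro ⟨-, ⟨x, hx⟩, ⟨y, hy⟩⟩
    rw [Fin.lt_def] at hx hy
    have := y.1.2
    omega
  · rintro ⟨h1, h2⟩
    obtain ⟨x, hx⟩ := hex ⟨0, by omega⟩
    obtain ⟨y, hy⟩ := hex ⟨t + 1, h2⟩
    refine ⟨hex t, ⟨x, ?_⟩, ⟨y, ?_⟩⟩
    · rw [hx, Fin.lt_def]; exact h1
    · rw [hy, Fin.lt_def]; exact Nat.lt_succ_self _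

theorem card_ground_filter (P : Fin l.length → Prop) [inst : DecidablePred P] :
    Fintype.card {x : Ground l // P x.1} = ∑ j with P j, l.get j := by
  rw [Fintype.card_subtype, card_filter_class (fun x : Ground l => x.1) univ P]
  exact sum_congr rfl fun j _ => congrFun (profile_univ l.get) j

theorem sum_get_lt (i : ℕ) : ∑ j : Fin l.length with j.val < i, l.get j = (l.take i).sum := by
  rw [← List.sum_take_ofFn, List.ofFn_get]

theorem sum_get_ge (i : ℕ) : ∑ j : Fin l.length with ¬ j.val < i, l.get j = (l.drop i).sum := by
  have h1 := sum_filter_add_sum_filter_not (univ : Finset (Fin l.length)) (fun j => (j : ℕ) < i) l.get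
  have h2 := List.sum_take_add_sum_drop l i
  rw [sum_get_lt, ← List.sum_ofFn, List.ofFn_get] at h1
  omega

/-- The class of `M_{λ(α, i)}` as the comparison with the class `i`. -/
def lamClass : Fin 3 → Ordering := ![.lt, .eq, .gt]

theorem lamClass_injective : Function.Injective lamClass := by decide

/-- The two maps to `Ordering` have fibres of equal size, namely the three parts of `λ`, so a
bijection can be chosen fibre by fibre. The shift `t + 1` passes from positions counted from 0 to
parts counted from 1. -/
theorem exists_lam_equiv (l : List ℕ) (t : Fin l.length) :
    ∃ e : Ground (lam l (t + 1)) ≃ Ground l,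
      ∀ x, cmpClass (fun y : Ground l => y.1) t (e x) = lamClass x.1 := by
  have hcard : ∀ o : Ordering, Fintype.card {x : Ground (lam l (t + 1)) // lamClass x.1 = o} =
      Fintype.card {y : Ground l // cmp y.1 t = o} := by
    intro o
    -- The length of the list reduces to 3; naming its entries as a function on `Fin 3` lets the
    -- fibres be found by `decide`.
    obtain ⟨v, hv⟩ : ∃ v : Fin 3 → ℕ, v = (lam l (t + 1)).get := ⟨_, rfl⟩
    have h0 : Fintype.card {x : Ground (lam l (t + 1)) // lamClass x.1 = o} =
        ∑ j : Fin 3 with lamClass j = o, v j := by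
      rw [hv]
      exact card_ground_filter (l := lam l (t + 1)) (fun j => lamClass j = o)
          (inst := fun j => instDecidableEqOrdering (lamClass j) o)
    rw [h0, card_ground_filter fun j => cmp j t = o]
    cases o
    · have h1 : (univ.filter fun j : Fin 3 => lamClass j = .lt) =
        {(0 : Fin 3)} := by decide
      have h2 : (univ.filter fun j : Fin l.length => cmp j t = .lt) =
          univ.filter fun j : Fin l.length => (j : ℕ) < t := filter_congr fun j _ => by
        rw [cmp_eq_lt_iff, Fin.lt_def]
      rw [h1, h2, sum_get_lt, sum_singleton, hv]
      rfl
    · have h1 : (univ.filter fun j : Fin 3 => lamClass j = .eq) =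
        {(1 : Fin 3)} := by decide
      have h2 : (univ.filter fun j : Fin l.length => cmp j t = .eq) = {t} := by
        ext j
        simp
      rw [h1, h2, sum_singleton, sum_singleton, hv]
      show l.getD t 0 = l.get t
      simp
    · have h1 : (univ.filter fun j : Fin 3 => lamClass j = .gt) =
        {(2 : Fin 3)} := by decide
      have h2 : (univ.filter fun j : Fin l.length => cmp j t = .gt) =
          univ.filter fun j : Fin l.length => ¬ (j : ℕ) < t + 1 := filter_congr fun j _ => by
        rw [cmp_eq_gt_iff, Fin.lt_def, not_lt, Nat.succ_le_iff]
      rw [h1, h2, sum_get_ge, sum_singleton, hv]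
      rfl
  refine ⟨Equiv.ofFiberEquiv (f := fun x : Ground (lam l (t + 1)) => lamClass x.1)
    (g := fun y : Ground l => cmp y.1 t) fun o => Fintype.equivOfCardEq (hcard o), fun x => ?_⟩
  exact Equiv.ofFiberEquiv_map _ x

theorem psi_matroidOf_lam {t : Fin l.length}
    (ht : t ∈ innerClasses (fun x : Ground l => x.1) univ) :
    psi (basePolytope (matroidOf (lam l (t + 1)))) =
      psi (basePolytope (rankTwoMatroid (cmpClass (fun x : Ground l => x.1) t))) := by
  obtain ⟨e, he⟩ := exists_lam_equiv l t
  refine psi_rankTwoMatroid_congr e (fun x y => ?_) (isBig_cmpClass_iff.2 ht)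
  rw [he, he]
  exact lamClass_injective.eq_iff.symm

theorem sum_psi_simplex_prod {k : ℕ} (β : Fin k → ℕ) :
    ∑ i ∈ Icc 2 ((deleteZeros β).length - 2),
      psi (simplex (mu₁ (deleteZeros β) i) ×ˢ simplex (mu₂ (deleteZeros β) i)) =
    ∑ i ∈ Icc 2 ((deleteZeros β).length - 2),
      prodCD (mu₁ (deleteZeros β) i) (mu₂ (deleteZeros β) i) := by
  refine sum_congr rfl fun i hi => ?_
  rw [mem_Icc] at hi
  exact psi_simplex_prod (one_le_mu₁_deleteZeros β (by omega) (by omega))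
    (one_le_mu₂_deleteZeros β (by omega))

theorem psi_matroidOf_splitting (hl : ∀ p ∈ l, 0 < p) (h3 : 3 ≤ l.length) :
    psi (basePolytope (matroidOf l)) +
      (∑ i ∈ Icc 2 ((deleteZeros l.get).length - 2),
        psi (simplex (mu₁ (deleteZeros l.get) i) ×ˢ simplex (mu₂ (deleteZeros l.get) i))) * cVar +
      ∑ β ∈ (Iio l.get).filter (fun β => 4 ≤ (deleteZeros β).length),
        (∏ j, (l.get j).choose (β j)) •
          ((∑ i ∈ Icc 2 ((deleteZeros β).length - 2),
            psi (simplex (mu₁ (deleteZeros β) i) ×ˢ simplex (mu₂ (deleteZeros β) i))) *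
            dVar * psi (simplex (l.sum - (deleteZeros β).sum))) =
      ∑ i ∈ Icc 2 (l.length - 1), psi (basePolytope (matroidOf (lam l i))) := by
  classical
  have hsum : ∑ j, l.get j = l.sum := by rw [← List.sum_ofFn, List.ofFn_get]
  have h := psi_rankTwoMatroid_splitting (isBig_ground hl h3)
  simp_rw [sum_cutCD] at h
  have hc : Fintype.card (Ground l) = l.sum := by
    rw [Fintype.card_sigma, ← hsum]
    exact sum_congr rfl fun j _ => Fintype.card_fin _
  have hT : ∀ T : Finset (Ground l), T.card = (deleteZeros (profile (fun x => x.1) T)).sum :=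
    fun T => by rw [sum_deleteZeros, sum_profile]
  have hu : profile (fun x : Ground l => x.1) univ = l.get := profile_univ l.get
  simp_rw [hT, hc] at h
  rw [hu] at h
  have hs := sum_profile_comp l.get fun β =>
    (∑ i ∈ Icc 2 ((deleteZeros β).length - 2),
      prodCD (mu₁ (deleteZeros β) i) (mu₂ (deleteZeros β) i)) * dVar *
      simplexCD (l.sum - (deleteZeros β).sum)
  have h1 : ∑ i ∈ innerClasses (fun x : Ground l => x.1) univ,
      psi (basePolytope (rankTwoMatroid (cmpClass (fun x : Ground l => x.1) i))) =
      ∑ i ∈ Icc 2 (l.length - 1), psi (basePolytope (matroidOf (lam l i))) := by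
    refine sum_bij (fun t _ => (t : ℕ) + 1) ?_ ?_ ?_ ?_
    · intro t ht
      rw [mem_innerClasses_ground hl] at ht
      rw [mem_Icc]
      omega
    · intro t _ t' _ he
      exact Fin.ext (Nat.succ_injective he)
    · intro i hi
      rw [mem_Icc] at hi
      refine ⟨⟨i - 1, by omega⟩, (mem_innerClasses_ground hl).2 ⟨?_, ?_⟩, ?_⟩ <;>
        simp only <;> omega
    · intro t ht
      exact (psi_matroidOf_lam ht).symm
  rw [← h1, ← h, sum_psi_simplex_prod, hs, sum_filter]
  congr 1
  refine sum_congr rfl fun β hβ => ?_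
  rw [sum_psi_simplex_prod]
  split_ifs with h4
  -- A strictly smaller `β` leaves at least one element, so the simplex factor has at least one
  -- vertex.
  · have hlt : (deleteZeros β).sum < l.sum := by
      rw [sum_deleteZeros, ← hsum]
      obtain ⟨hle, j, hj⟩ := Pi.lt_def.1 (mem_Iio.1 hβ)
      exact sum_lt_sum (fun i _ => hle i) ⟨j, mem_univ _, hj⟩
    rw [psi_simplex (by omega), simplexCD]
  -- Fewer than four nonzero parts allow no cut, so the restriction `ℓ(β̄) ≥ 4` loses nothing.
  · rw [Icc_eq_empty (by omega), sum_empty, zero_mul, zero_mul, smul_zero]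

end Blocks

end RankTwoCD

end

theorem mainTheorem7 (n : ℕ) (α : Composition n) (hα : 3 ≤ α.length) :
    -- every `Ψ` below is a polynomial in `c` and `d`, i.e. the cd-indices exist
    RankTwoCD.psi (RankTwoCD.basePolytope (RankTwoCD.matroidOf α.blocks))
        ∈ RankTwoCD.cdPolynomials ∧
    (∀ i ∈ Finset.Icc 2 (α.length - 1),
      RankTwoCD.psi (RankTwoCD.basePolytope (RankTwoCD.matroidOf (RankTwoCD.lam α.blocks i)))
        ∈ RankTwoCD.cdPolynomials) ∧
    (∀ p q : ℕ, 1 ≤ p → 1 ≤ q →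
      RankTwoCD.psi (RankTwoCD.simplex p ×ˢ RankTwoCD.simplex q) ∈ RankTwoCD.cdPolynomials) ∧
    (∀ m : ℕ, 1 ≤ m → RankTwoCD.psi (RankTwoCD.simplex m) ∈ RankTwoCD.cdPolynomials) ∧
    -- the formula
    RankTwoCD.psi (RankTwoCD.basePolytope (RankTwoCD.matroidOf α.blocks)) =
      (∑ i ∈ Finset.Icc 2 (α.length - 1),
          RankTwoCD.psi
            (RankTwoCD.basePolytope (RankTwoCD.matroidOf (RankTwoCD.lam α.blocks i))))
        - (∑ i ∈ Finset.Icc 2 (α.length - 2),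
            RankTwoCD.psi (RankTwoCD.simplex (RankTwoCD.mu₁ α.blocks i) ×ˢ
              RankTwoCD.simplex (RankTwoCD.mu₂ α.blocks i))) * RankTwoCD.cVar
        - ∑ β ∈ (Finset.Iio α.blocksFun).filter
              (fun β => 4 ≤ (RankTwoCD.deleteZeros β).length),
            (∏ j, (α.blocksFun j).choose (β j)) •
              ((∑ i ∈ Finset.Icc 2 ((RankTwoCD.deleteZeros β).length - 2),
                  RankTwoCD.psi
                    (RankTwoCD.simplex (RankTwoCD.mu₁ (RankTwoCD.deleteZeros β) i) ×ˢ
                      RankTwoCD.simplex (RankTwoCD.mu₂ (RankTwoCD.deleteZeros β) i))) *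
                RankTwoCD.dVar *
                RankTwoCD.psi (RankTwoCD.simplex (n - (RankTwoCD.deleteZeros β).sum))) := by
  have hpos : ∀ p ∈ α.blocks, 0 < p := fun p hp => α.blocks_pos hp
  have hlen : α.blocks.length = α.length := rfl
  refine ⟨RankTwoCD.psi_rankTwoMatroid_mem_cd (RankTwoCD.isBig_ground hpos hα), fun i hi => ?_,
    fun p q hp hq => ?_, fun m hm => ?_, ?_⟩
  · obtain ⟨j, rfl⟩ : ∃ j, i = j + 1 := ⟨i - 1, by have := (Finset.mem_Icc.1 hi).1; omega⟩
    rw [Finset.mem_Icc] at hi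
    have ht := (RankTwoCD.mem_innerClasses_ground hpos (t := ⟨j, by omega⟩)).2
      ⟨by simp only; omega, by simp only; omega⟩
    exact (RankTwoCD.psi_matroidOf_lam ht).symm ▸
      RankTwoCD.psi_rankTwoMatroid_mem_cd (RankTwoCD.isBig_cmpClass_iff.2 ht)
  · rw [RankTwoCD.psi_simplex_prod hp hq]
    exact RankTwoCD.prodCD_mem_cd hp hq
  · rw [RankTwoCD.psi_simplex hm]
    exact RankTwoCD.prodCD_mem_cd hm le_rfl
  · have h := RankTwoCD.psi_matroidOf_splitting hpos hα
    -- The wall terms of the full set come with its profile, which has no zero parts to delete.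
    have hd : RankTwoCD.deleteZeros α.blocks.get = α.blocks := by
      rw [RankTwoCD.deleteZeros, List.ofFn_get]
      exact List.filter_eq_self.2 fun p hp => by simpa using (hpos p hp).ne'
    rw [hd, α.blocks_sum] at h
    rw [sub_sub, eq_sub_iff_add_eq, ← add_assoc]
    exact h
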